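/- Let $k$ be a field and let $H$ be a pointed Hopf algebra over $k$, i.e. every simple subcoalgebra of $H$ is one-dimensional. Let $\operatorname{corad}(H)=H_0$ be its coradical (the sum of all simple subcoalgebras), let $H_0\subseteq H_1\subseteq\cdots$ with $H_{n+1}=\Delta^{-1}(H_0\otimes H+H\otimes H_n)$ be its coradical filtration, and let $\operatorname{gr}_cH=\bigoplus_{n\ge 0}H_n/H_{n-1}$ (with $H_{-1}=0$) be the associated graded Hopf algebra. Let $\pi:\operatorname{gr}_cH\to\operatorname{corad}(H)$ be the projection onto degree zero and let $B=(\operatorname{gr}_cH)^{\operatorname{co}\pi}=\{a\in\operatorname{gr}_cH : (\mathrm{id}\otimes\pi)\Delta(a)=a\otimes 1\}$, with $B_n=B\cap(\operatorname{gr}_cH)_n$. If $\operatorname{gr}_cH$ is left or right Noetherian, then $\operatorname{corad}(H)$, $\operatorname{gr}_cH$, $H$ and $B$ are all affine, i.e. finitely generated as $k$-algebras. Here the algebra $B=\bigoplus_{n\ge0}B_n$, with $B_0=k1$, carries the structure of an $\mathbb N$-graded braided Hopf algebra in the category of left Yetter–Drinfel'd modules over $\operatorname{corad}(H)$ for which $\operatorname{gr}_cH$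 is isomorphic, as a graded Hopf algebra, to the Radford biproduct $B\,\sharp\operatorname{corad}(H)$ with grading $(B\,\sharp\operatorname{corad}(H))_n=B_n\otimes\operatorname{corad}(H)$. -/

import Mathlib

open scoped TensorProduct

noncomputable section

namespace PointedHopf

section Coalgebra

variable (k : Type*) {C : Type*} [Field k] [AddCommGroup C] [Module k C]

/-- For subspaces `X ⊆ C` and `Y ⊆ D`, the subspace `X ⊗ Y` of `C ⊗ D`. -/
def tensorSub {D : Type*} [AddCommGroup D] [Module k D] (X : Submodule k C) (Y : Submodule k D) :
    Submodule k (C ⊗[k] D) :=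
  Submodule.map₂ (TensorProduct.mk k C D) X Y

variable {k}

lemma tmul_mem_tensorSub {D : Type*} [AddCommGroup D] [Module k D] {X : Submodule k C}
    {Y : Submodule k D} {x : C} {y : D} (hx : x ∈ X) (hy : y ∈ Y) :
    x ⊗ₜ[k] y ∈ tensorSub k X Y :=
  Submodule.apply_mem_map₂ _ hx hy

lemma tensorSub_le {D : Type*} [AddCommGroup D] [Module k D] {X : Submodule k C}
    {Y : Submodule k D} {Z : Submodule k (C ⊗[k] D)} :
    tensorSub k X Y ≤ Z ↔ ∀ x ∈ X, ∀ y ∈ Y, x ⊗ₜ[k] y ∈ Z :=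
  Submodule.map₂_le

lemma tensorSub_mono {D : Type*} [AddCommGroup D] [Module k D] {X X' : Submodule k C}
    {Y Y' : Submodule k D} (hX : X ≤ X') (hY : Y ≤ Y') : tensorSub k X Y ≤ tensorSub k X' Y' :=
  Submodule.map₂_le_map₂ hX hY

lemma map_mem_tensorSub {D C' D' : Type*} [AddCommGroup D] [Module k D] [AddCommGroup C']
    [Module k C'] [AddCommGroup D'] [Module k D'] {X : Submodule k C} {Y : Submodule k D}
    {X' : Submodule k C'} {Y' : Submodule k D'} {f : C →ₗ[k] C'} {g : D →ₗ[k] D'}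
    (hf : ∀ x ∈ X, f x ∈ X') (hg : ∀ y ∈ Y, g y ∈ Y') {u : C ⊗[k] D}
    (hu : u ∈ tensorSub k X Y) : TensorProduct.map f g u ∈ tensorSub k X' Y' := by
  have : tensorSub k X Y ≤ (tensorSub k X' Y').comap (TensorProduct.map f g) := by
    rw [tensorSub_le]
    intro x hx y hy
    simpa using tmul_mem_tensorSub (hf x hx) (hg y hy)
  exact this hu

lemma mem_tensorSub_top {D : Type*} [AddCommGroup D] [Module k D] (u : C ⊗[k] D) :
    u ∈ tensorSub k (⊤ : Submodule k C) (⊤ : Submodule k D) := by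
  induction u with
  | zero => exact zero_mem _
  | tmul x y => exact tmul_mem_tensorSub trivial trivial
  | add x y hx hy => exact add_mem hx hy

lemma exists_proj (X : Submodule k C) :
    ∃ P : C →ₗ[k] C, (∀ x, P x ∈ X) ∧ ∀ x ∈ X, P x = x := by
  obtain ⟨g, hg⟩ := X.subtype.exists_leftInverse_of_injective X.ker_subtype
  refine ⟨X.subtype ∘ₗ g, fun x => (g x).2, fun x hx => ?_⟩
  simpa using congrArg Subtype.val (LinearMap.congr_fun hg ⟨x, hx⟩)

lemma exists_factor {V Z : Type*} [AddCommGroup V] [Module k V] [AddCommGroup Z] [Module k Z]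
    (T : C →ₗ[k] Z) (f : C →ₗ[k] V) (h : ∀ x, T x = 0 → f x = 0) :
    ∃ φ : Z →ₗ[k] V, f = φ ∘ₗ T := by
  obtain ⟨g, hg⟩ := ((LinearMap.ker T).liftQ T le_rfl).exists_leftInverse_of_injective
    (Submodule.ker_liftQ_eq_bot _ _ _ le_rfl)
  refine ⟨(LinearMap.ker T).liftQ f (fun x hx => h x hx) ∘ₗ g, ?_⟩
  ext x
  have := LinearMap.congr_fun hg ((LinearMap.ker T).mkQ x)
  simp only [LinearMap.comp_apply, Submodule.mkQ_apply, Submodule.liftQ_apply,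
    LinearMap.id_apply] at this
  simp only [LinearMap.comp_apply, this]
  rfl

lemma map_sub_left {D V W : Type*} [AddCommGroup D] [Module k D] [AddCommGroup V] [Module k V]
    [AddCommGroup W] [Module k W] (f f' : C →ₗ[k] V) (g : D →ₗ[k] W) (u : C ⊗[k] D) :
    TensorProduct.map (f - f') g u = TensorProduct.map f g u - TensorProduct.map f' g u := by
  induction u with
  | zero => simp
  | tmul x y => simp [TensorProduct.sub_tmul]
  | add x y hx hy => simp only [map_add, hx, hy]; abel

lemma map_sub_right {D V W : Type*} [AddCommGroup D] [Module k D] [AddCommGroup V] [Module k V]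
    [AddCommGroup W] [Module k W] (f : C →ₗ[k] V) (g g' : D →ₗ[k] W) (u : C ⊗[k] D) :
    TensorProduct.map f (g - g') u = TensorProduct.map f g u - TensorProduct.map f g' u := by
  induction u with
  | zero => simp
  | tmul x y => simp [TensorProduct.tmul_sub]
  | add x y hx hy => simp only [map_add, hx, hy]; abel

lemma map_eq_zero {D V W : Type*} [AddCommGroup D] [Module k D] [AddCommGroup V] [Module k V]
    [AddCommGroup W] [Module k W] {X : Submodule k C} {Y : Submodule k D} {f : C →ₗ[k] V}
    {g : D →ₗ[k] W} (h : (∀ x ∈ X, f x = 0) ∨ ∀ y ∈ Y, g y = 0) {u : C ⊗[k] D}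
    (hu : u ∈ tensorSub k X Y) : TensorProduct.map f g u = 0 := by
  have : tensorSub k X Y ≤ LinearMap.ker (TensorProduct.map f g) := by
    rw [tensorSub_le]
    intro x hx y hy
    rcases h with h | h
    · simp [h x hx]
    · simp [h y hy]
  exact this hu

lemma mem_of_map_mkQ_eq_zero {X Y : Submodule k C} {u : C ⊗[k] C}
    (hu : TensorProduct.map X.mkQ Y.mkQ u = 0) : u ∈ tensorSub k X ⊤ ⊔ tensorSub k ⊤ Y := by
  obtain ⟨P, hP, hP'⟩ := exists_proj X
  obtain ⟨R, hR, hR'⟩ := exists_proj Y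
  obtain ⟨φ, hφ⟩ := exists_factor X.mkQ (LinearMap.id - P)
    (fun x hx => by simp [hP' x (by simpa using hx)])
  obtain ⟨ψ, hψ⟩ := exists_factor Y.mkQ (LinearMap.id - R)
    (fun x hx => by simp [hR' x (by simpa using hx)])
  have h0 : TensorProduct.map (LinearMap.id - P) (LinearMap.id - R) u = 0 := by
    rw [hφ, hψ, TensorProduct.map_comp, LinearMap.comp_apply, hu, map_zero]
  have key : ∀ u : C ⊗[k] C, u - TensorProduct.map (LinearMap.id - P) (LinearMap.id - R) u ∈
      tensorSub k X ⊤ ⊔ tensorSub k ⊤ Y := by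
    intro u
    induction u with
    | zero => simp
    | add x y hx hy =>
      rw [map_add, add_sub_add_comm]
      exact add_mem hx hy
    | tmul a b =>
      have : a ⊗ₜ[k] b - TensorProduct.map (LinearMap.id - P) (LinearMap.id - R) (a ⊗ₜ[k] b) =
          P a ⊗ₜ[k] b + (a - P a) ⊗ₜ[k] R b := by
        simp only [TensorProduct.map_tmul, LinearMap.sub_apply, LinearMap.id_apply,
          TensorProduct.sub_tmul, TensorProduct.tmul_sub]
        abel
      rw [this]
      exact add_mem (Submodule.mem_sup_left (tmul_mem_tensorSub (hP a) trivial))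
        (Submodule.mem_sup_right (tmul_mem_tensorSub trivial (hR b)))
  simpa [h0] using key u

variable (k) [Coalgebra k C]

/-- A subspace `D` with `Δ(D) ⊆ D ⊗ D`. -/
def IsSubcoalgebra (D : Submodule k C) : Prop :=
  ∀ x ∈ D, Coalgebra.comul (R := k) x ∈ tensorSub k D D

/-- A nonzero subcoalgebra with no subcoalgebras but `0` and itself. -/
def IsSimpleSubcoalgebra (D : Submodule k C) : Prop :=
  IsSubcoalgebra k D ∧ D ≠ ⊥ ∧ ∀ E : Submodule k C, IsSubcoalgebra k E → E ≤ D → E = ⊥ ∨ E = D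

variable (C) in
/-- The coradical: the sum of all simple subcoalgebras. -/
def coradical : Submodule k C := sSup {D | IsSimpleSubcoalgebra k D}

variable (C) in
/-- A coalgebra is pointed if all its simple subcoalgebras are one-dimensional. -/
class IsPointed : Prop where
  finrank_eq_one : ∀ D : Submodule k C, IsSimpleSubcoalgebra k D → Module.finrank k D = 1

variable (C) in
/-- The coradical filtration: `C₀` is the coradical and
`Cₙ₊₁ = Δ⁻¹(C₀ ⊗ C + C ⊗ Cₙ)`. -/
def coradFilt : ℕ → Submodule k C
  | 0 => coradical k C
  | n + 1 => (tensorSub k (coradical k C) ⊤ ⊔ tensorSub k ⊤ (coradFilt n)).comap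
      (Coalgebra.comul (R := k) (A := C))

variable (C) in
/-- The preceding step of the coradical filtration: `Cₙ₋₁`, with `C₋₁ = 0`. -/
def coradPred : ℕ → Submodule k C
  | 0 => ⊥
  | n + 1 => coradFilt k C n


variable {k}

lemma isSubcoalgebra_coradical : IsSubcoalgebra k (coradical k C) := by
  have : coradical k C ≤ (tensorSub k (coradical k C) (coradical k C)).comap
      (Coalgebra.comul (R := k) (A := C)) := by
    refine sSup_le fun D hD x hx => ?_
    exact tensorSub_mono (le_sSup hD) (le_sSup hD) (hD.1 x hx)
  exact this

lemma mem_coradFilt_succ {n : ℕ} {x : C} : x ∈ coradFilt k C (n + 1) ↔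
    Coalgebra.comul (R := k) x ∈
      tensorSub k (coradical k C) ⊤ ⊔ tensorSub k ⊤ (coradFilt k C n) := Iff.rfl

lemma coradFilt_le_succ (n : ℕ) : coradFilt k C n ≤ coradFilt k C (n + 1) := by
  induction n with
  | zero =>
    intro x hx
    exact Submodule.mem_sup_left (tensorSub_mono le_rfl le_top (isSubcoalgebra_coradical x hx))
  | succ n ih =>
    exact Submodule.comap_mono (sup_le_sup le_rfl (tensorSub_mono le_rfl ih))

lemma coradFilt_mono : Monotone (coradFilt k C) := monotone_nat_of_le_succ coradFilt_le_succ

lemma coradPred_le (n : ℕ) : coradPred k C n ≤ coradFilt k C n := by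
  cases n with
  | zero => exact bot_le
  | succ n => exact coradFilt_le_succ n

lemma coradPred_mono : Monotone (coradPred k C) := by
  refine monotone_nat_of_le_succ fun n => ?_
  exact coradPred_le n

lemma coradFilt_le_coradPred {m n : ℕ} (h : m < n) : coradFilt k C m ≤ coradPred k C n := by
  cases n with
  | zero => omega
  | succ n => exact coradFilt_mono (by omega)

lemma map_comul_eq_zero_of_succ {V W : Type*} [AddCommGroup V] [Module k V] [AddCommGroup W]
    [Module k W] {n : ℕ} {f : C →ₗ[k] V} {g : C →ₗ[k] W} (hf : ∀ x ∈ coradical k C, f x = 0)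
    (hg : ∀ x ∈ coradFilt k C n, g x = 0) {x : C} (hx : x ∈ coradFilt k C (n + 1)) :
    TensorProduct.map f g (Coalgebra.comul (R := k) x) = 0 := by
  have : tensorSub k (coradical k C) ⊤ ⊔ tensorSub k ⊤ (coradFilt k C n) ≤
      LinearMap.ker (TensorProduct.map f g) :=
    sup_le (fun u hu => map_eq_zero (.inl hf) hu) (fun u hu => map_eq_zero (.inr hg) hu)
  exact this hx

/-- Coassociativity in the form `(f ⊗ (q ⊗ g)Δ)Δ = ((f ⊗ q)Δ ⊗ g)Δ`. -/
lemma map_comul_right {V W₁ W₂ : Type*} [AddCommGroup V] [Module k V] [AddCommGroup W₁]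
    [Module k W₁] [AddCommGroup W₂] [Module k W₂]
    (f : C →ₗ[k] V) (q : C →ₗ[k] W₁) (g : C →ₗ[k] W₂) (x : C) :
    TensorProduct.map f (TensorProduct.map q g ∘ₗ Coalgebra.comul) (Coalgebra.comul (R := k) x) =
      TensorProduct.assoc k V W₁ W₂
        (TensorProduct.map (TensorProduct.map f q ∘ₗ Coalgebra.comul) g
          (Coalgebra.comul (R := k) x)) := by
  have h1 : TensorProduct.map f (TensorProduct.map q g ∘ₗ Coalgebra.comul (R := k)) =
      TensorProduct.map f (TensorProduct.map q g) ∘ₗ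
        (Coalgebra.comul (R := k) (A := C)).lTensor C := by
    ext; simp
  have h2 : TensorProduct.map (TensorProduct.map f q ∘ₗ Coalgebra.comul (R := k)) g =
      TensorProduct.map (TensorProduct.map f q) g ∘ₗ
        (Coalgebra.comul (R := k) (A := C)).rTensor C := by
    ext; simp
  rw [h1, h2, LinearMap.comp_apply, LinearMap.comp_apply, ← Coalgebra.coassoc_apply,
    TensorProduct.map_map_assoc]

lemma map_comul_eq_zero_right {V W : Type*} [AddCommGroup V] [Module k V] [AddCommGroup W]
    [Module k W] {n : ℕ} (f : C →ₗ[k] V) {g : C →ₗ[k] W}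
    (hg : ∀ x ∈ coradFilt k C n, g x = 0) {x : C} (hx : x ∈ coradFilt k C n) :
    TensorProduct.map f g (Coalgebra.comul (R := k) x) = 0 := by
  cases n with
  | zero => exact map_eq_zero (.inr hg) (isSubcoalgebra_coradical x hx)
  | succ n =>
    obtain ⟨φ, rfl⟩ := exists_factor (TensorProduct.map (coradical k C).mkQ
      (coradFilt k C n).mkQ ∘ₗ Coalgebra.comul) g
      (fun x hx => hg x (mem_of_map_mkQ_eq_zero hx))
    rw [← LinearMap.id_comp f, TensorProduct.map_comp, LinearMap.comp_apply, map_comul_right]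
    have h0 : TensorProduct.map (TensorProduct.map f (coradical k C).mkQ ∘ₗ Coalgebra.comul)
        (coradFilt k C n).mkQ (Coalgebra.comul (R := k) x) = 0 := by
      refine map_comul_eq_zero_of_succ (n := n) (fun y hy => ?_) (by simp) hx
      exact map_eq_zero (Y := coradical k C) (.inr (by simp))
        (isSubcoalgebra_coradical y hy)
    rw [h0, map_zero, map_zero]

/-- If `f` kills `Cᵢ₋₁` and `g` kills `Cⱼ₋₁` then `(f ⊗ g) ∘ Δ` kills `Cᵢ₊ⱼ₋₁`. -/
lemma map_comul_eq_zero {i j : ℕ} {V W : Type*} [AddCommGroup V] [Module k V] [AddCommGroup W]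
    [Module k W] {f : C →ₗ[k] V} {g : C →ₗ[k] W} (hf : ∀ x ∈ coradPred k C i, f x = 0)
    (hg : ∀ x ∈ coradPred k C j, g x = 0) {x : C} (hx : x ∈ coradPred k C (i + j)) :
    TensorProduct.map f g (Coalgebra.comul (R := k) x) = 0 := by
  have main : ∀ (i : ℕ) {V : Type _} [AddCommGroup V] [Module k V] {f : C →ₗ[k] V}
      (_ : ∀ x ∈ coradPred k C i, f x = 0) {x : C} (_ : x ∈ coradPred k C (i + j)),
      TensorProduct.map f g (Coalgebra.comul (R := k) x) = 0 := by
    intro i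
    induction i with
    | zero =>
      intro V _ _ f hf x hx
      rw [zero_add] at hx
      cases j with
      | zero => rw [show x = 0 from hx]; simp
      | succ j => exact map_comul_eq_zero_right f hg hx
    | succ i ih =>
      intro V _ _ f hf x hx
      cases i with
      | zero =>
        cases j with
        | zero => exact map_eq_zero (.inl hf) (isSubcoalgebra_coradical x hx)
        | succ j =>
          rw [show 0 + 1 + (j + 1) = (j + 1) + 1 by omega] at hx
          exact map_comul_eq_zero_of_succ hf hg hx
      | succ i =>
        obtain ⟨φ, rfl⟩ := exists_factor (TensorProduct.map (coradical k C).mkQ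
          (coradFilt k C i).mkQ ∘ₗ Coalgebra.comul) f
          (fun x hx => hf x (mem_of_map_mkQ_eq_zero hx))
        have h0 : TensorProduct.map (coradical k C).mkQ (TensorProduct.map (coradFilt k C i).mkQ g
            ∘ₗ Coalgebra.comul) (Coalgebra.comul (R := k) x) = 0 := by
          rw [show i + 1 + 1 + j = (i + j + 1) + 1 by omega] at hx
          refine map_comul_eq_zero_of_succ (n := i + j) (by simp) (fun y hy => ?_) hx
          refine ih (fun z hz => (Submodule.Quotient.mk_eq_zero _).2 hz) ?_
          rwa [show i + 1 + j = (i + j) + 1 by omega]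
        rw [map_comul_right, LinearEquiv.map_eq_zero_iff] at h0
        rw [← LinearMap.id_comp g, TensorProduct.map_comp, LinearMap.comp_apply, h0, map_zero]
  have hf' : ∀ x ∈ coradPred k C i, (coradPred k C i).mkQ x = 0 := by simp
  obtain ⟨φ, rfl⟩ := exists_factor (coradPred k C i).mkQ f (fun x hx => hf x (by simpa using hx))
  rw [← LinearMap.id_comp g, TensorProduct.map_comp, LinearMap.comp_apply, main i hf' hx, map_zero]

variable (k C) in
/-- The tensor product filtration `∑_{i+j=n} Cᵢ ⊗ Cⱼ` of `C ⊗ C`. -/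
def tensorFilt (n : ℕ) : Submodule k (C ⊗[k] C) :=
  ⨆ p ∈ Finset.HasAntidiagonal.antidiagonal n, tensorSub k (coradFilt k C p.1) (coradFilt k C p.2)

lemma tensorSub_le_tensorFilt {i j n : ℕ} (h : i + j = n) :
    tensorSub k (coradFilt k C i) (coradFilt k C j) ≤ tensorFilt k C n :=
  le_iSup₂_of_le (i, j) (by simpa using h) le_rfl

lemma tensorFilt_le {n : ℕ} {Z : Submodule k (C ⊗[k] C)} (h : ∀ i j, i + j = n →
    ∀ x ∈ coradFilt k C i, ∀ y ∈ coradFilt k C j, x ⊗ₜ[k] y ∈ Z) : tensorFilt k C n ≤ Z :=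
  iSup₂_le fun p hp => tensorSub_le.2 (h p.1 p.2 (by simpa using hp))

lemma mem_tensorFilt_aux (n m : ℕ) (hm : m ≤ n + 1) (u : C ⊗[k] C)
    (hu : u ∈ tensorSub k (coradPred k C m) ⊤)
    (h : ∀ i j, i + j = n + 1 → i < m → ∀ f g : C →ₗ[k] C, (∀ x ∈ coradPred k C i, f x = 0) →
      (∀ x ∈ coradPred k C j, g x = 0) → TensorProduct.map f g u = 0) :
    u ∈ tensorFilt k C n := by
  induction m generalizing u with
  | zero =>
    have : tensorSub k (coradPred k C 0) (⊤ : Submodule k C) ≤ tensorFilt k C n := by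
      rw [tensorSub_le]
      intro x hx y _
      rw [show x = 0 from hx, TensorProduct.zero_tmul]
      exact zero_mem _
    exact this hu
  | succ m ih =>
    obtain ⟨P, hP, hP'⟩ := exists_proj (coradPred k C m)
    obtain ⟨R, hR, hR'⟩ := exists_proj (coradFilt k C (n - m))
    set v := TensorProduct.map (LinearMap.id - P) LinearMap.id u with hv
    have hv1 : v = TensorProduct.map LinearMap.id R v := by
      have h0 := h m (n - m + 1) (by omega) (by omega) (LinearMap.id - P) (LinearMap.id - R)
        (fun x hx => by simp [hP' x hx]) (fun x hx => by simp [hR' x hx])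
      have : TensorProduct.map (LinearMap.id - P) (LinearMap.id - R) u =
          v - TensorProduct.map LinearMap.id R v := by
        rw [hv, ← LinearMap.comp_apply (TensorProduct.map LinearMap.id R),
          ← TensorProduct.map_comp, LinearMap.id_comp, LinearMap.comp_id,
          map_sub_right]
      rw [this] at h0
      exact sub_eq_zero.1 h0
    have hv2 : v ∈ tensorSub k (coradFilt k C m) ⊤ :=
      map_mem_tensorSub (fun x hx => sub_mem hx (coradPred_le m (hP x))) (fun _ _ => Submodule.mem_top) hu
    have hv3 : v ∈ tensorSub k (coradFilt k C m) (coradFilt k C (n - m)) := by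
      rw [hv1]
      exact map_mem_tensorSub (fun x hx => hx) (fun y _ => hR y) hv2
    have huv : u = v + TensorProduct.map P LinearMap.id u := by
      rw [hv, map_sub_left]
      simp
    have h4 : TensorProduct.map P LinearMap.id u ∈ tensorFilt k C n := by
      refine ih (by omega) _ (map_mem_tensorSub (fun x _ => hP x) (fun _ _ => Submodule.mem_top) hu) ?_
      intro i j hij him f g hf hg
      have e : TensorProduct.map P LinearMap.id u = u - v := by rw [eq_sub_iff_add_eq']; exact huv.symm
      rw [e, map_sub, h i j hij (by omega) f g hf hg,
        map_eq_zero (.inr fun y hy => hg y (coradFilt_le_coradPred (by omega) hy)) hv3, sub_zero]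
    rw [huv]
    exact add_mem (tensorSub_le_tensorFilt (by omega) hv3) h4

/-- `Δ(Cₙ) ⊆ ∑_{i+j=n} Cᵢ ⊗ Cⱼ`. -/
lemma comul_mem_tensorFilt {n : ℕ} {x : C} (hx : x ∈ coradFilt k C n) :
    Coalgebra.comul (R := k) x ∈ tensorFilt k C n := by
  have key : ∀ i j, i + j = n + 1 → ∀ f g : C →ₗ[k] C, (∀ x ∈ coradPred k C i, f x = 0) →
      (∀ x ∈ coradPred k C j, g x = 0) →
      TensorProduct.map f g (Coalgebra.comul (R := k) x) = 0 := by
    intro i j hij f g hf hg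
    exact map_comul_eq_zero hf hg (by rw [hij]; exact hx)
  refine mem_tensorFilt_aux n (n + 1) le_rfl _ ?_ (fun i j hij _ => key i j hij)
  obtain ⟨P, hP, hP'⟩ := exists_proj (coradFilt k C n)
  have h0 := key (n + 1) 0 rfl (LinearMap.id - P) LinearMap.id (fun x hx => by simp [hP' x hx])
    (fun x hx => by rw [show x = 0 from hx, map_zero])
  rw [map_sub_left, TensorProduct.map_id, LinearMap.id_apply,
    sub_eq_zero] at h0
  rw [h0]
  exact map_mem_tensorSub (fun x _ => hP x) (fun _ _ => Submodule.mem_top) (mem_tensorSub_top _)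

end Coalgebra

section Hopf

open Coalgebra LinearMap WithConv HopfAlgebra

variable {k H : Type*} [Field k] [Ring H] [HopfAlgebra k H]

lemma antipode_conv_comul :
    (toConv (TensorProduct.map (antipode k) (antipode k) ∘ₗ
      (TensorProduct.comm k H H).toLinearMap ∘ₗ comul) : WithConv (H →ₗ[k] H ⊗[k] H)) *
        toConv comul = 1 := by
  apply WithConv.ext
  simp only [LinearMap.convMul_def, LinearMap.convOne_def, ofConv_toConv]
  let L : H ⊗[k] ((H ⊗[k] H) ⊗[k] H) →ₗ[k] H ⊗[k] H :=
    TensorProduct.map (mul' k H ∘ₗ (antipode k).rTensor H) (mul' k H ∘ₗ (antipode k).rTensor H) ∘ₗ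
      (TensorProduct.leftComm k H (H ⊗[k] H) H).toLinearMap
  have hL : mul' k (H ⊗[k] H) ∘ₗ TensorProduct.map (TensorProduct.map (antipode k) (antipode k) ∘ₗ
      (TensorProduct.comm k H H).toLinearMap) LinearMap.id = L ∘ₗ
      (TensorProduct.assoc k H H H).symm.toLinearMap.lTensor H ∘ₗ
        (TensorProduct.assoc k H H (H ⊗[k] H)).toLinearMap := by
    ext; simp [L]
  have h2 : (TensorProduct.assoc k H H H).symm.toLinearMap.lTensor H ∘ₗ
      (TensorProduct.assoc k H H (H ⊗[k] H)).toLinearMap ∘ₗ TensorProduct.map comul comul ∘ₗ comul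
      = (comul.rTensor H ∘ₗ comul).lTensor H ∘ₗ comul (R := k) (A := H) := by
    simp only [coassoc_simps]
  have h3 : L ∘ₗ (comul.rTensor H).lTensor H =
      TensorProduct.mk k H H 1 ∘ₗ mul' k H ∘ₗ (antipode k).rTensor H ∘ₗ
      ((TensorProduct.lid k H).toLinearMap ∘ₗ (counit (R := k) (A := H)).rTensor H).lTensor H := by
    ext a b c
    have := mul_antipode_rTensor_comul_apply (R := k) b
    simp [L, this, Algebra.algebraMap_eq_smul_one, TensorProduct.smul_tmul]
  clear_value L
  have h4 : (TensorProduct.lid k H).toLinearMap ∘ₗ (counit (R := k) (A := H)).rTensor H ∘ₗ comul =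
      LinearMap.id := by
    rw [Coalgebra.rTensor_counit_comp_comul]; ext; simp
  have h5 : TensorProduct.map (TensorProduct.map (antipode k) (antipode k) ∘ₗ
      (TensorProduct.comm k H H).toLinearMap ∘ₗ comul) (comul (R := k) (A := H)) =
      TensorProduct.map (TensorProduct.map (antipode k) (antipode k) ∘ₗ
      (TensorProduct.comm k H H).toLinearMap) LinearMap.id ∘ₗ TensorProduct.map comul comul := by
    rw [← TensorProduct.map_comp, LinearMap.id_comp, LinearMap.comp_assoc]
  rw [h5, LinearMap.comp_assoc, ← LinearMap.comp_assoc, hL, LinearMap.comp_assoc,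
    LinearMap.comp_assoc, h2, LinearMap.lTensor_comp, LinearMap.comp_assoc, ← LinearMap.comp_assoc,
    h3]
  have h6 : (TensorProduct.mk k H H 1 ∘ₗ mul' k H ∘ₗ (antipode k).rTensor H ∘ₗ
      ((TensorProduct.lid k H).toLinearMap ∘ₗ (counit (R := k) (A := H)).rTensor H).lTensor H) ∘ₗ
      (comul (R := k) (A := H)).lTensor H ∘ₗ comul = TensorProduct.mk k H H 1 ∘ₗ mul' k H ∘ₗ
      (antipode k).rTensor H ∘ₗ ((TensorProduct.lid k H).toLinearMap ∘ₗ
      (counit (R := k) (A := H)).rTensor H ∘ₗ comul).lTensor H ∘ₗ comul := by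
    simp only [LinearMap.comp_assoc, LinearMap.lTensor_comp]
  rw [h6, h4, LinearMap.lTensor_id, LinearMap.id_comp, HopfAlgebra.mul_antipode_rTensor_comul]
  ext x
  simp [Algebra.algebraMap_eq_smul_one, Algebra.TensorProduct.one_def]

/-- The antipode reverses the comultiplication. -/
lemma comul_antipode (x : H) : comul (R := k) (antipode k x) =
    TensorProduct.map (antipode k) (antipode k)
      (TensorProduct.comm k H H (comul (R := k) x)) := by
  have := left_inv_eq_right_inv (antipode_conv_comul (k := k) (H := H)) LinearMap.comul_right_inv
  exact (LinearMap.congr_fun (congrArg WithConv.ofConv this) x).symm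

lemma isSimple_span_groupLike {g : H} (hg : IsGroupLikeElem k g) :
    IsSimpleSubcoalgebra k (k ∙ g) := by
  refine ⟨?_, ?_, ?_⟩
  · intro x hx
    obtain ⟨c, rfl⟩ := Submodule.mem_span_singleton.1 hx
    rw [map_smul, hg.comul_eq_tmul_self]
    exact Submodule.smul_mem _ _ (tmul_mem_tensorSub (Submodule.mem_span_singleton_self g)
      (Submodule.mem_span_singleton_self g))
  · simpa using hg.ne_zero
  · intro E _ hE
    exact (nonzero_span_atom g hg.ne_zero).le_iff.1 hE

lemma groupLike_mem_coradical {g : H} (hg : IsGroupLikeElem k g) : g ∈ coradical k H :=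
  (le_sSup (show (k ∙ g) ∈ {D | IsSimpleSubcoalgebra k D} from isSimple_span_groupLike hg))
    (Submodule.mem_span_singleton_self g)

lemma exists_groupLike {D : Submodule k H} (hD : IsSubcoalgebra k D)
    (h1 : Module.finrank k D = 1) : ∃ g, IsGroupLikeElem k g ∧ D = k ∙ g := by
  obtain ⟨⟨v, hv⟩, hv0, hspan⟩ := finrank_eq_one_iff'.1 h1
  have hv0' : v ≠ 0 := fun h => hv0 (by simp [h])
  have hDv : D = k ∙ v := by
    apply le_antisymm
    · intro x hx
      obtain ⟨c, hc⟩ := hspan ⟨x, hx⟩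
      exact Submodule.mem_span_singleton.2 ⟨c, congrArg Subtype.val hc⟩
    · simpa using hv
  have h2 : tensorSub k D D ≤ k ∙ (v ⊗ₜ[k] v) := by
    rw [tensorSub_le]
    intro x hx y hy
    rw [hDv] at hx hy
    obtain ⟨a, rfl⟩ := Submodule.mem_span_singleton.1 hx
    obtain ⟨b, rfl⟩ := Submodule.mem_span_singleton.1 hy
    exact Submodule.mem_span_singleton.2 ⟨a * b, by rw [TensorProduct.smul_tmul_smul]⟩
  obtain ⟨c, hc⟩ := Submodule.mem_span_singleton.1 (h2 (hD v hv))
  have h3 : (c * counit (R := k) v) • v = v := by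
    have := Coalgebra.rTensor_counit_comul (R := k) v
    rw [← hc] at this
    have := congrArg (TensorProduct.lid k H) this
    simpa [smul_smul] using this
  have h4 : c * counit (R := k) v = 1 := by
    have : (c * counit (R := k) v - 1) • v = 0 := by rw [sub_smul, h3, one_smul, sub_self]
    exact sub_eq_zero.1 ((smul_eq_zero.1 this).resolve_right hv0')
  have hc0 : c ≠ 0 := fun h => by simp [h] at h4
  refine ⟨c • v, ⟨by simpa using h4, ?_⟩, ?_⟩
  · rw [map_smul, ← hc, TensorProduct.smul_tmul_smul, smul_smul]
  · rw [hDv, Submodule.span_singleton_smul_eq (IsUnit.mk0 c hc0)]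

lemma one_mem_coradical : (1 : H) ∈ coradical k H := groupLike_mem_coradical .one

lemma tensorFilt_le_wedge (n : ℕ) : tensorFilt k H n ≤
    tensorSub k (coradFilt k H 0) (coradFilt k H n) ⊔
      tensorSub k (coradFilt k H n) (coradPred k H n) := by
  refine tensorFilt_le fun i j hij x hx y hy => ?_
  rcases Nat.eq_zero_or_pos i with rfl | hi
  · rw [zero_add] at hij
    subst hij
    exact Submodule.mem_sup_left (tmul_mem_tensorSub hx hy)
  · exact Submodule.mem_sup_right (tmul_mem_tensorSub (coradFilt_mono (by omega) hx)
      (coradFilt_le_coradPred (by omega) hy))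

lemma mul_mem_of_forall {X X' Y Y' Z Z' : Submodule k H} (h1 : ∀ x ∈ X, ∀ y ∈ Y, x * y ∈ Z)
    (h2 : ∀ x ∈ X', ∀ y ∈ Y', x * y ∈ Z') {u v : H ⊗[k] H} (hu : u ∈ tensorSub k X X')
    (hv : v ∈ tensorSub k Y Y') : u * v ∈ tensorSub k Z Z' := by
  have : tensorSub k X X' ≤ (tensorSub k Z Z').comap ((LinearMap.mul k (H ⊗[k] H)).flip v) := by
    rw [tensorSub_le]
    intro x hx x' hx'
    have : tensorSub k Y Y' ≤
        (tensorSub k Z Z').comap (LinearMap.mul k (H ⊗[k] H) (x ⊗ₜ[k] x')) := by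
      rw [tensorSub_le]
      intro y hy y' hy'
      simpa using tmul_mem_tensorSub (h1 x hx y hy) (h2 x' hx' y' hy')
    exact this hv
  exact this hu

section Pointed

variable [IsPointed k H]

variable (k H) in
lemma coradical_eq_span : coradical k H = Submodule.span k {g | IsGroupLikeElem k g} := by
  apply le_antisymm
  · refine sSup_le fun D hD => ?_
    obtain ⟨g, hg, rfl⟩ := exists_groupLike hD.1 (IsPointed.finrank_eq_one D hD)
    exact Submodule.span_mono (by simpa using hg)
  · exact Submodule.span_le.2 fun g hg => groupLike_mem_coradical hg

lemma mul_mem_coradical {x y : H} (hx : x ∈ coradical k H) (hy : y ∈ coradical k H) :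
    x * y ∈ coradical k H := by
  rw [coradical_eq_span] at hx hy
  have := Submodule.mul_mem_mul hx hy
  rw [Submodule.span_mul_span] at this
  refine Submodule.span_le.2 ?_ this
  rintro _ ⟨g, hg, h, hh, rfl⟩
  exact groupLike_mem_coradical (hg.mul hh)

lemma antipode_mem_coradical {x : H} (hx : x ∈ coradical k H) :
    antipode k x ∈ coradical k H := by
  rw [coradical_eq_span] at hx
  have : Submodule.span k {g : H | IsGroupLikeElem k g} ≤
      (coradical k H).comap (antipode k) :=
    Submodule.span_le.2 fun g hg => groupLike_mem_coradical (IsGroupLikeElem.antipode hg)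
  exact this hx

/-- The coradical filtration of a pointed Hopf algebra is multiplicative. -/
lemma mul_mem_coradFilt {m n : ℕ} {x y : H} (hx : x ∈ coradFilt k H m)
    (hy : y ∈ coradFilt k H n) : x * y ∈ coradFilt k H (m + n) := by
  induction hN : m + n using Nat.strong_induction_on generalizing m n x y with
  | _ N ih =>
  cases N with
  | zero =>
    obtain ⟨rfl, rfl⟩ : m = 0 ∧ n = 0 := by omega
    exact mul_mem_coradical hx hy
  | succ N =>
    rw [mem_coradFilt_succ, Bialgebra.comul_mul]
    obtain ⟨u, hu, u', hu', e⟩ := Submodule.mem_sup.1 (tensorFilt_le_wedge m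
      (comul_mem_tensorFilt hx))
    obtain ⟨v, hv, v', hv', e'⟩ := Submodule.mem_sup.1 (tensorFilt_le_wedge n
      (comul_mem_tensorFilt hy))
    have hpred : ∀ {a b : ℕ}, a + b = N + 1 → ∀ x ∈ coradPred k H a, ∀ y ∈ coradFilt k H b,
        x * y ∈ coradFilt k H N := by
      intro a b hab x hx y hy
      cases a with
      | zero => rw [show x = 0 from hx, zero_mul]; exact zero_mem _
      | succ a => exact ih N (by omega) hx hy (by omega)
    have hpred' : ∀ {a b : ℕ}, a + b = N + 1 → ∀ x ∈ coradFilt k H a, ∀ y ∈ coradPred k H b,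
        x * y ∈ coradFilt k H N := by
      intro a b hab x hx y hy
      cases b with
      | zero => rw [show y = 0 from hy, mul_zero]; exact zero_mem _
      | succ b => exact ih N (by omega) hx hy (by omega)
    rw [← e, ← e', add_mul, mul_add, mul_add]
    refine add_mem (add_mem (Submodule.mem_sup_left ?_) (Submodule.mem_sup_right ?_))
      (add_mem (Submodule.mem_sup_right ?_) (Submodule.mem_sup_right ?_))
    · exact mul_mem_of_forall (fun _ ha _ hb => mul_mem_coradical ha hb)
        (fun _ _ _ _ => Submodule.mem_top) hu hv
    · exact mul_mem_of_forall (fun _ _ _ _ => Submodule.mem_top) (hpred' hN) hu hv'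
    · exact mul_mem_of_forall (fun _ _ _ _ => Submodule.mem_top) (hpred hN) hu' hv
    · exact mul_mem_of_forall (fun _ _ _ _ => Submodule.mem_top)
        (fun a ha b hb => hpred hN a ha b (coradPred_le n hb)) hu' hv'

lemma antipode_mem_coradFilt {n : ℕ} {x : H} (hx : x ∈ coradFilt k H n) :
    antipode k x ∈ coradFilt k H n := by
  induction n generalizing x with
  | zero => exact antipode_mem_coradical hx
  | succ n ih =>
    rw [mem_coradFilt_succ, comul_antipode]
    have : tensorFilt k H (n + 1) ≤ (tensorSub k (coradical k H) ⊤ ⊔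
        tensorSub k ⊤ (coradFilt k H n)).comap
        (TensorProduct.map (antipode k) (antipode k) ∘ₗ
          (TensorProduct.comm k H H).toLinearMap) := by
      refine tensorFilt_le fun i j hij x hx y hy => ?_
      simp only [Submodule.mem_comap, LinearMap.comp_apply, LinearEquiv.coe_coe,
        TensorProduct.comm_tmul, TensorProduct.map_tmul]
      rcases Nat.eq_zero_or_pos j with rfl | hj
      · exact Submodule.mem_sup_left
          (tmul_mem_tensorSub (antipode_mem_coradical hy) Submodule.mem_top)
      · exact Submodule.mem_sup_right
          (tmul_mem_tensorSub Submodule.mem_top (ih (coradFilt_mono (by omega) hx)))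
    exact this (comul_mem_tensorFilt hx)

end Pointed

end Hopf


section Graded

open Coalgebra HopfAlgebra

variable (k H : Type*) [Field k] [Ring H] [HopfAlgebra k H]

/-- The `n`-th homogeneous component `Hₙ / Hₙ₋₁` of the associated graded space. -/
abbrev grComp (n : ℕ) : Type _ :=
  coradFilt k H n ⧸ (coradPred k H n).submoduleOf (coradFilt k H n)

/-- The associated graded space `gr_c H = ⨁ₙ Hₙ / Hₙ₋₁` of the coradical filtration. -/
def GrC : Type _ := DirectSum ℕ (grComp k H)

instance : AddCommGroup (GrC k H) := inferInstanceAs (AddCommGroup (DirectSum ℕ (grComp k H)))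
instance : Module k (GrC k H) := inferInstanceAs (Module k (DirectSum ℕ (grComp k H)))

namespace GrC

/-- The inclusion of the `n`-th homogeneous component. -/
def incl (n : ℕ) : grComp k H n →ₗ[k] GrC k H := DirectSum.lof k ℕ (grComp k H) n

/-- The `n`-th homogeneous component of `gr_c H`, as a subspace. -/
def component (n : ℕ) : Submodule k (GrC k H) := LinearMap.range (incl k H n)

variable {k H}

/-- The class in `Hₙ / Hₙ₋₁ ⊆ gr_c H` of an element of `Hₙ`. -/
def cls (n : ℕ) : coradFilt k H n →ₗ[k] GrC k H :=
  incl k H n ∘ₗ ((coradPred k H n).submoduleOf (coradFilt k H n)).mkQ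

/-- The linear map out of `gr_c H` induced by maps `Hₙ → M` vanishing on `Hₙ₋₁`. -/
def lift {M : Type*} [AddCommGroup M] [Module k M] (f : ∀ n, coradFilt k H n →ₗ[k] M)
    (hf : ∀ n (x : coradFilt k H n), (x : H) ∈ coradPred k H n → f n x = 0) : GrC k H →ₗ[k] M :=
  DirectSum.toModule k ℕ M fun n =>
    ((coradPred k H n).submoduleOf (coradFilt k H n)).liftQ (f n) fun x hx => hf n x hx

@[simp]
lemma lift_cls {M : Type*} [AddCommGroup M] [Module k M] (f : ∀ n, coradFilt k H n →ₗ[k] M)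
    (hf : ∀ n (x : coradFilt k H n), (x : H) ∈ coradPred k H n → f n x = 0) (n : ℕ)
    (x : coradFilt k H n) : lift f hf (cls n x) = f n x := by
  unfold lift cls incl
  exact DirectSum.toModule_lof k n _

@[elab_as_elim]
lemma induction {p : GrC k H → Prop} (h0 : p 0) (hadd : ∀ a b, p a → p b → p (a + b))
    (h : ∀ n (x : coradFilt k H n), p (cls n x)) (a : GrC k H) : p a := by
  refine DirectSum.induction_on (β := grComp k H) (motive := p) a h0 (fun n x => ?_) hadd
  obtain ⟨x, rfl⟩ := Submodule.mkQ_surjective _ x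
  exact h n x

lemma hom_ext {M : Type*} [AddCommGroup M] [Module k M] {f g : GrC k H →ₗ[k] M}
    (h : ∀ n (x : coradFilt k H n), f (cls n x) = g (cls n x)) : f = g := by
  ext a
  induction a using induction with
  | h0 => simp
  | hadd a b ha hb => simp [ha, hb]
  | h n x => exact h n x

lemma cls_eq_zero {n : ℕ} {x : coradFilt k H n} (hx : (x : H) ∈ coradPred k H n) :
    cls n x = 0 := by
  have : ((coradPred k H n).submoduleOf (coradFilt k H n)).mkQ x = 0 := by
    exact (Submodule.Quotient.mk_eq_zero _).2 hx
  rw [cls, LinearMap.comp_apply, this, map_zero]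

lemma exists_symb (n : ℕ) : ∃ s : H →ₗ[k] GrC k H, s ∘ₗ (coradFilt k H n).subtype = cls n :=
  LinearMap.exists_extend _

/-- A linear extension to `H` of the class map `Hₙ → gr_c H`. -/
def symb (n : ℕ) : H →ₗ[k] GrC k H := (exists_symb n).choose

lemma symb_coe (n : ℕ) (x : coradFilt k H n) : symb (k := k) n (x : H) = cls n x :=
  LinearMap.congr_fun (exists_symb (k := k) (H := H) n).choose_spec x

lemma symb_eq_zero {n : ℕ} {x : H} (hx : x ∈ coradPred k H n) : symb (k := k) n x = 0 := by
  rw [symb_coe n ⟨x, coradPred_le n hx⟩]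
  exact cls_eq_zero hx

/-- On `∑_{i+j=n} Hᵢ ⊗ Hⱼ` this map sends `a ⊗ b` with `a ∈ Hᵢ`, `b ∈ Hⱼ`, `i + j = n` to
`[a] ⊗ [b]` with `[a] ∈ Hᵢ / Hᵢ₋₁`, `[b] ∈ Hⱼ / Hⱼ₋₁`. -/
def symb₂ (n : ℕ) : H ⊗[k] H →ₗ[k] GrC k H ⊗[k] GrC k H :=
  ∑ p ∈ Finset.HasAntidiagonal.antidiagonal n, TensorProduct.map (symb p.1) (symb p.2)

lemma symb₂_tmul {i j n : ℕ} (h : i + j = n) {a b : H} (ha : a ∈ coradFilt k H i)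
    (hb : b ∈ coradFilt k H j) :
    symb₂ n (a ⊗ₜ[k] b) = symb (k := k) i a ⊗ₜ[k] symb (k := k) j b := by
  rw [symb₂, LinearMap.sum_apply, Finset.sum_eq_single (i, j)]
  · simp
  · rintro ⟨i', j'⟩ hp hne
    rw [Finset.HasAntidiagonal.mem_antidiagonal] at hp
    simp only [TensorProduct.map_tmul]
    dsimp only at hp
    rcases lt_trichotomy i i' with h' | h' | h'
    · rw [symb_eq_zero (coradFilt_le_coradPred h' ha), TensorProduct.zero_tmul]
    · exact absurd (by ext <;> dsimp <;> omega) hne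
    · rw [symb_eq_zero (coradFilt_le_coradPred (by omega : j < j') hb), TensorProduct.tmul_zero]
  · intro h'
    exact absurd (Finset.HasAntidiagonal.mem_antidiagonal.2 h) h'

lemma symb₂_comul_eq_zero {n : ℕ} {x : H} (hx : x ∈ coradPred k H n) :
    symb₂ n (comul (R := k) x) = 0 := by
  rw [symb₂, LinearMap.sum_apply]
  refine Finset.sum_eq_zero fun p hp => ?_
  rw [Finset.HasAntidiagonal.mem_antidiagonal] at hp
  exact map_comul_eq_zero (i := p.1) (j := p.2) (fun y hy => symb_eq_zero hy)
    (fun y hy => symb_eq_zero hy) (by rwa [hp])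

lemma symb₂_eq_zero {m n : ℕ} (hmn : m < n) {u : H ⊗[k] H} (hu : u ∈ tensorFilt k H m) :
    symb₂ n u = 0 := by
  have : tensorFilt k H m ≤ LinearMap.ker (symb₂ (k := k) (H := H) n) := by
    refine tensorFilt_le fun i j hij x hx y hy => ?_
    rw [LinearMap.mem_ker,
      symb₂_tmul (i := i) (j := n - i) (by omega) hx (coradFilt_mono (by omega) hy),
      symb_eq_zero (coradFilt_le_coradPred (by omega : j < n - i) hy), TensorProduct.tmul_zero]
  exact this hu

/-- The coalgebra structure of `gr_c H`: for `x ∈ Hₙ`, writing `Δ(x)` as a sum of tensors `a ⊗ b`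
with `a ∈ Hᵢ`, `b ∈ Hⱼ` and `i + j = n`, `Δ[x]` is the sum of the `[a] ⊗ [b]`
(see `comul_cls_of_sum`); and `ε[x] = ε(x)` for `n = 0`, `ε[x] = 0` for `n > 0`. -/
instance : CoalgebraStruct k (GrC k H) where
  comul := lift (fun n => symb₂ n ∘ₗ comul ∘ₗ (coradFilt k H n).subtype)
    fun _ _ hx => symb₂_comul_eq_zero hx
  counit := lift (fun n => if n = 0 then counit ∘ₗ (coradFilt k H n).subtype else 0) (by
    rintro (_ | n) x hx
    · simp [show (x : H) = 0 from hx]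
    · simp)

lemma comul_cls (n : ℕ) (x : coradFilt k H n) :
    comul (R := k) (cls n x) = symb₂ n (comul (R := k) (x : H)) :=
  lift_cls _ _ n x

lemma comul_symb {n : ℕ} {x : H} (hx : x ∈ coradFilt k H n) :
    comul (R := k) (symb (k := k) n x) = symb₂ n (comul (R := k) x) := by
  rw [symb_coe n ⟨x, hx⟩, comul_cls]

lemma comul_cls_of_sum {n : ℕ} {x : coradFilt k H n} {ι : Type*} (s : Finset ι) (i j : ι → ℕ)
    (hij : ∀ t ∈ s, i t + j t = n) (a : ∀ t, coradFilt k H (i t)) (b : ∀ t, coradFilt k H (j t))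
    (h : comul (R := k) (x : H) = ∑ t ∈ s, (a t : H) ⊗ₜ[k] (b t : H)) :
    comul (R := k) (cls n x) = ∑ t ∈ s, cls (i t) (a t) ⊗ₜ[k] cls (j t) (b t) := by
  rw [comul_cls, h, map_sum]
  refine Finset.sum_congr rfl fun t ht => ?_
  rw [symb₂_tmul (hij t ht) (a t).2 (b t).2, symb_coe, symb_coe]

lemma counit_cls_zero (x : coradFilt k H 0) :
    counit (R := k) (cls 0 x) = counit (R := k) (x : H) := by
  refine (lift_cls _ _ 0 x).trans ?_
  simp

lemma counit_cls_pos {n : ℕ} (hn : n ≠ 0) (x : coradFilt k H n) :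
    counit (R := k) (cls n x) = 0 := by
  refine (lift_cls _ _ n x).trans ?_
  simp [hn]

lemma rTensor_comul_symb₂ {n : ℕ} {u : H ⊗[k] H} (hu : u ∈ tensorFilt k H n) :
    (comul (R := k) (A := GrC k H)).rTensor (GrC k H) (symb₂ n u) =
      (∑ p ∈ Finset.HasAntidiagonal.antidiagonal n,
        TensorProduct.map (symb₂ (k := k) (H := H) p.1) (symb p.2))
          ((comul (R := k) (A := H)).rTensor H u) := by
  have : tensorFilt k H n ≤ LinearMap.eqLocus
      ((comul (R := k) (A := GrC k H)).rTensor (GrC k H) ∘ₗ symb₂ n)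
      ((∑ p ∈ Finset.HasAntidiagonal.antidiagonal n,
        TensorProduct.map (symb₂ (k := k) (H := H) p.1) (symb p.2)) ∘ₗ
          (comul (R := k) (A := H)).rTensor H) := by
    refine tensorFilt_le fun i j hij x hx y hy => ?_
    rw [LinearMap.mem_eqLocus, LinearMap.comp_apply, LinearMap.comp_apply, symb₂_tmul hij hx hy,
      LinearMap.rTensor_tmul, LinearMap.rTensor_tmul, comul_symb hx, LinearMap.sum_apply,
      Finset.sum_eq_single (i, j)]
    · simp
    · rintro ⟨i', j'⟩ hp hne
      rw [Finset.HasAntidiagonal.mem_antidiagonal] at hp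
      simp only [TensorProduct.map_tmul]
      dsimp only at hp
      rcases lt_trichotomy i i' with h' | h' | h'
      · rw [symb₂_eq_zero h' (comul_mem_tensorFilt hx), TensorProduct.zero_tmul]
      · exact absurd (by ext <;> dsimp <;> omega) hne
      · rw [symb_eq_zero (coradFilt_le_coradPred (by omega : j < j') hy), TensorProduct.tmul_zero]
    · intro h'
      exact absurd (Finset.HasAntidiagonal.mem_antidiagonal.2 hij) h'
  exact this hu

lemma lTensor_comul_symb₂ {n : ℕ} {u : H ⊗[k] H} (hu : u ∈ tensorFilt k H n) :
    (comul (R := k) (A := GrC k H)).lTensor (GrC k H) (symb₂ n u) =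
      (∑ p ∈ Finset.HasAntidiagonal.antidiagonal n,
        TensorProduct.map (symb p.1) (symb₂ (k := k) (H := H) p.2))
          ((comul (R := k) (A := H)).lTensor H u) := by
  have : tensorFilt k H n ≤ LinearMap.eqLocus
      ((comul (R := k) (A := GrC k H)).lTensor (GrC k H) ∘ₗ symb₂ n)
      ((∑ p ∈ Finset.HasAntidiagonal.antidiagonal n,
        TensorProduct.map (symb p.1) (symb₂ (k := k) (H := H) p.2)) ∘ₗ
          (comul (R := k) (A := H)).lTensor H) := by
    refine tensorFilt_le fun i j hij x hx y hy => ?_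
    rw [LinearMap.mem_eqLocus, LinearMap.comp_apply, LinearMap.comp_apply, symb₂_tmul hij hx hy,
      LinearMap.lTensor_tmul, LinearMap.lTensor_tmul, comul_symb hy, LinearMap.sum_apply,
      Finset.sum_eq_single (i, j)]
    · simp
    · rintro ⟨i', j'⟩ hp hne
      rw [Finset.HasAntidiagonal.mem_antidiagonal] at hp
      simp only [TensorProduct.map_tmul]
      dsimp only at hp
      rcases lt_trichotomy i i' with h' | h' | h'
      · rw [symb_eq_zero (coradFilt_le_coradPred h' hx), TensorProduct.zero_tmul]
      · exact absurd (by ext <;> dsimp <;> omega) hne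
      · rw [symb₂_eq_zero (by omega : j < j') (comul_mem_tensorFilt hy), TensorProduct.tmul_zero]
    · intro h'
      exact absurd (Finset.HasAntidiagonal.mem_antidiagonal.2 hij) h'
  exact this hu

lemma assoc_symb₃ (n : ℕ) (w : (H ⊗[k] H) ⊗[k] H) :
    TensorProduct.assoc k (GrC k H) (GrC k H) (GrC k H)
      ((∑ p ∈ Finset.HasAntidiagonal.antidiagonal n,
        TensorProduct.map (symb₂ (k := k) (H := H) p.1) (symb p.2)) w) =
      (∑ p ∈ Finset.HasAntidiagonal.antidiagonal n,
        TensorProduct.map (symb p.1) (symb₂ (k := k) (H := H) p.2))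
          (TensorProduct.assoc k H H H w) := by
  have : (TensorProduct.assoc k (GrC k H) (GrC k H) (GrC k H)).toLinearMap ∘ₗ
      (∑ p ∈ Finset.HasAntidiagonal.antidiagonal n,
        TensorProduct.map (symb₂ (k := k) (H := H) p.1) (symb p.2)) =
      (∑ p ∈ Finset.HasAntidiagonal.antidiagonal n,
        TensorProduct.map (symb p.1) (symb₂ (k := k) (H := H) p.2)) ∘ₗ
          (TensorProduct.assoc k H H H).toLinearMap := by
    refine TensorProduct.ext_threefold fun a b c => ?_
    simp only [LinearMap.comp_apply, LinearMap.sum_apply, TensorProduct.map_tmul, symb₂,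
      LinearEquiv.coe_coe, TensorProduct.assoc_tmul, TensorProduct.sum_tmul, map_sum,
      TensorProduct.tmul_sum]
    rw [Finset.sum_sigma', Finset.sum_sigma']
    refine Finset.sum_bij' (fun t _ => ⟨(t.2.1, t.2.2 + t.1.2), (t.2.2, t.1.2)⟩)
      (fun t _ => ⟨(t.1.1 + t.2.1, t.2.2), (t.1.1, t.2.1)⟩) ?_ ?_ ?_ ?_ ?_
    case refine_5 => exact fun _ _ => rfl
    all_goals
      rintro ⟨⟨p₁, p₂⟩, ⟨q₁, q₂⟩⟩ ht
      rw [Finset.mem_sigma, Finset.HasAntidiagonal.mem_antidiagonal,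
        Finset.HasAntidiagonal.mem_antidiagonal] at ht
      obtain ⟨h₁, h₂⟩ := ht
      dsimp only at h₁ h₂
      subst h₁
      subst h₂
    · simp [add_assoc]
    · simp [add_assoc]
    · rfl
    · rfl
  exact LinearMap.congr_fun this w

instance : Coalgebra k (GrC k H) where
  coassoc := by
    refine hom_ext fun n x => ?_
    have hx := comul_mem_tensorFilt x.2
    simp only [LinearMap.comp_apply, LinearEquiv.coe_coe, comul_cls]
    rw [rTensor_comul_symb₂ hx, lTensor_comul_symb₂ hx, assoc_symb₃, Coalgebra.coassoc_apply]
  rTensor_counit_comp_comul := by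
    refine hom_ext fun n x => ?_
    have : tensorFilt k H n ≤ LinearMap.eqLocus
        ((counit (R := k) (A := GrC k H)).rTensor (GrC k H) ∘ₗ symb₂ n)
        ((symb (k := k) n).lTensor k ∘ₗ (counit (R := k) (A := H)).rTensor H) := by
      refine tensorFilt_le fun i j hij x hx y hy => ?_
      rw [LinearMap.mem_eqLocus, LinearMap.comp_apply, LinearMap.comp_apply, symb₂_tmul hij hx hy,
        LinearMap.rTensor_tmul, LinearMap.rTensor_tmul, LinearMap.lTensor_tmul,
        symb_coe i ⟨x, hx⟩]
      rcases Nat.eq_zero_or_pos i with rfl | hi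
      · rw [counit_cls_zero, show j = n by omega]
      · rw [counit_cls_pos hi.ne', symb_eq_zero (coradFilt_le_coradPred (by omega : j < n) hy),
          TensorProduct.zero_tmul, TensorProduct.tmul_zero]
    have h := this (comul_mem_tensorFilt x.2)
    rw [LinearMap.mem_eqLocus, LinearMap.comp_apply, LinearMap.comp_apply,
      Coalgebra.rTensor_counit_comul, LinearMap.lTensor_tmul, symb_coe] at h
    rw [LinearMap.comp_apply, comul_cls, h]
    rfl
  lTensor_counit_comp_comul := by
    refine hom_ext fun n x => ?_
    have : tensorFilt k H n ≤ LinearMap.eqLocus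
        ((counit (R := k) (A := GrC k H)).lTensor (GrC k H) ∘ₗ symb₂ n)
        ((symb (k := k) n).rTensor k ∘ₗ (counit (R := k) (A := H)).lTensor H) := by
      refine tensorFilt_le fun i j hij x hx y hy => ?_
      rw [LinearMap.mem_eqLocus, LinearMap.comp_apply, LinearMap.comp_apply, symb₂_tmul hij hx hy,
        LinearMap.lTensor_tmul, LinearMap.lTensor_tmul, LinearMap.rTensor_tmul,
        symb_coe j ⟨y, hy⟩]
      rcases Nat.eq_zero_or_pos j with rfl | hj
      · rw [counit_cls_zero, show i = n by omega]
      · rw [counit_cls_pos hj.ne', symb_eq_zero (coradFilt_le_coradPred (by omega : i < n) hx),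
          TensorProduct.zero_tmul, TensorProduct.tmul_zero]
    have h := this (comul_mem_tensorFilt x.2)
    rw [LinearMap.mem_eqLocus, LinearMap.comp_apply, LinearMap.comp_apply,
      Coalgebra.lTensor_counit_comul, LinearMap.rTensor_tmul, symb_coe] at h
    rw [LinearMap.comp_apply, comul_cls, h]
    rfl

end GrC

end Graded


section GradedHopf

open Coalgebra HopfAlgebra

variable {k H : Type*} [Field k] [Ring H] [HopfAlgebra k H]

lemma gradedMk_eq {m n : ℕ} (h : m = n) {x : coradFilt k H m} {y : coradFilt k H n}
    (hxy : (x : H) = y) : GradedMonoid.mk (A := grComp k H) m (Submodule.Quotient.mk x) =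
      GradedMonoid.mk n (Submodule.Quotient.mk y) := by
  subst h
  rw [Subtype.ext hxy]

variable [IsPointed k H]

lemma mul_mem_coradPred_left {m n : ℕ} {x y : H} (hx : x ∈ coradPred k H m)
    (hy : y ∈ coradFilt k H n) : x * y ∈ coradPred k H (m + n) := by
  cases m with
  | zero => rw [show x = 0 from hx, zero_mul]; exact zero_mem _
  | succ m =>
    rw [show m + 1 + n = m + n + 1 by omega]
    exact mul_mem_coradFilt hx hy

lemma mul_mem_coradPred_right {m n : ℕ} {x y : H} (hx : x ∈ coradFilt k H m)
    (hy : y ∈ coradPred k H n) : x * y ∈ coradPred k H (m + n) := by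
  cases n with
  | zero => rw [show y = 0 from hy, mul_zero]; exact zero_mem _
  | succ n => exact mul_mem_coradFilt hx hy

/-- The multiplication `Hₘ × Hₙ → Hₘ₊ₙ`. -/
def filtMul (m n : ℕ) : coradFilt k H m →ₗ[k] coradFilt k H n →ₗ[k] coradFilt k H (m + n) :=
  LinearMap.mk₂ k (fun x y => ⟨(x : H) * y, mul_mem_coradFilt x.2 y.2⟩)
    (fun _ _ _ => Subtype.ext (add_mul _ _ _)) (fun _ _ _ => Subtype.ext (smul_mul_assoc _ _ _))
    (fun _ _ _ => Subtype.ext (mul_add _ _ _)) (fun _ _ _ => Subtype.ext (mul_smul_comm _ _ _))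

/-- The multiplication `Hₘ / Hₘ₋₁ × Hₙ / Hₙ₋₁ → Hₘ₊ₙ / Hₘ₊ₙ₋₁` induced by that of `H`. -/
def grMul (m n : ℕ) : grComp k H m →ₗ[k] grComp k H n →ₗ[k] grComp k H (m + n) :=
  Submodule.liftQ _ (Submodule.liftQ _ ((filtMul m n).compr₂ (Submodule.mkQ _)).flip
    (fun y hy => by
      ext x
      exact (Submodule.Quotient.mk_eq_zero _).2 (mul_mem_coradPred_right x.2 hy))).flip
    (fun x hx => by
      ext y
      exact (Submodule.Quotient.mk_eq_zero _).2 (mul_mem_coradPred_left hx y.2))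

lemma grMul_mk {m n : ℕ} (x : coradFilt k H m) (y : coradFilt k H n) :
    grMul m n (Submodule.Quotient.mk x) (Submodule.Quotient.mk y) =
      Submodule.Quotient.mk ⟨(x : H) * y, mul_mem_coradFilt x.2 y.2⟩ := rfl

instance : GradedMonoid.GMul (grComp k H) where
  mul {m n} a b := grMul m n a b

instance : GradedMonoid.GOne (grComp k H) where
  one := Submodule.Quotient.mk ⟨1, one_mem_coradical⟩

instance : DirectSum.GRing (grComp k H) where
  mul_zero a := map_zero (grMul _ _ a)
  zero_mul b := by
    change grMul _ _ 0 b = 0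
    rw [map_zero, LinearMap.zero_apply]
  mul_add a b c := map_add (grMul _ _ a) b c
  add_mul a b c := by
    change grMul _ _ (a + b) c = grMul _ _ a c + grMul _ _ b c
    rw [map_add, LinearMap.add_apply]
  one_mul := by
    rintro ⟨n, a⟩
    obtain ⟨x, rfl⟩ := Submodule.Quotient.mk_surjective _ a
    exact gradedMk_eq (zero_add n) (one_mul (x : H))
  mul_one := by
    rintro ⟨n, a⟩
    obtain ⟨x, rfl⟩ := Submodule.Quotient.mk_surjective _ a
    exact gradedMk_eq (add_zero n) (mul_one (x : H))
  mul_assoc := by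
    rintro ⟨l, a⟩ ⟨m, b⟩ ⟨n, c⟩
    obtain ⟨x, rfl⟩ := Submodule.Quotient.mk_surjective _ a
    obtain ⟨y, rfl⟩ := Submodule.Quotient.mk_surjective _ b
    obtain ⟨z, rfl⟩ := Submodule.Quotient.mk_surjective _ c
    exact gradedMk_eq (add_assoc l m n) (mul_assoc (x : H) y z)
  natCast n := n • GradedMonoid.GOne.one
  natCast_zero := zero_smul _ _
  natCast_succ n := succ_nsmul _ n
  intCast n := n • GradedMonoid.GOne.one
  intCast_ofNat n := natCast_zsmul _ n
  intCast_negSucc_ofNat n := negSucc_zsmul _ n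

instance : DirectSum.GAlgebra k (grComp k H) where
  toFun := (LinearMap.toSpanSingleton k (grComp k H 0) GradedMonoid.GOne.one).toAddMonoidHom
  map_one := one_smul k (GradedMonoid.GOne.one : grComp k H 0)
  map_mul r s := by
    refine gradedMk_eq (x := (r * s) • ⟨1, one_mem_coradical⟩)
      (y := ⟨(r • (1 : H)) * (s • (1 : H)), _⟩) (zero_add 0).symm ?_
    simp [mul_smul, smul_comm r s]
  commutes r := by
    rintro ⟨n, a⟩
    obtain ⟨x, rfl⟩ := Submodule.Quotient.mk_surjective _ a
    refine gradedMk_eq (x := ⟨(r • (1 : H)) * x, _⟩) (y := ⟨x * (r • (1 : H)), _⟩)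
      (by omega) ?_
    simp
  smul_def r := by
    rintro ⟨n, a⟩
    obtain ⟨x, rfl⟩ := Submodule.Quotient.mk_surjective _ a
    refine gradedMk_eq (x := r • x) (y := ⟨(r • (1 : H)) * x, _⟩) (zero_add n).symm ?_
    simp

namespace GrC

instance : Ring (GrC k H) := inferInstanceAs (Ring (DirectSum ℕ (grComp k H)))
instance : Algebra k (GrC k H) := inferInstanceAs (Algebra k (DirectSum ℕ (grComp k H)))

lemma cls_mul_cls {m n : ℕ} (x : coradFilt k H m) (y : coradFilt k H n) :
    cls m x * cls n y = cls (m + n) ⟨(x : H) * y, mul_mem_coradFilt x.2 y.2⟩ :=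
  DirectSum.of_mul_of (A := grComp k H) _ _

lemma one_eq_cls : (1 : GrC k H) = cls 0 ⟨1, one_mem_coradical⟩ := rfl

lemma symb_mul_symb {m n : ℕ} {x y : H} (hx : x ∈ coradFilt k H m) (hy : y ∈ coradFilt k H n) :
    symb (k := k) m x * symb (k := k) n y = symb (k := k) (m + n) (x * y) := by
  rw [symb_coe m ⟨x, hx⟩, symb_coe n ⟨y, hy⟩, cls_mul_cls,
    symb_coe (m + n) ⟨x * y, mul_mem_coradFilt hx hy⟩]

lemma symb₂_mul {m n : ℕ} {u v : H ⊗[k] H} (hu : u ∈ tensorFilt k H m)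
    (hv : v ∈ tensorFilt k H n) :
    symb₂ (m + n) (u * v) = symb₂ (k := k) m u * symb₂ (k := k) n v := by
  have key : tensorFilt k H m ≤ LinearMap.eqLocus
      (symb₂ (k := k) (m + n) ∘ₗ (LinearMap.mul k (H ⊗[k] H)).flip v)
      ((LinearMap.mul k (GrC k H ⊗[k] GrC k H)).flip (symb₂ (k := k) n v) ∘ₗ symb₂ m) := by
    refine tensorFilt_le fun i j hij a ha b hb => ?_
    have key2 : tensorFilt k H n ≤ LinearMap.eqLocus
        (symb₂ (k := k) (m + n) ∘ₗ LinearMap.mul k (H ⊗[k] H) (a ⊗ₜ[k] b))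
        (LinearMap.mul k (GrC k H ⊗[k] GrC k H) (symb₂ (k := k) m (a ⊗ₜ[k] b)) ∘ₗ symb₂ n) := by
      refine tensorFilt_le fun i' j' hij' a' ha' b' hb' => ?_
      simp only [LinearMap.mem_eqLocus, LinearMap.comp_apply, LinearMap.mul_apply',
        Algebra.TensorProduct.tmul_mul_tmul]
      rw [symb₂_tmul (by omega : (i + i') + (j + j') = m + n) (mul_mem_coradFilt ha ha')
        (mul_mem_coradFilt hb hb'), symb₂_tmul hij ha hb, symb₂_tmul hij' ha' hb',
        Algebra.TensorProduct.tmul_mul_tmul, symb_mul_symb ha ha', symb_mul_symb hb hb']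
    exact key2 hv
  exact key hu

instance : Bialgebra k (GrC k H) :=
  Bialgebra.mk' k (GrC k H)
    (by rw [one_eq_cls, counit_cls_zero]; exact Bialgebra.counit_one)
    (fun {a b} => by
      induction a using induction with
      | h0 => simp
      | hadd a a' ha ha' => rw [add_mul, map_add, map_add, ha, ha', add_mul]
      | h m x =>
      induction b using induction with
      | h0 => simp
      | hadd b b' hb hb' => rw [mul_add, map_add, map_add, hb, hb', mul_add]
      | h n y =>
      rw [cls_mul_cls]
      rcases Nat.eq_zero_or_pos m with rfl | hm
      · rcases Nat.eq_zero_or_pos n with rfl | hn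
        · rw [counit_cls_zero, counit_cls_zero, counit_cls_zero]
          exact Bialgebra.counit_mul (x : H) (y : H)
        · rw [counit_cls_pos hn.ne' y, counit_cls_pos (by omega), mul_zero]
      · rw [counit_cls_pos hm.ne' x, counit_cls_pos (by omega), zero_mul])
    (by
      rw [one_eq_cls, comul_cls]
      dsimp only
      rw [Bialgebra.comul_one, Algebra.TensorProduct.one_def,
        symb₂_tmul (i := 0) (j := 0) rfl one_mem_coradical one_mem_coradical,
        symb_coe 0 ⟨1, one_mem_coradical⟩, ← one_eq_cls, Algebra.TensorProduct.one_def])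
    (fun {a b} => by
      induction a using induction with
      | h0 => simp
      | hadd a a' ha ha' => rw [add_mul, map_add, map_add, ha, ha', add_mul]
      | h m x =>
      induction b using induction with
      | h0 => simp
      | hadd b b' hb hb' => rw [mul_add, map_add, map_add, hb, hb', mul_add]
      | h n y =>
      rw [cls_mul_cls, comul_cls, comul_cls, comul_cls]
      dsimp only
      rw [Bialgebra.comul_mul,
        symb₂_mul (comul_mem_tensorFilt x.2) (comul_mem_tensorFilt y.2)])

lemma antipode_mem_coradPred {n : ℕ} {x : H} (hx : x ∈ coradPred k H n) :
    antipode k x ∈ coradPred k H n := by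
  cases n with
  | zero => rw [show x = 0 from hx, map_zero]; exact zero_mem _
  | succ n => exact antipode_mem_coradFilt hx

/-- The antipode of `gr_c H`: `S[x] = [S(x)]`. -/
instance : HopfAlgebraStruct k (GrC k H) where
  antipode := lift (fun n => cls n ∘ₗ (antipode k).restrict fun _ hx => antipode_mem_coradFilt hx)
    fun _ _ hx => cls_eq_zero (antipode_mem_coradPred hx)

lemma antipode_cls (n : ℕ) (x : coradFilt k H n) :
    antipode k (cls n x) = cls n ⟨antipode k (x : H), antipode_mem_coradFilt x.2⟩ :=
  lift_cls _ _ n x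

lemma antipode_symb {n : ℕ} {x : H} (hx : x ∈ coradFilt k H n) :
    antipode k (symb (k := k) n x) = symb (k := k) n (antipode k x) := by
  rw [symb_coe n ⟨x, hx⟩, antipode_cls, ← symb_coe]

lemma algebraMap_counit_cls (n : ℕ) (x : coradFilt k H n) :
    symb (k := k) n (algebraMap k H (counit (R := k) (x : H))) =
      algebraMap k (GrC k H) (counit (R := k) (cls n x)) := by
  rw [Algebra.algebraMap_eq_smul_one, Algebra.algebraMap_eq_smul_one, map_smul]
  rcases Nat.eq_zero_or_pos n with rfl | hn
  · rw [counit_cls_zero, symb_coe 0 ⟨1, one_mem_coradical⟩, ← one_eq_cls]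
  · rw [counit_cls_pos hn.ne', zero_smul,
      symb_eq_zero (coradFilt_le_coradPred hn one_mem_coradical), smul_zero]

/-- `gr_c H` as a Hopf algebra. -/
instance : HopfAlgebra k (GrC k H) where
  mul_antipode_rTensor_comul := by
    refine hom_ext fun n x => ?_
    have : tensorFilt k H n ≤ LinearMap.eqLocus
        (LinearMap.mul' k (GrC k H) ∘ₗ (antipode k).rTensor (GrC k H) ∘ₗ symb₂ n)
        (symb n ∘ₗ LinearMap.mul' k H ∘ₗ (antipode k).rTensor H) := by
      refine tensorFilt_le fun i j hij a ha b hb => ?_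
      subst hij
      simp only [LinearMap.mem_eqLocus, LinearMap.comp_apply]
      rw [symb₂_tmul rfl ha hb, LinearMap.rTensor_tmul, LinearMap.rTensor_tmul,
        LinearMap.mul'_apply, LinearMap.mul'_apply, antipode_symb ha,
        symb_mul_symb (antipode_mem_coradFilt ha) hb]
    have h := this (comul_mem_tensorFilt x.2)
    simp only [LinearMap.mem_eqLocus, LinearMap.comp_apply,
      HopfAlgebra.mul_antipode_rTensor_comul_apply] at h
    rw [LinearMap.comp_apply, LinearMap.comp_apply, comul_cls, h, algebraMap_counit_cls]
    rfl
  mul_antipode_lTensor_comul := by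
    refine hom_ext fun n x => ?_
    have : tensorFilt k H n ≤ LinearMap.eqLocus
        (LinearMap.mul' k (GrC k H) ∘ₗ (antipode k).lTensor (GrC k H) ∘ₗ symb₂ n)
        (symb n ∘ₗ LinearMap.mul' k H ∘ₗ (antipode k).lTensor H) := by
      refine tensorFilt_le fun i j hij a ha b hb => ?_
      subst hij
      simp only [LinearMap.mem_eqLocus, LinearMap.comp_apply]
      rw [symb₂_tmul rfl ha hb, LinearMap.lTensor_tmul, LinearMap.lTensor_tmul,
        LinearMap.mul'_apply, LinearMap.mul'_apply, antipode_symb hb,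
        symb_mul_symb ha (antipode_mem_coradFilt hb)]
    have h := this (comul_mem_tensorFilt x.2)
    simp only [LinearMap.mem_eqLocus, LinearMap.comp_apply,
      HopfAlgebra.mul_antipode_lTensor_comul_apply] at h
    rw [LinearMap.comp_apply, LinearMap.comp_apply, comul_cls, h, algebraMap_counit_cls]
    rfl

end GrC

end GradedHopf


section Corad

open Coalgebra HopfAlgebra

variable (k H : Type*) [Field k] [Ring H] [HopfAlgebra k H] [IsPointed k H]

/-- The coradical of a pointed Hopf algebra as a subalgebra. -/
def corad : Subalgebra k H where
  carrier := coradical k H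
  mul_mem' := mul_mem_coradical
  add_mem' := add_mem
  algebraMap_mem' r := by
    rw [Algebra.algebraMap_eq_smul_one]
    exact Submodule.smul_mem _ r one_mem_coradical

namespace corad

/-- The inclusion `corad(H) ⊗ corad(H) → H ⊗ H`. -/
def incl₂ : corad k H ⊗[k] corad k H →ₐ[k] H ⊗[k] H :=
  Algebra.TensorProduct.map (corad k H).val (corad k H).val

variable {k H}

lemma incl₂_tmul (x y : corad k H) : incl₂ k H (x ⊗ₜ[k] y) = (x : H) ⊗ₜ[k] (y : H) := rfl

variable (k H) in
lemma incl₂_injective : Function.Injective (incl₂ k H) :=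
  TensorProduct.map_injective_of_flat_flat (corad k H).val.toLinearMap
    (corad k H).val.toLinearMap Subtype.val_injective Subtype.val_injective

lemma comul_mem_range (x : corad k H) :
    comul (R := k) (x : H) ∈ LinearMap.range (incl₂ k H).toLinearMap := by
  have : tensorSub k (coradical k H) (coradical k H) ≤
      LinearMap.range (incl₂ k H).toLinearMap := by
    rw [tensorSub_le]
    intro x hx y hy
    exact ⟨(⟨x, hx⟩ : corad k H) ⊗ₜ[k] (⟨y, hy⟩ : corad k H), rfl⟩
  exact this (isSubcoalgebra_coradical _ x.2)

/-- The comultiplication and counit of `corad(H)` are the restrictions of those of `H`. -/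
instance : CoalgebraStruct k (corad k H) where
  comul := (LinearEquiv.ofInjective (incl₂ k H).toLinearMap (incl₂_injective k H)).symm.toLinearMap
    ∘ₗ LinearMap.codRestrict _ (comul ∘ₗ (corad k H).val.toLinearMap) comul_mem_range
  counit := counit ∘ₗ (corad k H).val.toLinearMap

lemma incl₂_comul (x : corad k H) : incl₂ k H (comul (R := k) x) = comul (R := k) (x : H) :=
  congrArg Subtype.val
    ((LinearEquiv.ofInjective (incl₂ k H).toLinearMap (incl₂_injective k H)).apply_symm_apply
      ⟨comul (R := k) (x : H), comul_mem_range x⟩)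

lemma counit_coe (x : corad k H) : counit (R := k) x = counit (R := k) (x : H) := rfl

instance : Coalgebra k (corad k H) where
  coassoc := by
    ext x
    have hinj : Function.Injective (TensorProduct.map (corad k H).val.toLinearMap
        (incl₂ k H).toLinearMap) :=
      TensorProduct.map_injective_of_flat_flat _ _ Subtype.val_injective (incl₂_injective k H)
    apply hinj
    have h1 : TensorProduct.map (corad k H).val.toLinearMap (incl₂ k H).toLinearMap ∘ₗ
        (TensorProduct.assoc k _ _ _).toLinearMap ∘ₗ (comul (R := k)).rTensor (corad k H) =
        (TensorProduct.assoc k H H H).toLinearMap ∘ₗ (comul (R := k)).rTensor H ∘ₗ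
          (incl₂ k H).toLinearMap := by
      have h0 : TensorProduct.map (corad k H).val.toLinearMap (incl₂ k H).toLinearMap ∘ₗ
          (TensorProduct.assoc k _ _ _).toLinearMap = (TensorProduct.assoc k H H H).toLinearMap ∘ₗ
          TensorProduct.map (incl₂ k H).toLinearMap (corad k H).val.toLinearMap :=
        TensorProduct.ext_threefold fun a b c => rfl
      rw [← LinearMap.comp_assoc, h0, LinearMap.comp_assoc]
      congr 1
      refine TensorProduct.ext' fun a b => ?_
      simp only [LinearMap.comp_apply, LinearMap.rTensor_tmul, TensorProduct.map_tmul,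
        AlgHom.toLinearMap_apply, incl₂_comul, incl₂_tmul]
      rfl
    have h2 : TensorProduct.map (corad k H).val.toLinearMap (incl₂ k H).toLinearMap ∘ₗ
        (comul (R := k)).lTensor (corad k H) = (comul (R := k)).lTensor H ∘ₗ
          (incl₂ k H).toLinearMap := by
      refine TensorProduct.ext' fun a b => ?_
      simp only [LinearMap.comp_apply, LinearMap.lTensor_tmul, TensorProduct.map_tmul,
        AlgHom.toLinearMap_apply, incl₂_comul, incl₂_tmul]
      rfl
    have e1 := LinearMap.congr_fun h1 (comul (R := k) x)
    have e2 := LinearMap.congr_fun h2 (comul (R := k) x)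
    simp only [LinearMap.comp_apply, AlgHom.toLinearMap_apply, incl₂_comul,
      LinearEquiv.coe_coe] at e1 e2 ⊢
    rw [e1, e2, Coalgebra.coassoc_apply]
  rTensor_counit_comp_comul := by
    ext x
    have hinj : Function.Injective ((corad k H).val.toLinearMap.lTensor k) :=
      Module.Flat.lTensor_preserves_injective_linearMap _ Subtype.val_injective
    apply hinj
    have h1 : (corad k H).val.toLinearMap.lTensor k ∘ₗ (counit (R := k)).rTensor (corad k H) =
        (counit (R := k)).rTensor H ∘ₗ (incl₂ k H).toLinearMap :=
      TensorProduct.ext' fun a b => rfl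
    have e1 := LinearMap.congr_fun h1 (comul (R := k) x)
    simp only [LinearMap.comp_apply, AlgHom.toLinearMap_apply, incl₂_comul] at e1 ⊢
    rw [e1, Coalgebra.rTensor_counit_comul]
    rfl
  lTensor_counit_comp_comul := by
    ext x
    have hinj : Function.Injective ((corad k H).val.toLinearMap.rTensor k) :=
      Module.Flat.rTensor_preserves_injective_linearMap _ Subtype.val_injective
    apply hinj
    have h1 : (corad k H).val.toLinearMap.rTensor k ∘ₗ (counit (R := k)).lTensor (corad k H) =
        (counit (R := k)).lTensor H ∘ₗ (incl₂ k H).toLinearMap :=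
      TensorProduct.ext' fun a b => rfl
    have e1 := LinearMap.congr_fun h1 (comul (R := k) x)
    simp only [LinearMap.comp_apply, AlgHom.toLinearMap_apply, incl₂_comul] at e1 ⊢
    rw [e1, Coalgebra.lTensor_counit_comul]
    rfl

instance : Bialgebra k (corad k H) :=
  Bialgebra.mk' k (corad k H)
    (Bialgebra.counit_one (R := k) (A := H))
    (fun {a b} => Bialgebra.counit_mul (R := k) (a : H) (b : H))
    (incl₂_injective k H (by
      rw [incl₂_comul, map_one]
      exact Bialgebra.comul_one (R := k) (A := H)))
    (fun {a b} => incl₂_injective k H (by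
      rw [map_mul (incl₂ k H), incl₂_comul, incl₂_comul, incl₂_comul]
      exact Bialgebra.comul_mul (R := k) (a : H) (b : H)))

/-- The antipode of `corad(H)` is the restriction of that of `H`. -/
instance : HopfAlgebraStruct k (corad k H) where
  antipode := LinearMap.restrict (p := Subalgebra.toSubmodule (corad k H))
    (q := Subalgebra.toSubmodule (corad k H)) (antipode k) fun _ hx => antipode_mem_coradical hx

lemma antipode_coe (x : corad k H) : (antipode k x : corad k H) = antipode k (x : H) := rfl

/-- `corad(H)` as a Hopf algebra. -/
instance : HopfAlgebra k (corad k H) where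
  mul_antipode_rTensor_comul := by
    ext x
    have h1 : (corad k H).val.toLinearMap ∘ₗ LinearMap.mul' k (corad k H) ∘ₗ
        (antipode k).rTensor (corad k H) = LinearMap.mul' k H ∘ₗ (antipode k).rTensor H ∘ₗ
          (incl₂ k H).toLinearMap := TensorProduct.ext' fun a b => rfl
    have e1 := LinearMap.congr_fun h1 (comul (R := k) x)
    simp only [LinearMap.comp_apply, AlgHom.toLinearMap_apply, incl₂_comul,
      HopfAlgebra.mul_antipode_rTensor_comul_apply] at e1
    exact e1
  mul_antipode_lTensor_comul := by
    ext x
    have h1 : (corad k H).val.toLinearMap ∘ₗ LinearMap.mul' k (corad k H) ∘ₗ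
        (antipode k).lTensor (corad k H) = LinearMap.mul' k H ∘ₗ (antipode k).lTensor H ∘ₗ
          (incl₂ k H).toLinearMap := TensorProduct.ext' fun a b => rfl
    have e1 := LinearMap.congr_fun h1 (comul (R := k) x)
    simp only [LinearMap.comp_apply, AlgHom.toLinearMap_apply, incl₂_comul,
      HopfAlgebra.mul_antipode_lTensor_comul_apply] at e1
    exact e1

end corad

namespace GrC

/-- The projection onto degree zero, as a linear map `gr_c H → H₀ = corad(H)`. -/
def projZeroLin : GrC k H →ₗ[k] corad k H :=
  lift (fun n => match n with
    | 0 => (LinearMap.id : coradFilt k H 0 →ₗ[k] coradFilt k H 0)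
    | _ + 1 => 0) (by
    rintro (_ | n) x hx
    · exact Subtype.ext hx
    · rfl)

variable {k H} in
lemma projZeroLin_cls_zero (x : coradFilt k H 0) : projZeroLin k H (cls 0 x) = ⟨x, x.2⟩ :=
  lift_cls _ _ 0 x

variable {k H} in
lemma projZeroLin_cls_pos {n : ℕ} (hn : n ≠ 0) (x : coradFilt k H n) :
    projZeroLin k H (cls n x) = 0 := by
  cases n with
  | zero => exact absurd rfl hn
  | succ n => exact lift_cls _ _ (n + 1) x

/-- The projection `π : gr_c H → corad(H)` onto degree zero. -/
def projZero : GrC k H →ₐ[k] corad k H :=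
  AlgHom.ofLinearMap (projZeroLin k H)
    (by rw [one_eq_cls, projZeroLin_cls_zero]; rfl)
    (fun a b => by
      induction a using induction with
      | h0 => simp
      | hadd a a' ha ha' => rw [add_mul, map_add, map_add, ha, ha', add_mul]
      | h m x =>
      induction b using induction with
      | h0 => simp
      | hadd b b' hb hb' => rw [mul_add, map_add, map_add, hb, hb', mul_add]
      | h n y =>
      rw [cls_mul_cls]
      rcases Nat.eq_zero_or_pos m with rfl | hm
      · rcases Nat.eq_zero_or_pos n with rfl | hn
        · rw [projZeroLin_cls_zero, projZeroLin_cls_zero, projZeroLin_cls_zero]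
          rfl
        · rw [projZeroLin_cls_pos hn.ne' y, projZeroLin_cls_pos (by omega), mul_zero]
      · rw [projZeroLin_cls_pos hm.ne' x, projZeroLin_cls_pos (by omega), zero_mul])

/-- The algebra `B = (gr_c H)^{co π} = {a | (id ⊗ π)Δ(a) = a ⊗ 1}` of right coinvariants of the
projection `π : gr_c H → corad(H)`. -/
def braidedPart : Subalgebra k (GrC k H) :=
  AlgHom.equalizer
    ((Algebra.TensorProduct.map (AlgHom.id k (GrC k H)) (projZero k H)).comp
      (Bialgebra.comulAlgHom k (GrC k H)))
    Algebra.TensorProduct.includeLeft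

/-- The subspace `Bₙ = B ∩ (gr_c H)ₙ` of `B`. -/
def braidedComponent (n : ℕ) : Submodule k (braidedPart k H) :=
  (component k H n).comap (braidedPart k H).val.toLinearMap

end GrC

end Corad


section YetterDrinfeld

open Coalgebra HopfAlgebra TensorProduct

variable (k K : Type*) [Field k] [Ring K] [HopfAlgebra k K]

/-- A linear action `h ⊗ v ↦ h · v` and a linear coaction `v ↦ v₍₋₁₎ ⊗ v₍₀₎` of `K` on `V`; the
axioms are in `YDData.IsYetterDrinfeld`. -/
structure YDData (V : Type*) [AddCommGroup V] [Module k V] where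
  act : K ⊗[k] V →ₗ[k] V
  coact : V →ₗ[k] K ⊗[k] V

namespace YDData

variable {k K} {V W : Type*} [AddCommGroup V] [Module k V] [AddCommGroup W] [Module k W]

/-- Left Yetter-Drinfel'd modules over `K`: left modules and left comodules with
`h₁ v₍₋₁₎ ⊗ h₂ · v₍₀₎ = (h₁ · v)₍₋₁₎ h₂ ⊗ (h₁ · v)₍₀₎`. -/
structure IsYetterDrinfeld (M : YDData k K V) : Prop where
  one_act : ∀ v, M.act (1 ⊗ₜ v) = v
  mul_act : ∀ g h v, M.act ((g * h) ⊗ₜ v) = M.act (g ⊗ₜ M.act (h ⊗ₜ v))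
  counit_coact : TensorProduct.lid k V ∘ₗ counit.rTensor V ∘ₗ M.coact = LinearMap.id
  coassoc_coact : TensorProduct.assoc k K K V ∘ₗ comul.rTensor V ∘ₗ M.coact =
    M.coact.lTensor K ∘ₗ M.coact
  compat :
    TensorProduct.map (LinearMap.mul' k K) M.act ∘ₗ
        TensorProduct.tensorTensorTensorComm k K K K V ∘ₗ TensorProduct.map comul M.coact =
      (LinearMap.mul' k K).rTensor V ∘ₗ TensorProduct.rightComm k K V K ∘ₗ
        M.coact.rTensor K ∘ₗ M.act.rTensor K ∘ₗ TensorProduct.rightComm k K K V ∘ₗ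
          (comul (R := k) (A := K)).rTensor V

/-- The tensor product: `h · (v ⊗ w) = h₁ · v ⊗ h₂ · w`,
`v ⊗ w ↦ v₍₋₁₎ w₍₋₁₎ ⊗ (v₍₀₎ ⊗ w₍₀₎)`. -/
def tensor (M : YDData k K V) (N : YDData k K W) : YDData k K (V ⊗[k] W) where
  act := TensorProduct.map M.act N.act ∘ₗ TensorProduct.tensorTensorTensorComm k K K V W ∘ₗ
    comul.rTensor (V ⊗[k] W)
  coact := (LinearMap.mul' k K).rTensor (V ⊗[k] W) ∘ₗ
    TensorProduct.tensorTensorTensorComm k K V K W ∘ₗ TensorProduct.map M.coact N.coact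

variable (k K) in
/-- The unit object `k`: `h · c = ε(h) c`, `c ↦ 1 ⊗ c`. -/
def unit : YDData k K k where
  act := TensorProduct.lid k k ∘ₗ counit.rTensor k
  coact := TensorProduct.mk k K k 1

/-- Linear maps compatible with the actions and the coactions. -/
structure IsHom (M : YDData k K V) (N : YDData k K W) (f : V →ₗ[k] W) : Prop where
  act : f ∘ₗ M.act = N.act ∘ₗ f.lTensor K
  coact : N.coact ∘ₗ f = f.lTensor K ∘ₗ M.coact

/-- The braiding `v ⊗ w ↦ v₍₋₁₎ · w ⊗ v₍₀₎`. -/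
def braiding (M : YDData k K V) (N : YDData k K W) : V ⊗[k] W →ₗ[k] W ⊗[k] V :=
  N.act.rTensor V ∘ₗ TensorProduct.rightComm k K V W ∘ₗ M.coact.rTensor W

end YDData

/-- `id ⊗ f ⊗ id`, with the four tensor factors bracketed in pairs. -/
def middle {k X Y M N P Q : Type*} [Field k] [AddCommGroup X] [Module k X] [AddCommGroup Y]
    [Module k Y] [AddCommGroup M] [Module k M] [AddCommGroup N] [Module k N] [AddCommGroup P]
    [Module k P] [AddCommGroup Q] [Module k Q] (f : M ⊗[k] N →ₗ[k] P ⊗[k] Q) :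
    (X ⊗[k] M) ⊗[k] (N ⊗[k] Y) →ₗ[k] (X ⊗[k] P) ⊗[k] (Q ⊗[k] Y) :=
  (TensorProduct.assoc k X P (Q ⊗[k] Y)).symm ∘ₗ
    ((TensorProduct.assoc k P Q Y).toLinearMap ∘ₗ f.rTensor Y ∘ₗ
      (TensorProduct.assoc k M N Y).symm.toLinearMap).lTensor X ∘ₗ
    TensorProduct.assoc k X M (N ⊗[k] Y)

/-- The data, besides the algebra structure of `B`, of a braided Hopf algebra over `K`: an action
and a coaction of `K`, a comultiplication, a counit and an antipode; the axioms are in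
`BraidedHopfData.IsBraidedHopfAlgebra`. -/
structure BraidedHopfData (B : Type*) [Ring B] [Algebra k B] extends YDData k K B where
  comul : B →ₗ[k] B ⊗[k] B
  counit : B →ₗ[k] k
  antipode : B →ₗ[k] B

namespace BraidedHopfData

variable {k K} {B : Type*} [Ring B] [Algebra k B]

/-- Hopf algebras in the braided category of left Yetter-Drinfel'd modules over `K`. -/
structure IsBraidedHopfAlgebra (D : BraidedHopfData k K B) : Prop where
  yetterDrinfeld : D.toYDData.IsYetterDrinfeld
  mul_hom : (D.toYDData.tensor D.toYDData).IsHom D.toYDData (LinearMap.mul' k B)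
  one_hom : (YDData.unit k K).IsHom D.toYDData (Algebra.linearMap k B)
  comul_hom : D.toYDData.IsHom (D.toYDData.tensor D.toYDData) D.comul
  counit_hom : D.toYDData.IsHom (YDData.unit k K) D.counit
  antipode_hom : D.toYDData.IsHom D.toYDData D.antipode
  coassoc : TensorProduct.assoc k B B B ∘ₗ D.comul.rTensor B ∘ₗ D.comul =
    D.comul.lTensor B ∘ₗ D.comul
  rTensor_counit_comul : TensorProduct.lid k B ∘ₗ D.counit.rTensor B ∘ₗ D.comul = LinearMap.id
  lTensor_counit_comul : TensorProduct.rid k B ∘ₗ D.counit.lTensor B ∘ₗ D.comul = LinearMap.id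
  counit_one : D.counit 1 = 1
  counit_mul : ∀ a b, D.counit (a * b) = D.counit a * D.counit b
  comul_one : D.comul 1 = 1 ⊗ₜ 1
  /-- The comultiplication is multiplicative for the braided product on `B ⊗ B`. -/
  comul_mul : D.comul ∘ₗ LinearMap.mul' k B =
    TensorProduct.map (LinearMap.mul' k B) (LinearMap.mul' k B) ∘ₗ
      middle (D.toYDData.braiding D.toYDData) ∘ₗ TensorProduct.map D.comul D.comul
  mul_antipode_rTensor : LinearMap.mul' k B ∘ₗ D.antipode.rTensor B ∘ₗ D.comul =
    Algebra.linearMap k B ∘ₗ D.counit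
  mul_antipode_lTensor : LinearMap.mul' k B ∘ₗ D.antipode.lTensor B ∘ₗ D.comul =
    Algebra.linearMap k B ∘ₗ D.counit

/-- The subspaces `Bₙ` form an `ℕ`-grading of `B` respected by all the structure maps. -/
structure IsGraded (D : BraidedHopfData k K B) (𝓑 : ℕ → Submodule k B) : Prop where
  isInternal : DirectSum.IsInternal 𝓑
  one_mem : 1 ∈ 𝓑 0
  mul_mem : ∀ m n, ∀ a ∈ 𝓑 m, ∀ b ∈ 𝓑 n, a * b ∈ 𝓑 (m + n)
  act_mem : ∀ n h, ∀ b ∈ 𝓑 n, D.act (h ⊗ₜ b) ∈ 𝓑 n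
  coact_mem : ∀ n, ∀ b ∈ 𝓑 n, D.coact b ∈ tensorSub k ⊤ (𝓑 n)
  comul_mem : ∀ n, ∀ b ∈ 𝓑 n,
    D.comul b ∈ ⨆ p ∈ Finset.HasAntidiagonal.antidiagonal n, tensorSub k (𝓑 p.1) (𝓑 p.2)
  counit_eq_zero : ∀ n, n ≠ 0 → ∀ b ∈ 𝓑 n, D.counit b = 0
  antipode_mem : ∀ n, ∀ b ∈ 𝓑 n, D.antipode b ∈ 𝓑 n

/-- The multiplication `(b ♯ h)(b' ♯ h') = b (h₁ · b') ♯ h₂ h'` of the Radford biproduct `B ♯ K`,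
whose underlying space is `B ⊗ K`. -/
def biproductMul (D : BraidedHopfData k K B) :
    (B ⊗[k] K) ⊗[k] (B ⊗[k] K) →ₗ[k] B ⊗[k] K :=
  TensorProduct.map (LinearMap.mul' k B) (LinearMap.mul' k K) ∘ₗ
    middle (D.act.rTensor K ∘ₗ TensorProduct.rightComm k K K B ∘ₗ
      (Coalgebra.comul (R := k) (A := K)).rTensor B)

/-- The comultiplication
`b ♯ h ↦ (b⁽¹⁾ ♯ (b⁽²⁾)₍₋₁₎ h₁) ⊗ ((b⁽²⁾)₍₀₎ ♯ h₂)` of the Radford biproduct `B ♯ K`. -/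
def biproductComul (D : BraidedHopfData k K B) :
    B ⊗[k] K →ₗ[k] (B ⊗[k] K) ⊗[k] (B ⊗[k] K) :=
  middle ((LinearMap.mul' k K).rTensor B ∘ₗ TensorProduct.rightComm k K B K ∘ₗ
      D.coact.rTensor K) ∘ₗ
    TensorProduct.map D.comul (Coalgebra.comul (R := k) (A := K))

/-- The counit `b ♯ h ↦ ε(b) ε(h)` of the Radford biproduct `B ♯ K`. -/
def biproductCounit (D : BraidedHopfData k K B) : B ⊗[k] K →ₗ[k] k :=
  TensorProduct.lid k k ∘ₗ TensorProduct.map D.counit (Coalgebra.counit (R := k) (A := K))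

/-- A bijection `B ♯ K ≃ A` which is an isomorphism of graded Hopf algebras, where `B ♯ K` has
the unit `1 ♯ 1` and the grading `(B ♯ K)ₙ = Bₙ ⊗ K`. As `A` is a Hopf algebra, such a map also
carries the antipode of `B ♯ K` to that of `A`. -/
structure IsBiproductIso {A : Type*} [Ring A] [HopfAlgebra k A] (D : BraidedHopfData k K B)
    (𝓑 : ℕ → Submodule k B) (𝓐 : ℕ → Submodule k A) (Φ : B ⊗[k] K ≃ₗ[k] A) : Prop where
  map_one : Φ (1 ⊗ₜ 1) = 1
  map_mul : Φ.toLinearMap ∘ₗ D.biproductMul =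
    LinearMap.mul' k A ∘ₗ TensorProduct.map Φ.toLinearMap Φ.toLinearMap
  map_comul : Coalgebra.comul ∘ₗ Φ.toLinearMap =
    TensorProduct.map Φ.toLinearMap Φ.toLinearMap ∘ₗ D.biproductComul
  map_counit : Coalgebra.counit ∘ₗ Φ.toLinearMap = D.biproductCounit
  map_grading : ∀ n, (tensorSub k (𝓑 n) ⊤).map Φ.toLinearMap = 𝓐 n

end BraidedHopfData

end YetterDrinfeld

end PointedHopf

end

/-!
Let `A` be a Hopf algebra with a split Hopf projection `π : A → K`, `ι : K → A`, where `K` is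
spanned by group-like elements. Radford's theorem says that `A = B ♯ K` with `B = A^{co π}`; as
`A` is spanned by the products `b ι(g)` with `b` in `B` homogeneous for the coaction of `K` and
`g` group-like, every identity involved reduces to a comparison of such elements. If `A` is left
or right Noetherian, so are its quotient `K` and, by contraction of one-sided ideals, `B`. A
Noetherian group algebra is finitely generated, as its group satisfies the ascending chain
condition on subgroups, and a Noetherian graded algebra is finitely generated over its component
of degree zero.

For `A = gr H` and `K = corad H` it remains to lift generators from `gr H` to `H`, which is
possible once the coradical filtration exhausts `H`. It does, because `H` is a locally finite
module over its convolution dual algebra, and the filtration refines its socle series.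
-/

noncomputable section

namespace PointedHopf

section GroupLikeSpan

open Coalgebra

variable {k K V W : Type*} [Field k] [AddCommGroup K] [Module k K] [Coalgebra k K]
  [AddCommGroup V] [Module k V] [AddCommGroup W] [Module k W]
  (hK : Submodule.span k {g : K | IsGroupLikeElem k g} = ⊤)

/-- The basis formed by the group-like elements of a coalgebra which they span. -/
def groupLikeBasis : Module.Basis (GroupLike k K) k K :=
  Module.Basis.mk (linearIndep_groupLikeVal (R := k) (A := K))
    (hK.ge.trans (Submodule.span_mono fun g hg => ⟨⟨g, hg⟩, rfl⟩))

@[simp]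
lemma groupLikeBasis_apply (g : GroupLike k K) : groupLikeBasis hK g = g.val :=
  Module.Basis.mk_apply _ _ g

include hK

lemma groupLike_hom_ext {f f' : K →ₗ[k] V} (h : ∀ g, IsGroupLikeElem k g → f g = f' g) : f = f' :=
  LinearMap.ext_on hK h

lemma groupLike_tensor_hom_ext {f f' : K ⊗[k] V →ₗ[k] W}
    (h : ∀ g, IsGroupLikeElem k g → ∀ v, f (g ⊗ₜ v) = f' (g ⊗ₜ v)) : f = f' :=
  TensorProduct.ext (groupLike_hom_ext hK fun g hg => LinearMap.ext (h g hg))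

lemma groupLike_tensor_hom_ext_right {f f' : V ⊗[k] K →ₗ[k] W}
    (h : ∀ v g, IsGroupLikeElem k g → f (v ⊗ₜ g) = f' (v ⊗ₜ g)) : f = f' :=
  TensorProduct.ext (LinearMap.ext fun v => groupLike_hom_ext hK (h v))

lemma span_coact_eq_tmul_groupLike (ρ : V →ₗ[k] V ⊗[k] K)
    (hε : ∀ v, TensorProduct.rid k V (counit.lTensor V (ρ v)) = v)
    (hρ : ∀ v, TensorProduct.assoc k V K K (ρ.rTensor K (ρ v)) = comul.lTensor V (ρ v)) :
    Submodule.span k {v | ∃ g, IsGroupLikeElem k g ∧ ρ v = v ⊗ₜ g} = ⊤ := by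
  refine eq_top_iff.2 fun v _ => ?_
  obtain ⟨x, hx⟩ := TensorProduct.eq_repr_basis_right (groupLikeBasis hK) (ρ v)
  simp only [groupLikeBasis_apply, Finsupp.sum] at hx
  have hv : v = ∑ g ∈ x.support, x g := by
    nth_rewrite 1 [← hε v, ← hx]
    simp [fun g : GroupLike k K => g.2.counit_eq_one]
  -- Coassociativity compares `∑ ρ(x_g) ⊗ g` with `∑ x_g ⊗ g ⊗ g`.
  let d := Finsupp.onFinset x.support (fun g => ρ (x g) - x g ⊗ₜ g.val) fun g hg =>
    Finsupp.mem_support_iff.2 fun h0 => hg (by simp [h0])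
  have hd : d = 0 := by
    refine TensorProduct.sum_tmul_basis_right_eq_zero (groupLikeBasis hK) d ?_
    rw [Finsupp.onFinset_sum _ fun _ => by simp]
    refine (TensorProduct.assoc k V K K).injective ?_
    have h := hρ v
    rw [← hx] at h
    simpa [TensorProduct.sub_tmul, sub_eq_zero, fun g : GroupLike k K => g.2.comul_eq_tmul_self]
      using h
  rw [hv]
  exact sum_mem fun g _ => Submodule.subset_span
    ⟨g.val, g.2, sub_eq_zero.1 (DFunLike.congr_fun hd g)⟩

lemma span_coact_eq_groupLike_tmul (δ : V →ₗ[k] K ⊗[k] V)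
    (hε : ∀ v, TensorProduct.lid k V (counit.rTensor V (δ v)) = v)
    (hδ : ∀ v, TensorProduct.assoc k K K V (comul.rTensor V (δ v)) = δ.lTensor K (δ v)) :
    Submodule.span k {v | ∃ g, IsGroupLikeElem k g ∧ δ v = g ⊗ₜ v} = ⊤ := by
  refine eq_top_iff.2 fun v _ => ?_
  obtain ⟨x, hx⟩ := TensorProduct.eq_repr_basis_left (groupLikeBasis hK) (δ v)
  simp only [groupLikeBasis_apply, Finsupp.sum] at hx
  have hv : v = ∑ g ∈ x.support, x g := by
    nth_rewrite 1 [← hε v, ← hx]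
    simp [fun g : GroupLike k K => g.2.counit_eq_one]
  let d := Finsupp.onFinset x.support (fun g => δ (x g) - g.val ⊗ₜ x g) fun g hg =>
    Finsupp.mem_support_iff.2 fun h0 => hg (by simp [h0])
  have hd : d = 0 := by
    refine TensorProduct.sum_tmul_basis_left_eq_zero (groupLikeBasis hK) d ?_
    rw [Finsupp.onFinset_sum _ fun _ => by simp]
    have h := (hδ v).symm
    rw [← hx] at h
    simpa [TensorProduct.tmul_sub, sub_eq_zero, fun g : GroupLike k K => g.2.comul_eq_tmul_self]
      using h
  rw [hv]
  exact sum_mem fun g _ => Submodule.subset_span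
    ⟨g.val, g.2, sub_eq_zero.1 (DFunLike.congr_fun hd g)⟩

end GroupLikeSpan

section SplitProjection

open Coalgebra HopfAlgebra

lemma map_mul_tmul {k A V W : Type*} [CommRing k] [Ring A] [Algebra k A] [AddCommGroup V]
    [Module k V] [AddCommGroup W] [Module k W] (f : A →ₗ[k] V) (f' : A →ₗ[k] W) (u : A ⊗[k] A)
    (z w : A) :
    TensorProduct.map f f' (u * z ⊗ₜ w) =
      TensorProduct.map (f ∘ₗ LinearMap.mulRight k z) (f' ∘ₗ LinearMap.mulRight k w) u := by
  induction u with
  | zero => simp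
  | add x y hx hy => simp only [add_mul, map_add, hx, hy]
  | tmul x y => simp

variable {k A K : Type*} [Field k] [Ring A] [HopfAlgebra k A] [Ring K] [HopfAlgebra k K]

/-- The right coaction `(id ⊗ π)Δ` of `K` on `A`. -/
def coactRight (π : A →ₐ[k] K) : A →ₐ[k] A ⊗[k] K :=
  (Algebra.TensorProduct.map (AlgHom.id k A) π).comp (Bialgebra.comulAlgHom k A)

/-- The algebra `A^{co π}` of right coinvariants `a`, those with `(id ⊗ π)Δ(a) = a ⊗ 1`. -/
def coinv (π : A →ₐ[k] K) : Subalgebra k A :=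
  AlgHom.equalizer (coactRight π) Algebra.TensorProduct.includeLeft

lemma coactRight_apply (π : A →ₐ[k] K) (a : A) :
    coactRight π a = TensorProduct.map LinearMap.id π.toLinearMap (comul (R := k) a) := rfl

lemma map_coactRight {V W : Type*} [AddCommGroup V] [Module k V] [AddCommGroup W] [Module k W]
    (π : A →ₐ[k] K) (f : A →ₗ[k] V) (q : K →ₗ[k] W) (a : A) :
    TensorProduct.map f q (coactRight π a) =
      TensorProduct.map f (q ∘ₗ π.toLinearMap) (comul (R := k) a) := by
  rw [coactRight_apply, TensorProduct.map_map, LinearMap.comp_id]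

lemma mem_coinv {π : A →ₐ[k] K} {a : A} : a ∈ coinv π ↔ coactRight π a = a ⊗ₜ 1 := Iff.rfl

lemma coactRight_coe {π : A →ₐ[k] K} (b : coinv π) : coactRight π (b : A) = (b : A) ⊗ₜ 1 := b.2

lemma lTensor_val_coinv_injective (π : A →ₐ[k] K) (V : Type*) [AddCommGroup V] [Module k V] :
    Function.Injective ((coinv π).val.toLinearMap.lTensor V) :=
  Module.Flat.lTensor_preserves_injective_linearMap _ Subtype.val_injective

/-- The endomorphism `a ↦ a₁ ιSπ(a₂)` of `A`, the composite of `IsSplitProjection.retract` with the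
inclusion of the coinvariants. -/
def retractEnd (π : A →ₐ[k] K) (ι : K →ₐ[k] A) : A →ₗ[k] A :=
  LinearMap.mul' k A ∘ₗ (ι.toLinearMap ∘ₗ antipode k).lTensor A ∘ₗ (coactRight π).toLinearMap

lemma retractEnd_of_coactRight_eq {π : A →ₐ[k] K} (ι : K →ₐ[k] A) {a : A} {x : K}
    (ha : coactRight π a = a ⊗ₜ x) : retractEnd π ι a = a * ι (antipode k x) := by
  simp [retractEnd, ha]

lemma incl_antipode_mul_cancel (ι : K →ₐ[k] A) {g : K} (hg : IsGroupLikeElem k g) :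
    ι (antipode k g) * ι g = 1 := by
  rw [← map_mul, hg.antipode_mul_cancel, map_one]

/-- Maps of bialgebras `π : A → K` and `ι : K → A` with `πι = id`, where `K` is spanned by
group-like elements: the situation of Radford's theorem over a group algebra. -/
structure IsSplitProjection (π : A →ₐ[k] K) (ι : K →ₐ[k] A) : Prop where
  comul_proj : ∀ a, comul (R := k) (π a) =
    TensorProduct.map π.toLinearMap π.toLinearMap (comul (R := k) a)
  counit_proj : ∀ a, counit (R := k) (π a) = counit (R := k) a
  comul_incl : ∀ x, comul (R := k) (ι x) =
    TensorProduct.map ι.toLinearMap ι.toLinearMap (comul (R := k) x)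
  counit_incl : ∀ x, counit (R := k) (ι x) = counit (R := k) x
  proj_incl : ∀ x, π (ι x) = x
  span_groupLike : Submodule.span k {g : K | IsGroupLikeElem k g} = ⊤

namespace IsSplitProjection

variable {π : A →ₐ[k] K} {ι : K →ₐ[k] A} (h : IsSplitProjection π ι)

include h

lemma incl_groupLike {g : K} (hg : IsGroupLikeElem k g) : IsGroupLikeElem k (ι g) where
  counit_eq_one := by rw [h.counit_incl, hg.counit_eq_one]
  comul_eq_tmul_self := by
    rw [h.comul_incl, hg.comul_eq_tmul_self]
    rfl

lemma coactRight_incl {g : K} (hg : IsGroupLikeElem k g) : coactRight π (ι g) = ι g ⊗ₜ g := by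
  rw [coactRight_apply, (h.incl_groupLike hg).comul_eq_tmul_self]
  simp [h.proj_incl]

lemma coactRight_mul_incl (b : coinv π) {g : K} (hg : IsGroupLikeElem k g) :
    coactRight π (b * ι g) = (b * ι g : A) ⊗ₜ g := by
  rw [map_mul, coactRight_coe, h.coactRight_incl hg, Algebra.TensorProduct.tmul_mul_tmul, one_mul]

lemma coactRight_incl_mul (b : coinv π) {g : K} (hg : IsGroupLikeElem k g) :
    coactRight π (ι g * b) = (ι g * b : A) ⊗ₜ g := by
  rw [map_mul, coactRight_coe, h.coactRight_incl hg, Algebra.TensorProduct.tmul_mul_tmul, mul_one]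

lemma counit_comp_proj : counit ∘ₗ π.toLinearMap = counit (R := k) (A := A) :=
  LinearMap.ext h.counit_proj

lemma map_proj_comp_comul :
    TensorProduct.map π.toLinearMap π.toLinearMap ∘ₗ comul = comul (R := k) ∘ₗ π.toLinearMap :=
  LinearMap.ext fun a => (h.comul_proj a).symm

lemma counit_coactRight (a : A) :
    TensorProduct.rid k A (counit.lTensor A (coactRight π a)) = a := by
  rw [LinearMap.lTensor, map_coactRight, h.counit_comp_proj, ← LinearMap.lTensor,
    Coalgebra.lTensor_counit_comul, TensorProduct.rid_tmul, one_smul]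

lemma coassoc_coactRight (a : A) :
    TensorProduct.assoc k A K K ((coactRight π).toLinearMap.rTensor K (coactRight π a)) =
      comul.lTensor A (coactRight π a) := by
  have := map_comul_right (k := k) LinearMap.id π.toLinearMap π.toLinearMap a
  rw [h.map_proj_comp_comul] at this
  rw [LinearMap.lTensor, map_coactRight, this, coactRight_apply, LinearMap.rTensor_map,
    LinearMap.comp_id]
  rfl

lemma mul_incl_antipode_mem_coinv {a : A} {g : K} (hg : IsGroupLikeElem k g)
    (ha : coactRight π a = a ⊗ₜ g) : a * ι (antipode k g) ∈ coinv π := by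
  rw [mem_coinv, map_mul, ha, h.coactRight_incl hg.antipode,
    Algebra.TensorProduct.tmul_mul_tmul, hg.mul_antipode_cancel]

lemma span_coinv_mul_incl :
    Submodule.span k {x | ∃ (b : coinv π) (g : K), IsGroupLikeElem k g ∧ x = b * ι g} = ⊤ := by
  rw [eq_top_iff, ← span_coact_eq_tmul_groupLike h.span_groupLike (coactRight π).toLinearMap
    h.counit_coactRight h.coassoc_coactRight]
  refine Submodule.span_mono fun a ⟨g, hg, ha⟩ =>
    ⟨⟨_, h.mul_incl_antipode_mem_coinv hg ha⟩, g, hg, ?_⟩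
  rw [mul_assoc, incl_antipode_mul_cancel ι hg, mul_one]

lemma hom_ext {V : Type*} [AddCommGroup V] [Module k V] {f f' : A →ₗ[k] V}
    (H : ∀ (b : coinv π) (g : K), IsGroupLikeElem k g → f (b * ι g) = f' (b * ι g)) : f = f' :=
  LinearMap.ext_on h.span_coinv_mul_incl (by rintro _ ⟨b, g, hg, rfl⟩; exact H b g hg)

lemma retractEnd_mul_incl (b : coinv π) {g : K} (hg : IsGroupLikeElem k g) :
    retractEnd π ι (b * ι g) = b := by
  rw [retractEnd_of_coactRight_eq ι (h.coactRight_mul_incl b hg), mul_assoc, ← map_mul,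
    hg.mul_antipode_cancel, map_one, mul_one]

lemma retractEnd_mem (a : A) : retractEnd π ι a ∈ Subalgebra.toSubmodule (coinv π) := by
  have : (⊤ : Submodule k A) ≤ (Subalgebra.toSubmodule (coinv π)).comap (retractEnd π ι) := by
    rw [← h.span_coinv_mul_incl, Submodule.span_le]
    rintro _ ⟨b, g, hg, rfl⟩
    simp [h.retractEnd_mul_incl b hg]
  exact this trivial

/-- The retraction `p : A → B`, `a ↦ a₁ ιSπ(a₂)`, onto the algebra `B` of coinvariants. -/
def retract : A →ₗ[k] coinv π :=
  LinearMap.codRestrict (Subalgebra.toSubmodule (coinv π)) (retractEnd π ι) h.retractEnd_mem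

lemma coe_retract_of_coactRight_eq {a : A} {x : K} (ha : coactRight π a = a ⊗ₜ x) :
    (h.retract a : A) = a * ι (antipode k x) :=
  retractEnd_of_coactRight_eq ι ha

lemma retract_mul_incl (b : coinv π) {g : K} (hg : IsGroupLikeElem k g) :
    h.retract (b * ι g) = b :=
  Subtype.ext (h.retractEnd_mul_incl b hg)

lemma retract_coe (b : coinv π) : h.retract b = b := by
  simpa using h.retract_mul_incl b .one

lemma retract_comp_mulRight {g : K} (hg : IsGroupLikeElem k g) :
    h.retract ∘ₗ LinearMap.mulRight k (ι g) = h.retract :=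
  h.hom_ext fun b x hx => by
    rw [LinearMap.comp_apply, LinearMap.mulRight_apply, mul_assoc, ← map_mul,
      h.retract_mul_incl b hx, h.retract_mul_incl b (hx.mul hg)]

lemma retract_mul_groupLike (a : A) {g : K} (hg : IsGroupLikeElem k g) :
    h.retract (a * ι g) = h.retract a :=
  LinearMap.congr_fun (h.retract_comp_mulRight hg) a

lemma retract_mul_retract (a a' : A) : h.retract (a * h.retract a') = h.retract (a * a') := by
  have : h.retract ∘ₗ LinearMap.mulLeft k a ∘ₗ (coinv π).val.toLinearMap ∘ₗ h.retract =
      h.retract ∘ₗ LinearMap.mulLeft k a := h.hom_ext fun b x hx => by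
    simp only [LinearMap.comp_apply, h.retract_mul_incl b hx, LinearMap.mulLeft_apply]
    rw [← mul_assoc, h.retract_mul_groupLike _ hx]
    rfl
  exact LinearMap.congr_fun this a'

lemma retract_coe_mul (b : coinv π) (a : A) : h.retract (b * a) = b * h.retract a := by
  rw [← h.retract_mul_retract, ← MulMemClass.coe_mul, h.retract_coe]

lemma comul_mul_incl (a : A) {g : K} (hg : IsGroupLikeElem k g) :
    comul (R := k) (a * ι g) = comul (R := k) a * (ι g ⊗ₜ ι g) := by
  rw [Bialgebra.comul_mul, (h.incl_groupLike hg).comul_eq_tmul_self]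

lemma comul_incl_mul (a : A) {g : K} (hg : IsGroupLikeElem k g) :
    comul (R := k) (ι g * a) = (ι g ⊗ₜ ι g) * comul (R := k) a := by
  rw [Bialgebra.comul_mul, (h.incl_groupLike hg).comul_eq_tmul_self]

lemma map_retract_mul {V : Type*} [AddCommGroup V] [Module k V] (f : A →ₗ[k] V) (u : A ⊗[k] A)
    {g : K} (hg : IsGroupLikeElem k g) :
    TensorProduct.map f h.retract (u * (ι g ⊗ₜ ι g)) =
      TensorProduct.map (f ∘ₗ LinearMap.mulRight k (ι g)) h.retract u := by
  rw [map_mul_tmul, h.retract_comp_mulRight hg]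

/-- The coalgebra structure of `B` is that of the quotient `A / A K⁺` of `A`. -/
lemma map_retract_comul (a : A) :
    TensorProduct.map h.retract h.retract (comul (R := k) (h.retract a : A)) =
      TensorProduct.map h.retract h.retract (comul (R := k) a) := by
  have : TensorProduct.map h.retract h.retract ∘ₗ comul ∘ₗ (coinv π).val.toLinearMap ∘ₗ h.retract =
      TensorProduct.map h.retract h.retract ∘ₗ comul (R := k) := h.hom_ext fun b x hx => by
    simp only [LinearMap.comp_apply, h.retract_mul_incl b hx]
    rw [h.comul_mul_incl _ hx, h.map_retract_mul _ _ hx, h.retract_comp_mulRight hx]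
    rfl
  exact LinearMap.congr_fun this a

/-- `Δ(B) ⊆ A ⊗ B`. -/
lemma map_id_retract_comul (b : coinv π) :
    TensorProduct.map LinearMap.id ((coinv π).val.toLinearMap ∘ₗ h.retract) (comul (R := k) (b : A))
      = comul (R := k) (b : A) := by
  have hretract : (coinv π).val.toLinearMap ∘ₗ h.retract =
      (LinearMap.mul' k A ∘ₗ (ι.toLinearMap ∘ₗ antipode k).lTensor A) ∘ₗ
        (TensorProduct.map LinearMap.id π.toLinearMap ∘ₗ comul) := rfl
  have hcoassoc := map_comul_right (k := k) LinearMap.id LinearMap.id π.toLinearMap (b : A)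
  have hcoinv : TensorProduct.map comul π.toLinearMap (comul (R := k) (b : A)) =
      comul (R := k) (b : A) ⊗ₜ 1 := by
    simpa only [coactRight_apply, LinearMap.rTensor_map, LinearMap.comp_id,
      LinearMap.rTensor_tmul] using congrArg ((comul (R := k)).rTensor K) (coactRight_coe b)
  rw [hretract, ← LinearMap.lTensor_map, hcoassoc, TensorProduct.map_id, LinearMap.id_comp, hcoinv]
  induction comul (R := k) (b : A) with
  | zero => simp
  | add x y hx hy => simp only [TensorProduct.add_tmul, map_add, hx, hy]
  | tmul x y => simp

lemma map_comp_retract_comul {V W : Type*} [AddCommGroup V] [Module k V] [AddCommGroup W]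
    [Module k W] (f : A →ₗ[k] V) (q : A →ₗ[k] W) (b : coinv π) :
    TensorProduct.map f (q ∘ₗ (coinv π).val.toLinearMap ∘ₗ h.retract) (comul (R := k) (b : A)) =
      TensorProduct.map f q (comul (R := k) (b : A)) := by
  conv_rhs => rw [← h.map_id_retract_comul b, TensorProduct.map_map, LinearMap.comp_id]

end IsSplitProjection

end SplitProjection

section Coaction

open Coalgebra HopfAlgebra

lemma map_counit_comul {k C V : Type*} [CommRing k] [AddCommGroup C] [Module k C] [Coalgebra k C]
    [AddCommGroup V] [Module k V] (f : C →ₗ[k] V) (c : C) :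
    TensorProduct.map counit f (comul (R := k) c) = 1 ⊗ₜ f c := by
  simpa only [LinearMap.rTensor, LinearMap.lTensor_map, LinearMap.comp_id, LinearMap.lTensor_tmul]
    using congrArg (f.lTensor k) (Coalgebra.rTensor_counit_comul (R := k) c)

lemma map_comul_counit {k C V : Type*} [CommRing k] [AddCommGroup C] [Module k C] [Coalgebra k C]
    [AddCommGroup V] [Module k V] (f : C →ₗ[k] V) (c : C) :
    TensorProduct.map f counit (comul (R := k) c) = f c ⊗ₜ 1 := by
  simpa only [LinearMap.lTensor, LinearMap.rTensor_map, LinearMap.comp_id, LinearMap.rTensor_tmul]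
    using congrArg (f.rTensor k) (Coalgebra.lTensor_counit_comul (R := k) c)

variable {k A K : Type*} [Field k] [Ring A] [HopfAlgebra k A] [Ring K] [HopfAlgebra k K]

lemma proj_coe {π : A →ₐ[k] K} (b : coinv π) :
    π (b : A) = algebraMap k K (counit (R := k) (b : A)) := by
  have := congrArg (fun u => TensorProduct.lid k K ((counit (R := k)).rTensor K u))
    (coactRight_coe b)
  simp only [coactRight_apply, LinearMap.rTensor_map, LinearMap.comp_id, LinearMap.rTensor_tmul,
    TensorProduct.lid_tmul, map_counit_comul] at this
  simpa [Algebra.algebraMap_eq_smul_one] using this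

namespace IsSplitProjection

variable {π : A →ₐ[k] K} {ι : K →ₐ[k] A} (h : IsSplitProjection π ι)

include h

/-- `a = p(a₁) ιπ(a₂)`. -/
lemma retract_mul_proj :
    LinearMap.mul' k A ∘ₗ TensorProduct.map (coinv π).val.toLinearMap ι.toLinearMap ∘ₗ
      TensorProduct.map h.retract π.toLinearMap ∘ₗ comul = LinearMap.id := by
  refine h.hom_ext fun b x hx => ?_
  have : TensorProduct.map h.retract π.toLinearMap (comul (R := k) (b * ι x : A)) = b ⊗ₜ x := by
    rw [← LinearMap.id_comp π.toLinearMap, ← map_coactRight, h.coactRight_mul_incl b hx,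
      TensorProduct.map_tmul, h.retract_mul_incl b hx, LinearMap.id_apply]
  simp only [LinearMap.comp_apply, this]
  simp

/-- The left coaction `(π ⊗ id)Δ` of `K` on `B`. -/
def coactLeft : coinv π →ₗ[k] K ⊗[k] coinv π :=
  TensorProduct.map π.toLinearMap h.retract ∘ₗ comul ∘ₗ (coinv π).val.toLinearMap

lemma coactLeft_apply (b : coinv π) :
    h.coactLeft b = TensorProduct.map π.toLinearMap h.retract (comul (R := k) (b : A)) := rfl

lemma lTensor_val_coactLeft (b : coinv π) :
    (coinv π).val.toLinearMap.lTensor K (h.coactLeft b) =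
      TensorProduct.map π.toLinearMap LinearMap.id (comul (R := k) (b : A)) := by
  rw [coactLeft_apply, LinearMap.lTensor_map, ← LinearMap.id_comp (_ ∘ₗ h.retract),
    h.map_comp_retract_comul]

/-- `π(a₁) ⊗ p(a₂) = p(a₁)₍₋₁₎ π(a₂) ⊗ p(a₁)₍₀₎`. -/
lemma map_proj_retract_comul (a : A) :
    (LinearMap.mul' k K).rTensor (coinv π) (TensorProduct.rightComm k K (coinv π) K
      (TensorProduct.map (h.coactLeft ∘ₗ h.retract) π.toLinearMap (comul (R := k) a))) =
      TensorProduct.map π.toLinearMap h.retract (comul (R := k) a) := by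
  have : (LinearMap.mul' k K).rTensor (coinv π) ∘ₗ
      (TensorProduct.rightComm k K (coinv π) K).toLinearMap ∘ₗ
      (h.coactLeft ∘ₗ h.retract).rTensor K ∘ₗ (coactRight π).toLinearMap =
      TensorProduct.map π.toLinearMap h.retract ∘ₗ comul := h.hom_ext fun b x hx => by
    simp only [LinearMap.comp_apply, AlgHom.toLinearMap_apply]
    rw [h.coactRight_mul_incl b hx, h.comul_mul_incl _ hx, h.map_retract_mul _ _ hx]
    simp only [LinearMap.rTensor_tmul, LinearMap.comp_apply, h.retract_mul_incl b hx,
      coactLeft_apply]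
    induction comul (R := k) (b : A) with
    | zero => simp
    | add x y hx hy => simp only [TensorProduct.add_tmul, map_add, hx, hy]
    | tmul y z => simp [h.proj_incl]
  rw [← LinearMap.id_comp π.toLinearMap, ← map_coactRight]
  exact LinearMap.congr_fun this a

/-- The action `h · b = p(ι(h) b)` of `K` on `B`. -/
def adj : K ⊗[k] coinv π →ₗ[k] coinv π :=
  h.retract ∘ₗ LinearMap.mul' k A ∘ₗ TensorProduct.map ι.toLinearMap (coinv π).val.toLinearMap

lemma adj_tmul (x : K) (b : coinv π) : h.adj (x ⊗ₜ b) = h.retract (ι x * b) := rfl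

lemma coe_adj {g : K} (hg : IsGroupLikeElem k g) (b : coinv π) :
    (h.adj (g ⊗ₜ b) : A) = ι g * b * ι (antipode k g) :=
  h.coe_retract_of_coactRight_eq (h.coactRight_incl_mul b hg)

/-- `p(a₁) (π(a₂) · c) = p(a c)`. -/
lemma retract_mul_adj (a : A) (c : coinv π) :
    LinearMap.mul' k (coinv π) (TensorProduct.map h.retract
      (h.adj ∘ₗ (TensorProduct.mk k K (coinv π)).flip c ∘ₗ π.toLinearMap) (comul (R := k) a)) =
      h.retract (a * c) := by
  have : LinearMap.mul' k (coinv π) ∘ₗ TensorProduct.map h.retract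
      (h.adj ∘ₗ (TensorProduct.mk k K (coinv π)).flip c) ∘ₗ (coactRight π).toLinearMap =
      h.retract ∘ₗ LinearMap.mulRight k (c : A) := h.hom_ext fun b x hx => by
    simp only [LinearMap.comp_apply, AlgHom.toLinearMap_apply]
    rw [h.coactRight_mul_incl b hx]
    simp only [TensorProduct.map_tmul, LinearMap.comp_apply, h.retract_mul_incl b hx,
      LinearMap.mul'_apply, LinearMap.flip_apply, TensorProduct.mk_apply, adj_tmul,
      LinearMap.mulRight_apply, mul_assoc, h.retract_coe_mul]
  rw [← LinearMap.comp_assoc, ← map_coactRight]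
  exact LinearMap.congr_fun this a

lemma coassoc_coactLeft (b : coinv π) :
    TensorProduct.assoc k K K (coinv π) (comul.rTensor (coinv π) (h.coactLeft b)) =
      h.coactLeft.lTensor K (h.coactLeft b) := by
  have := h.map_comp_retract_comul π.toLinearMap
    (TensorProduct.map π.toLinearMap h.retract ∘ₗ comul) b
  rw [map_comul_right, h.map_proj_comp_comul] at this
  rw [coactLeft_apply, LinearMap.lTensor_map, LinearMap.rTensor_map, ← this]
  rfl

lemma counit_coactLeft (b : coinv π) :
    TensorProduct.lid k (coinv π) (counit.rTensor (coinv π) (h.coactLeft b)) = b := by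
  rw [coactLeft_apply, LinearMap.rTensor_map, h.counit_comp_proj, map_counit_comul,
    TensorProduct.lid_tmul, one_smul, retract_coe]

lemma span_coactLeft_eq_groupLike_tmul :
    Submodule.span k {b | ∃ g, IsGroupLikeElem k g ∧ h.coactLeft b = g ⊗ₜ b} = ⊤ :=
  span_coact_eq_groupLike_tmul h.span_groupLike h.coactLeft h.counit_coactLeft h.coassoc_coactLeft

lemma map_proj_id_comul {b : coinv π} {g : K} (hb : h.coactLeft b = g ⊗ₜ b) :
    TensorProduct.map π.toLinearMap LinearMap.id (comul (R := k) (b : A)) = g ⊗ₜ (b : A) := by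
  rw [← h.lTensor_val_coactLeft, hb]
  rfl

end IsSplitProjection

end Coaction

section Antipode

open Coalgebra HopfAlgebra

variable {k A K : Type*} [Field k] [Ring A] [HopfAlgebra k A] [Ring K] [HopfAlgebra k K]

/-- The map `a ↦ ιπ(a₁) S(a₂)`, whose restriction to the coinvariants is their braided
antipode. -/
def skewAntipode (π : A →ₐ[k] K) (ι : K →ₐ[k] A) : A →ₗ[k] A :=
  LinearMap.mul' k A ∘ₗ TensorProduct.map (ι.toLinearMap ∘ₗ π.toLinearMap) (antipode k) ∘ₗ comul

namespace IsSplitProjection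

variable {π : A →ₐ[k] K} {ι : K →ₐ[k] A} (h : IsSplitProjection π ι)

include h

/-- Both sides are the inverse of `π` under convolution. -/
lemma proj_comp_antipode : π.toLinearMap ∘ₗ antipode k = antipode k ∘ₗ π.toLinearMap := by
  have hleft : WithConv.toConv (π.toLinearMap ∘ₗ antipode k) *
      WithConv.toConv π.toLinearMap = 1 := by
    have := LinearMap.algHom_comp_convMul_distrib π (WithConv.toConv (antipode k))
      (WithConv.toConv LinearMap.id)
    rw [LinearMap.antipode_mul_id] at this
    refine WithConv.ofConv_injective (this.symm.trans ?_)
    ext a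
    simp
  have hright : WithConv.toConv π.toLinearMap *
      WithConv.toConv (antipode k ∘ₗ π.toLinearMap) = 1 := by
    ext a
    rw [LinearMap.convMul_apply, WithConv.ofConv_toConv, WithConv.ofConv_toConv,
      ← LinearMap.lTensor_map, ← h.comul_proj, mul_antipode_lTensor_comul_apply, h.counit_proj,
      LinearMap.convOne_apply]
  exact congrArg WithConv.ofConv (left_inv_eq_right_inv hleft hright)

lemma antipode_incl {g : K} (hg : IsGroupLikeElem k g) : antipode k (ι g) = ι (antipode k g) :=
  left_inv_eq_right_inv (h.incl_groupLike hg).antipode_mul_cancel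
    (by rw [← map_mul, hg.mul_antipode_cancel, map_one])

lemma skewAntipode_mul_incl (a : A) {g : K} (hg : IsGroupLikeElem k g) :
    skewAntipode π ι (a * ι g) = skewAntipode π ι a := by
  simp only [skewAntipode, LinearMap.comp_apply]
  rw [h.comul_mul_incl _ hg]
  induction comul (R := k) a with
  | zero => simp
  | add x y hx hy => simp only [add_mul, map_add, hx, hy]
  | tmul x y =>
    simp only [Algebra.TensorProduct.tmul_mul_tmul, TensorProduct.map_tmul, LinearMap.comp_apply,
      AlgHom.toLinearMap_apply, LinearMap.mul'_apply, antipode_mul_antidistrib, map_mul,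
      h.proj_incl]
    rw [mul_assoc, ← mul_assoc (ι g), (h.incl_groupLike hg).mul_antipode_cancel, one_mul]

lemma skewAntipode_incl_mul (a : A) {g : K} (hg : IsGroupLikeElem k g) :
    skewAntipode π ι (ι g * a) = ι g * skewAntipode π ι a * ι (antipode k g) := by
  simp only [skewAntipode, LinearMap.comp_apply]
  rw [h.comul_incl_mul _ hg]
  induction comul (R := k) a with
  | zero => simp
  | add x y hx hy => simp only [mul_add, add_mul, map_add, hx, hy]
  | tmul x y =>
    simp only [Algebra.TensorProduct.tmul_mul_tmul, TensorProduct.map_tmul, LinearMap.comp_apply,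
      AlgHom.toLinearMap_apply, LinearMap.mul'_apply, antipode_mul_antidistrib, map_mul,
      h.proj_incl, h.antipode_incl hg, mul_assoc]

lemma skewAntipode_retract (a : A) : skewAntipode π ι (h.retract a) = skewAntipode π ι a := by
  have : skewAntipode π ι ∘ₗ (coinv π).val.toLinearMap ∘ₗ h.retract = skewAntipode π ι :=
    h.hom_ext fun b x hx => by
      simp [h.retract_mul_incl b hx, h.skewAntipode_mul_incl _ hx]
  exact LinearMap.congr_fun this a

lemma skewAntipode_of_coactLeft_eq {b : coinv π} {g : K} (hb : h.coactLeft b = g ⊗ₜ b) :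
    skewAntipode π ι b = ι g * antipode k (b : A) := by
  have := congrArg (LinearMap.mul' k A ∘ₗ TensorProduct.map ι.toLinearMap (antipode k))
    (h.map_proj_id_comul hb)
  rwa [LinearMap.comp_apply, TensorProduct.map_map] at this

lemma coactRight_antipode {b : coinv π} {g : K} (hb : h.coactLeft b = g ⊗ₜ b) :
    coactRight π (antipode k (b : A)) = antipode k (b : A) ⊗ₜ antipode k g := by
  rw [coactRight_apply, comul_antipode, TensorProduct.map_map, LinearMap.id_comp,
    TensorProduct.map_comm, h.proj_comp_antipode,
    ← LinearMap.comp_id (antipode k (A := A)), ← TensorProduct.map_map, h.map_proj_id_comul hb]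
  rfl

lemma skewAntipode_mem (b : coinv π) : skewAntipode π ι b ∈ coinv π := by
  have : (⊤ : Submodule k (coinv π)) ≤ (Subalgebra.toSubmodule (coinv π)).comap
      (skewAntipode π ι ∘ₗ (coinv π).val.toLinearMap) := by
    rw [← h.span_coactLeft_eq_groupLike_tmul, Submodule.span_le]
    rintro b ⟨g, hg, hb⟩
    change skewAntipode π ι b ∈ coinv π
    rw [h.skewAntipode_of_coactLeft_eq hb, mem_coinv, map_mul, h.coactRight_incl hg,
      h.coactRight_antipode hb, Algebra.TensorProduct.tmul_mul_tmul, hg.mul_antipode_cancel]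
  exact this trivial

/-- The structure on the algebra `B` of coinvariants which makes it a Hopf algebra in the category
of Yetter-Drinfel'd modules over `K`. -/
def braided : BraidedHopfData k K (coinv π) where
  act := h.adj
  coact := h.coactLeft
  comul := TensorProduct.map h.retract h.retract ∘ₗ comul ∘ₗ (coinv π).val.toLinearMap
  counit := counit ∘ₗ (coinv π).val.toLinearMap
  antipode := h.retract ∘ₗ skewAntipode π ι ∘ₗ (coinv π).val.toLinearMap

lemma braided_comul_apply (b : coinv π) :
    h.braided.comul b = TensorProduct.map h.retract h.retract (comul (R := k) (b : A)) := rfl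

lemma braided_comul_comp_retract :
    h.braided.comul ∘ₗ h.retract = TensorProduct.map h.retract h.retract ∘ₗ comul :=
  LinearMap.ext h.map_retract_comul

lemma braided_counit_comp_retract : h.braided.counit ∘ₗ h.retract = counit (R := k) (A := A) :=
  h.hom_ext fun b x hx => by
    simp [braided, h.retract_mul_incl b hx, (h.incl_groupLike hx).counit_eq_one]

lemma coe_braided_antipode (b : coinv π) : (h.braided.antipode b : A) = skewAntipode π ι b :=
  congrArg Subtype.val (h.retract_coe ⟨_, h.skewAntipode_mem b⟩)

lemma coe_braided_antipode_retract (a : A) :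
    (h.braided.antipode (h.retract a) : A) = skewAntipode π ι a := by
  rw [coe_braided_antipode, skewAntipode_retract]

end IsSplitProjection

end Antipode

section Braiding

variable {k A K V W B : Type*} [Field k] [Ring A] [Algebra k A] [Ring K] [HopfAlgebra k K]
  [AddCommGroup V] [Module k V] [AddCommGroup W] [Module k W] [Ring B] [Algebra k B]

lemma tensor_coact_apply (M : YDData k K V) (N : YDData k K W) (u : V ⊗[k] W) :
    (M.tensor N).coact u = TensorProduct.assoc k K V W (((LinearMap.mul' k K).rTensor V ∘ₗ
      (TensorProduct.rightComm k K V K).toLinearMap).rTensor W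
        ((TensorProduct.assoc k (K ⊗[k] V) K W).symm
          (TensorProduct.map M.coact N.coact u))) := by
  have : (LinearMap.mul' k K).rTensor (V ⊗[k] W) ∘ₗ
      (TensorProduct.tensorTensorTensorComm k K V K W).toLinearMap =
      (TensorProduct.assoc k K V W).toLinearMap ∘ₗ ((LinearMap.mul' k K).rTensor V ∘ₗ
      (TensorProduct.rightComm k K V K).toLinearMap).rTensor W ∘ₗ
        (TensorProduct.assoc k (K ⊗[k] V) K W).symm.toLinearMap := by
    ext x v y w
    rfl
  exact LinearMap.congr_fun this _

lemma lTensor_mul_tensorTensorTensorComm (φ : B →ₐ[k] A) (u v : K ⊗[k] B) :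
    φ.toLinearMap.lTensor K ((LinearMap.mul' k B).lTensor K
      ((LinearMap.mul' k K).rTensor (B ⊗[k] B)
        (TensorProduct.tensorTensorTensorComm k K B K B (u ⊗ₜ v)))) =
      φ.toLinearMap.lTensor K u * φ.toLinearMap.lTensor K v := by
  have : φ.toLinearMap.lTensor K ∘ₗ (LinearMap.mul' k B).lTensor K ∘ₗ
      (LinearMap.mul' k K).rTensor (B ⊗[k] B) ∘ₗ
        (TensorProduct.tensorTensorTensorComm k K B K B).toLinearMap =
      LinearMap.mul' k (K ⊗[k] A) ∘ₗ
        TensorProduct.map (φ.toLinearMap.lTensor K) (φ.toLinearMap.lTensor K) := by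
    ext x b y c
    simp
  exact LinearMap.congr_fun this (u ⊗ₜ v)

/-- `(b ⊗ b')(c ⊗ d) = b (b'₍₋₁₎ · c) ⊗ b'₍₀₎ d` in the braided tensor product. -/
lemma map_mul_middle_braiding (M : YDData k K B) (c d : B) (u : B ⊗[k] B) :
    TensorProduct.map (LinearMap.mul' k B) (LinearMap.mul' k B)
      (middle (M.braiding M) (u ⊗ₜ (c ⊗ₜ d))) =
      TensorProduct.map (LinearMap.mul' k B ∘ₗ
        (M.act ∘ₗ (TensorProduct.mk k K B).flip c).lTensor B) (LinearMap.mulRight k d)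
        ((TensorProduct.assoc k B K B).symm (M.coact.lTensor B u)) := by
  have middle_braiding : middle (M.braiding M) (u ⊗ₜ[k] (c ⊗ₜ[k] d)) =
      middle (M.act.rTensor B ∘ₗ (TensorProduct.rightComm k K B B).toLinearMap)
        (M.coact.lTensor B u ⊗ₜ[k] (c ⊗ₜ[k] d)) := by
    induction u with
    | zero => simp
    | add x y hx hy => simp only [map_add, TensorProduct.add_tmul, hx, hy]
    | tmul x y => simp [middle, YDData.braiding]
  have map_mul_middle : TensorProduct.map (LinearMap.mul' k B) (LinearMap.mul' k B) ∘ₗ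
      middle (M.act.rTensor B ∘ₗ (TensorProduct.rightComm k K B B).toLinearMap) ∘ₗ
      (TensorProduct.mk k (B ⊗[k] (K ⊗[k] B)) (B ⊗[k] B)).flip (c ⊗ₜ d) =
      TensorProduct.map (LinearMap.mul' k B ∘ₗ
        (M.act ∘ₗ (TensorProduct.mk k K B).flip c).lTensor B) (LinearMap.mulRight k d) ∘ₗ
        (TensorProduct.assoc k B K B).symm.toLinearMap := by
    ext b x y
    simp [middle]
  rw [middle_braiding]
  exact LinearMap.congr_fun map_mul_middle (M.coact.lTensor B u)

lemma map_middle_coact (D : BraidedHopfData k K B) (φ : B →ₐ[k] A) (ι : K →ₐ[k] A) (g : K)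
    (u : B ⊗[k] B) :
    TensorProduct.map (LinearMap.mul' k A ∘ₗ TensorProduct.map φ.toLinearMap ι.toLinearMap)
      (LinearMap.mul' k A ∘ₗ TensorProduct.map φ.toLinearMap ι.toLinearMap)
      (middle ((LinearMap.mul' k K).rTensor B ∘ₗ
        TensorProduct.rightComm k K B K ∘ₗ D.coact.rTensor K) (u ⊗ₜ (g ⊗ₜ g))) =
      TensorProduct.map (LinearMap.mul' k A ∘ₗ TensorProduct.map φ.toLinearMap ι.toLinearMap)
        φ.toLinearMap ((TensorProduct.assoc k B K B).symm (D.coact.lTensor B u)) *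
          (ι g ⊗ₜ ι g) := by
  have middle_coact : middle ((LinearMap.mul' k K).rTensor B ∘ₗ
        TensorProduct.rightComm k K B K ∘ₗ D.coact.rTensor K) (u ⊗ₜ (g ⊗ₜ g)) =
      middle ((LinearMap.mul' k K).rTensor B ∘ₗ
        (TensorProduct.rightComm k K B K).toLinearMap) (D.coact.lTensor B u ⊗ₜ (g ⊗ₜ g)) := by
    induction u with
    | zero => simp
    | add x y hx hy => simp only [map_add, TensorProduct.add_tmul, hx, hy]
    | tmul x y => simp [middle]
  have map_middle : TensorProduct.map
        (LinearMap.mul' k A ∘ₗ TensorProduct.map φ.toLinearMap ι.toLinearMap)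
        (LinearMap.mul' k A ∘ₗ TensorProduct.map φ.toLinearMap ι.toLinearMap) ∘ₗ
      middle ((LinearMap.mul' k K).rTensor B ∘ₗ (TensorProduct.rightComm k K B K).toLinearMap) ∘ₗ
      (TensorProduct.mk k (B ⊗[k] (K ⊗[k] B)) (K ⊗[k] K)).flip (g ⊗ₜ g) =
      LinearMap.mulRight k (ι g ⊗ₜ ι g) ∘ₗ
        TensorProduct.map (LinearMap.mul' k A ∘ₗ TensorProduct.map φ.toLinearMap ι.toLinearMap)
          φ.toLinearMap ∘ₗ (TensorProduct.assoc k B K B).symm.toLinearMap := by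
    ext b x c
    simp [middle, mul_assoc]
  rw [middle_coact]
  exact LinearMap.congr_fun map_middle (D.coact.lTensor B u)

end Braiding

section YetterDrinfeld

open Coalgebra HopfAlgebra

variable {k A K : Type*} [Field k] [Ring A] [HopfAlgebra k A] [Ring K] [HopfAlgebra k K]

namespace IsSplitProjection

variable {π : A →ₐ[k] K} {ι : K →ₐ[k] A} (h : IsSplitProjection π ι)

include h

lemma retract_one : h.retract 1 = 1 := h.retract_coe 1

lemma retract_incl (x : K) : h.retract (ι x) = counit (R := k) x • 1 := by
  have : h.retract ∘ₗ ι.toLinearMap = LinearMap.toSpanSingleton k (coinv π) 1 ∘ₗ counit :=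
    groupLike_hom_ext h.span_groupLike fun g hg => by
      simpa [hg.counit_eq_one] using h.retract_mul_incl 1 hg
  exact LinearMap.congr_fun this x

lemma tensor_act_groupLike {g : K} (hg : IsGroupLikeElem k g) (b c : coinv π) :
    (h.braided.toYDData.tensor h.braided.toYDData).act (g ⊗ₜ (b ⊗ₜ c)) =
      h.adj (g ⊗ₜ b) ⊗ₜ h.adj (g ⊗ₜ c) := by
  simp [YDData.tensor, hg.comul_eq_tmul_self, braided]

lemma adj_mul {g : K} (hg : IsGroupLikeElem k g) (b c : coinv π) :
    h.adj (g ⊗ₜ (b * c)) = h.adj (g ⊗ₜ b) * h.adj (g ⊗ₜ c) := by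
  apply Subtype.ext
  simp only [MulMemClass.coe_mul, h.coe_adj hg, mul_assoc]
  rw [← mul_assoc (ι (antipode k g)) (ι g), incl_antipode_mul_cancel ι hg, one_mul]

lemma rightComm_coactLeft_retract {a : A} {g : K} (ha : coactRight π a = a ⊗ₜ g) :
    (LinearMap.mul' k K).rTensor (coinv π) (TensorProduct.rightComm k K (coinv π) K
      (h.coactLeft (h.retract a) ⊗ₜ g)) =
      TensorProduct.map π.toLinearMap h.retract (comul (R := k) a) := by
  rw [← h.map_proj_retract_comul, ← LinearMap.comp_id (h.coactLeft ∘ₗ h.retract),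
    ← LinearMap.rTensor_map, ← coactRight_apply, ha]
  rfl

lemma map_proj_retract_incl_mul (g : K) (u : A ⊗[k] A) :
    TensorProduct.map π.toLinearMap h.retract ((ι g ⊗ₜ ι g) * u) =
      TensorProduct.map (LinearMap.mul' k K) h.adj (TensorProduct.tensorTensorTensorComm k K K K _
        ((g ⊗ₜ g) ⊗ₜ TensorProduct.map π.toLinearMap h.retract u)) := by
  induction u with
  | zero => simp
  | add x y hx hy => simp only [mul_add, map_add, TensorProduct.tmul_add, hx, hy]
  | tmul x y => simp [adj_tmul, h.retract_mul_retract, h.proj_incl]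

lemma isYetterDrinfeld : h.braided.toYDData.IsYetterDrinfeld where
  one_act v := by
    change h.retract (ι 1 * v) = v
    rw [map_one, one_mul, h.retract_coe]
  mul_act g x v := by
    change h.retract (ι (g * x) * v) = h.retract (ι g * h.retract (ι x * v))
    rw [h.retract_mul_retract, map_mul ι, mul_assoc]
  counit_coact := LinearMap.ext h.counit_coactLeft
  coassoc_coact := LinearMap.ext h.coassoc_coactLeft
  compat := groupLike_tensor_hom_ext h.span_groupLike fun g hg v => by
    have coact_act := h.rightComm_coactLeft_retract (h.coactRight_incl_mul v hg)
    rw [h.comul_incl_mul _ hg, h.map_proj_retract_incl_mul] at coact_act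
    simp only [LinearMap.comp_apply, LinearMap.rTensor_tmul, TensorProduct.map_tmul,
      hg.comul_eq_tmul_self, LinearEquiv.coe_coe, TensorProduct.rightComm_tmul]
    exact coact_act.symm

lemma isHom_mul : (h.braided.toYDData.tensor h.braided.toYDData).IsHom h.braided.toYDData
    (LinearMap.mul' k (coinv π)) where
  act := groupLike_tensor_hom_ext h.span_groupLike fun g hg v => by
    simp only [LinearMap.comp_apply, LinearMap.lTensor_tmul]
    induction v with
    | zero => simp
    | add x y hx hy => simp only [TensorProduct.tmul_add, map_add, hx, hy]
    | tmul b c => exact (congrArg _ (h.tensor_act_groupLike hg b c)).trans (h.adj_mul hg b c).symm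
  coact := TensorProduct.ext' fun b c => by
    apply lTensor_val_coinv_injective π
    change (coinv π).val.toLinearMap.lTensor K (h.coactLeft (b * c)) =
      (coinv π).val.toLinearMap.lTensor K ((LinearMap.mul' k (coinv π)).lTensor K
      ((LinearMap.mul' k K).rTensor (coinv π ⊗[k] coinv π)
        (TensorProduct.tensorTensorTensorComm k K (coinv π) K (coinv π)
          (h.coactLeft b ⊗ₜ h.coactLeft c))))
    rw [lTensor_mul_tensorTensorTensorComm, lTensor_val_coactLeft, lTensor_val_coactLeft,
      lTensor_val_coactLeft, MulMemClass.coe_mul, Bialgebra.comul_mul]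
    exact map_mul (Algebra.TensorProduct.map π (AlgHom.id k A)) _ _

lemma coactLeft_one : h.coactLeft 1 = 1 ⊗ₜ 1 := by
  rw [coactLeft_apply, OneMemClass.coe_one, Bialgebra.comul_one, Algebra.TensorProduct.one_def,
    TensorProduct.map_tmul, AlgHom.toLinearMap_apply, map_one, retract_one]

lemma isHom_one : (YDData.unit k K).IsHom h.braided.toYDData (Algebra.linearMap k (coinv π)) where
  act := TensorProduct.ext' fun x c => by
    simp [YDData.unit, braided, adj_tmul, Algebra.algebraMap_eq_smul_one, h.retract_incl,
      smul_smul, mul_comm]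
  coact := by
    ext
    simp [YDData.unit, braided, h.coactLeft_one]

lemma map_retract_incl_mul {g : K} (hg : IsGroupLikeElem k g) (u : A ⊗[k] A) :
    TensorProduct.map h.retract h.retract ((ι g ⊗ₜ ι g) * u) =
      (h.braided.toYDData.tensor h.braided.toYDData).act
        (g ⊗ₜ TensorProduct.map h.retract h.retract u) := by
  induction u with
  | zero => simp
  | add x y hx hy => simp only [mul_add, map_add, TensorProduct.tmul_add, hx, hy]
  | tmul x y =>
    rw [TensorProduct.map_tmul, h.tensor_act_groupLike hg]
    simp [adj_tmul, h.retract_mul_retract]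

/-- `f(b₁) ⊗ p(b₂)₍₋₁₎ ⊗ p(b₂)₍₀₎ = f(b₁) ⊗ π(b₂) ⊗ p(b₃)`. -/
lemma map_coactLeft_comul {V : Type*} [AddCommGroup V] [Module k V] (f : A →ₗ[k] V)
    (b : coinv π) :
    TensorProduct.map f (h.coactLeft ∘ₗ h.retract) (comul (R := k) (b : A)) =
      TensorProduct.assoc k V K (coinv π) (TensorProduct.map
        (TensorProduct.map f π.toLinearMap ∘ₗ comul) h.retract (comul (R := k) (b : A))) := by
  rw [← map_comul_right]
  exact h.map_comp_retract_comul f (TensorProduct.map π.toLinearMap h.retract ∘ₗ comul) b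

lemma assoc_symm_lTensor_coact_braided_comul (b : coinv π) :
    (TensorProduct.assoc k (coinv π) K (coinv π)).symm
      (h.braided.coact.lTensor (coinv π) (h.braided.comul b)) =
      TensorProduct.map (TensorProduct.map h.retract π.toLinearMap ∘ₗ comul) h.retract
        (comul (R := k) (b : A)) := by
  rw [braided_comul_apply, LinearMap.lTensor_map, LinearEquiv.symm_apply_eq]
  exact h.map_coactLeft_comul h.retract b

lemma coact_braided_comul (b : coinv π) :
    (h.braided.toYDData.tensor h.braided.toYDData).coact (h.braided.comul b) =
      h.braided.comul.lTensor K (h.coactLeft b) := by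
  have codiagonal : ((LinearMap.mul' k K).rTensor (coinv π) ∘ₗ
      (TensorProduct.rightComm k K (coinv π) K).toLinearMap) ∘ₗ
      TensorProduct.map (h.coactLeft ∘ₗ h.retract) π.toLinearMap ∘ₗ comul =
      TensorProduct.map π.toLinearMap h.retract ∘ₗ comul (R := k) :=
    LinearMap.ext h.map_proj_retract_comul
  rw [tensor_coact_apply, braided_comul_apply, TensorProduct.map_map]
  change TensorProduct.assoc k K (coinv π) (coinv π) (LinearMap.rTensor _ _
    ((TensorProduct.assoc k (K ⊗[k] coinv π) K (coinv π)).symm (TensorProduct.map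
      (h.coactLeft ∘ₗ h.retract) (h.coactLeft ∘ₗ h.retract) (comul (R := k) (b : A))))) = _
  rw [h.map_coactLeft_comul, LinearEquiv.symm_apply_apply, LinearMap.rTensor_map, codiagonal,
    ← map_comul_right, coactLeft_apply, LinearMap.lTensor_map, braided_comul_comp_retract]

lemma isHom_comul : h.braided.toYDData.IsHom (h.braided.toYDData.tensor h.braided.toYDData)
    h.braided.comul where
  act := groupLike_tensor_hom_ext h.span_groupLike fun g hg b => by
    rw [LinearMap.comp_apply, LinearMap.comp_apply, LinearMap.lTensor_tmul,
      h.braided_comul_apply b, ← h.map_retract_incl_mul hg, ← h.comul_incl_mul _ hg]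
    exact h.map_retract_comul _
  coact := LinearMap.ext h.coact_braided_comul

lemma isHom_counit : h.braided.toYDData.IsHom (YDData.unit k K) h.braided.counit where
  act := groupLike_tensor_hom_ext h.span_groupLike fun g hg b => by
    have : h.braided.counit (h.adj (g ⊗ₜ b)) = counit (R := k) (ι g * b : A) :=
      LinearMap.congr_fun h.braided_counit_comp_retract _
    rw [Bialgebra.counit_mul, (h.incl_groupLike hg).counit_eq_one] at this
    refine this.trans ?_
    simp [YDData.unit, hg.counit_eq_one, braided]
  coact := by
    ext b : 1
    change (1 : K) ⊗ₜ[k] counit (R := k) (b : A) = h.braided.counit.lTensor K (h.coactLeft b)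
    rw [coactLeft_apply, LinearMap.lTensor_map, braided_counit_comp_retract, map_comul_counit,
      AlgHom.toLinearMap_apply, proj_coe, Algebra.algebraMap_eq_smul_one, TensorProduct.smul_tmul,
      smul_eq_mul, mul_one]

lemma coactLeft_antipode {b : coinv π} {g : K} (hg : IsGroupLikeElem k g)
    (hb : h.coactLeft b = g ⊗ₜ b) :
    h.coactLeft (h.braided.antipode b) = g ⊗ₜ h.braided.antipode b := by
  have proj_comul_antipode : TensorProduct.map π.toLinearMap LinearMap.id
      (comul (R := k) (antipode k (b : A))) = 1 ⊗ₜ antipode k (b : A) := by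
    have := congrArg ((TensorProduct.comm k A K).toLinearMap ∘ₗ
      TensorProduct.map (antipode k) (antipode k)) (coactRight_coe b)
    rw [LinearMap.comp_apply, coactRight_apply, TensorProduct.map_map, LinearMap.comp_id,
      ← h.proj_comp_antipode, LinearEquiv.coe_coe, ← TensorProduct.map_comm] at this
    rw [comul_antipode, TensorProduct.map_map, LinearMap.id_comp, this]
    simp
  apply lTensor_val_coinv_injective π
  rw [lTensor_val_coactLeft, coe_braided_antipode, h.skewAntipode_of_coactLeft_eq hb,
    h.comul_incl_mul _ hg]
  refine (map_mul (Algebra.TensorProduct.map π (AlgHom.id k A)) _ _).trans ?_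
  refine (congrArg _ proj_comul_antipode).trans ?_
  simp [h.proj_incl, coe_braided_antipode, h.skewAntipode_of_coactLeft_eq hb]

lemma isHom_antipode : h.braided.toYDData.IsHom h.braided.toYDData h.braided.antipode where
  act := groupLike_tensor_hom_ext h.span_groupLike fun g hg b => by
    apply Subtype.ext
    change (h.braided.antipode (h.retract (ι g * b)) : A) = h.adj (g ⊗ₜ h.braided.antipode b)
    rw [h.coe_braided_antipode_retract, h.skewAntipode_incl_mul _ hg, h.coe_adj hg,
      coe_braided_antipode]
  coact := by
    refine LinearMap.ext_on h.span_coactLeft_eq_groupLike_tmul ?_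
    rintro b ⟨g, hg, hb⟩
    change h.coactLeft (h.braided.antipode b) = h.braided.antipode.lTensor K (h.coactLeft b)
    rw [h.coactLeft_antipode hg hb, hb, LinearMap.lTensor_tmul]

end IsSplitProjection

end YetterDrinfeld

section Biproduct

open Coalgebra HopfAlgebra

variable {k A K : Type*} [Field k] [Ring A] [HopfAlgebra k A] [Ring K] [HopfAlgebra k K]

/-- Associativity of the convolution product. -/
lemma mul_map_comul_assoc (f q g : A →ₗ[k] A) (a : A) :
    LinearMap.mul' k A (TensorProduct.map f
      (LinearMap.mul' k A ∘ₗ TensorProduct.map q g ∘ₗ comul) (comul (R := k) a)) =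
    LinearMap.mul' k A (TensorProduct.map
      (LinearMap.mul' k A ∘ₗ TensorProduct.map f q ∘ₗ comul) g (comul (R := k) a)) := by
  have := mul_assoc (WithConv.toConv f) (WithConv.toConv q) (WithConv.toConv g)
  exact (LinearMap.congr_fun (congrArg WithConv.ofConv this) a).symm

namespace IsSplitProjection

variable {π : A →ₐ[k] K} {ι : K →ₐ[k] A} (h : IsSplitProjection π ι)

include h

/-- `p(a₁) (π(a₂) · p(z)) = p(a z)`. -/
lemma mul_act_comp_map_comul (z : A) :
    (LinearMap.mul' k (coinv π) ∘ₗ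
      (h.adj ∘ₗ (TensorProduct.mk k K (coinv π)).flip (h.retract z)).lTensor (coinv π)) ∘ₗ
      TensorProduct.map h.retract π.toLinearMap ∘ₗ comul =
      h.retract ∘ₗ LinearMap.mulRight k z := by
  ext a : 1
  have := h.retract_mul_adj a (h.retract z)
  rw [h.retract_mul_retract] at this
  simp only [LinearMap.comp_apply]
  rw [LinearMap.lTensor_map]
  exact this

lemma map_retract_comul_mul (b : coinv π) (v : A ⊗[k] A) :
    TensorProduct.map h.retract h.retract (comul (R := k) (b : A) * v) =
      TensorProduct.map (LinearMap.mul' k (coinv π)) (LinearMap.mul' k (coinv π))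
        (middle (h.braided.toYDData.braiding h.braided.toYDData)
          (h.braided.comul b ⊗ₜ TensorProduct.map h.retract h.retract v)) := by
  suffices e : TensorProduct.map h.retract h.retract ∘ₗ
      LinearMap.mul k (A ⊗[k] A) (comul (R := k) (b : A)) =
      TensorProduct.map (LinearMap.mul' k (coinv π)) (LinearMap.mul' k (coinv π)) ∘ₗ
        middle (h.braided.toYDData.braiding h.braided.toYDData) ∘ₗ
          TensorProduct.mk k _ _ (h.braided.comul b) ∘ₗ
            TensorProduct.map h.retract h.retract from LinearMap.congr_fun e v
  refine TensorProduct.ext' fun z w => ?_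
  have mulRight_retract :
      (h.retract ∘ₗ LinearMap.mulRight k w) ∘ₗ (coinv π).val.toLinearMap ∘ₗ h.retract =
        LinearMap.mulRight k (h.retract w) ∘ₗ h.retract :=
    LinearMap.ext fun a => h.retract_coe_mul (h.retract a) w
  rw [LinearMap.comp_apply, LinearMap.mul_apply', map_mul_tmul, ← h.map_comp_retract_comul,
    mulRight_retract, ← h.mul_act_comp_map_comul, ← TensorProduct.map_map,
    ← h.assoc_symm_lTensor_coact_braided_comul]
  exact (map_mul_middle_braiding h.braided.toYDData (h.retract z) (h.retract w) _).symm

lemma mul_braided_antipode_rTensor_comul (b : coinv π) :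
    LinearMap.mul' k (coinv π) (h.braided.antipode.rTensor (coinv π) (h.braided.comul b)) =
      algebraMap k (coinv π) (h.braided.counit b) := by
  have coe_mul_antipode (u : A ⊗[k] A) : (LinearMap.mul' k (coinv π)
      (h.braided.antipode.rTensor _ (TensorProduct.map h.retract h.retract u)) : A) =
      LinearMap.mul' k A (TensorProduct.map (skewAntipode π ι)
        (LinearMap.id ∘ₗ (coinv π).val.toLinearMap ∘ₗ h.retract) u) := by
    induction u with
    | zero => simp
    | add x y hx hy => simp only [map_add, AddMemClass.coe_add, hx, hy]
    | tmul x y => simp [h.coe_braided_antipode_retract]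
  have antipode_mul_id : LinearMap.mul' k A ∘ₗ TensorProduct.map (antipode k) LinearMap.id ∘ₗ
      comul = Algebra.linearMap k A ∘ₗ counit := HopfAlgebra.mul_antipode_rTensor_comul
  apply Subtype.ext
  rw [braided_comul_apply, coe_mul_antipode, h.map_comp_retract_comul, skewAntipode,
    ← mul_map_comul_assoc, antipode_mul_id, ← LinearMap.lTensor_map, map_comul_counit]
  simp [proj_coe, braided]

lemma mul_braided_antipode_lTensor_comul (b : coinv π) :
    LinearMap.mul' k (coinv π) (h.braided.antipode.lTensor (coinv π) (h.braided.comul b)) =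
      algebraMap k (coinv π) (h.braided.counit b) := by
  have coe_mul_antipode (u : A ⊗[k] A) : (LinearMap.mul' k (coinv π)
      (h.braided.antipode.lTensor _ (TensorProduct.map h.retract h.retract u)) : A) =
      LinearMap.mul' k A (TensorProduct.map ((coinv π).val.toLinearMap ∘ₗ h.retract)
        (skewAntipode π ι) u) := by
    induction u with
    | zero => simp
    | add x y hx hy => simp only [map_add, AddMemClass.coe_add, hx, hy]
    | tmul x y => simp [h.coe_braided_antipode_retract]
  have retract_mul_incl_proj : LinearMap.mul' k A ∘ₗ
      TensorProduct.map ((coinv π).val.toLinearMap ∘ₗ h.retract)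
        (ι.toLinearMap ∘ₗ π.toLinearMap) ∘ₗ comul = LinearMap.id := by
    rw [TensorProduct.map_comp, LinearMap.comp_assoc, h.retract_mul_proj]
  apply Subtype.ext
  rw [braided_comul_apply, coe_mul_antipode, skewAntipode, mul_map_comul_assoc,
    retract_mul_incl_proj]
  exact HopfAlgebra.mul_antipode_lTensor_comul_apply (R := k) (b : A)

lemma isBraidedHopfAlgebra : h.braided.IsBraidedHopfAlgebra where
  yetterDrinfeld := h.isYetterDrinfeld
  mul_hom := h.isHom_mul
  one_hom := h.isHom_one
  comul_hom := h.isHom_comul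
  counit_hom := h.isHom_counit
  antipode_hom := h.isHom_antipode
  coassoc := by
    ext b : 1
    simp only [LinearMap.comp_apply, LinearEquiv.coe_coe, braided_comul_apply]
    rw [LinearMap.rTensor_map, LinearMap.lTensor_map, braided_comul_comp_retract, map_comul_right]
  rTensor_counit_comul := by
    ext b : 1
    simp only [LinearMap.comp_apply, LinearEquiv.coe_coe, braided_comul_apply]
    rw [LinearMap.rTensor_map, braided_counit_comp_retract, map_counit_comul]
    simp [h.retract_coe]
  lTensor_counit_comul := by
    ext b : 1
    simp only [LinearMap.comp_apply, LinearEquiv.coe_coe, braided_comul_apply]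
    rw [LinearMap.lTensor_map, braided_counit_comp_retract, map_comul_counit]
    simp [h.retract_coe]
  counit_one := Bialgebra.counit_one (R := k) (A := A)
  counit_mul a b := Bialgebra.counit_mul (R := k) (a : A) (b : A)
  comul_one := by
    rw [braided_comul_apply, OneMemClass.coe_one, Bialgebra.comul_one,
      Algebra.TensorProduct.one_def, TensorProduct.map_tmul, retract_one]
  comul_mul := TensorProduct.ext' fun b c => by
    rw [LinearMap.comp_apply, LinearMap.mul'_apply, braided_comul_apply, MulMemClass.coe_mul,
      Bialgebra.comul_mul, map_retract_comul_mul]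
    rfl
  mul_antipode_rTensor := LinearMap.ext h.mul_braided_antipode_rTensor_comul
  mul_antipode_lTensor := LinearMap.ext h.mul_braided_antipode_lTensor_comul

/-- The isomorphism `B ♯ K ≃ A`, `b ♯ x ↦ b ι(x)`, with inverse `a ↦ p(a₁) ♯ π(a₂)`. -/
def biproductEquiv : coinv π ⊗[k] K ≃ₗ[k] A :=
  LinearEquiv.ofLinearMap
    (LinearMap.mul' k A ∘ₗ TensorProduct.map (coinv π).val.toLinearMap ι.toLinearMap)
    (TensorProduct.map h.retract π.toLinearMap ∘ₗ comul)
    h.retract_mul_proj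
    (groupLike_tensor_hom_ext_right h.span_groupLike fun b g hg => by
      have := congrArg (h.retract.rTensor K) (h.coactRight_mul_incl b hg)
      rwa [coactRight_apply, LinearMap.rTensor_map, LinearMap.comp_id, LinearMap.rTensor_tmul,
        h.retract_mul_incl b hg] at this)

lemma biproductEquiv_tmul (b : coinv π) (x : K) : h.biproductEquiv (b ⊗ₜ x) = b * ι x := rfl

lemma comul_biproductEquiv (b : coinv π) {g : K} (hg : IsGroupLikeElem k g) :
    comul (R := k) (h.biproductEquiv (b ⊗ₜ g)) = TensorProduct.map h.biproductEquiv.toLinearMap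
      h.biproductEquiv.toLinearMap (h.braided.biproductComul (b ⊗ₜ g)) := by
  have comul_eq := map_middle_coact h.braided (coinv π).val ι g (h.braided.comul b)
  rw [assoc_symm_lTensor_coact_braided_comul, TensorProduct.map_map, LinearMap.comp_assoc,
    h.retract_mul_proj, h.map_id_retract_comul, ← h.comul_mul_incl _ hg] at comul_eq
  rw [biproductEquiv_tmul, ← comul_eq, BraidedHopfData.biproductComul, LinearMap.comp_apply,
    TensorProduct.map_tmul, hg.comul_eq_tmul_self]
  rfl

lemma biproductEquiv_mul (b c : coinv π) {g : K} (hg : IsGroupLikeElem k g) (x : K) :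
    h.biproductEquiv (h.braided.biproductMul ((b ⊗ₜ g) ⊗ₜ (c ⊗ₜ x))) =
      h.biproductEquiv (b ⊗ₜ g) * h.biproductEquiv (c ⊗ₜ x) := by
  have : h.braided.biproductMul ((b ⊗ₜ g) ⊗ₜ (c ⊗ₜ x)) =
      (b * h.adj (g ⊗ₜ c)) ⊗ₜ (g * x) := by
    simp [BraidedHopfData.biproductMul, middle, hg.comul_eq_tmul_self, braided]
  rw [this, biproductEquiv_tmul, biproductEquiv_tmul, biproductEquiv_tmul, MulMemClass.coe_mul,
    h.coe_adj hg, map_mul]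
  simp only [mul_assoc]
  rw [← mul_assoc (ι (antipode k g)), incl_antipode_mul_cancel ι hg, one_mul]

end IsSplitProjection

end Biproduct

section GradedProjection

open Coalgebra HopfAlgebra

variable {k A K : Type*} [Field k] [Ring A] [HopfAlgebra k A] [Ring K] [HopfAlgebra k K]

/-- A grading of the Hopf algebra `A` for which `π` and `ι` are the projection onto and the
inclusion of the component of degree zero. -/
structure IsGradedProjection (π : A →ₐ[k] K) (ι : K →ₐ[k] A) (𝓐 : ℕ → Submodule k A) : Prop
    extends IsSplitProjection π ι where
  isInternal : DirectSum.IsInternal 𝓐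
  mul_mem : ∀ {m n : ℕ} {a b : A}, a ∈ 𝓐 m → b ∈ 𝓐 n → a * b ∈ 𝓐 (m + n)
  comul_mem : ∀ {n : ℕ} {a : A}, a ∈ 𝓐 n → comul (R := k) a ∈
    ⨆ p ∈ Finset.HasAntidiagonal.antidiagonal n, tensorSub k (𝓐 p.1) (𝓐 p.2)
  antipode_mem : ∀ {n : ℕ} {a : A}, a ∈ 𝓐 n → antipode k a ∈ 𝓐 n
  proj_eq_zero : ∀ {n : ℕ} {a : A}, n ≠ 0 → a ∈ 𝓐 n → π a = 0
  incl_mem : ∀ x, ι x ∈ 𝓐 0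
  exists_incl : ∀ a ∈ 𝓐 0, ∃ x, ι x = a

namespace IsSplitProjection

variable {π : A →ₐ[k] K} {ι : K →ₐ[k] A} (h : IsSplitProjection π ι)

include h

lemma isBiproductIso {𝓑 : ℕ → Submodule k (coinv π)} {𝓐 : ℕ → Submodule k A}
    (hgr : ∀ n, (tensorSub k (𝓑 n) ⊤).map h.biproductEquiv.toLinearMap = 𝓐 n) :
    h.braided.IsBiproductIso 𝓑 𝓐 h.biproductEquiv where
  map_one := by
    rw [biproductEquiv_tmul, map_one, mul_one]
    rfl
  map_mul := by
    refine TensorProduct.ext (groupLike_tensor_hom_ext_right h.span_groupLike fun b g hg => ?_)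
    refine TensorProduct.ext' fun c x => ?_
    exact h.biproductEquiv_mul b c hg x
  map_comul := groupLike_tensor_hom_ext_right h.span_groupLike fun b g hg =>
    h.comul_biproductEquiv b hg
  map_counit := TensorProduct.ext' fun b x => by
    change counit (R := k) (b * ι x : A) = counit (R := k) (b : A) * counit (R := k) x
    rw [Bialgebra.counit_mul, h.counit_incl]
  map_grading := hgr

end IsSplitProjection

namespace IsGradedProjection

variable {π : A →ₐ[k] K} {ι : K →ₐ[k] A} {𝓐 : ℕ → Submodule k A}
  (h : IsGradedProjection π ι 𝓐)

/-- The component `Bₙ = B ∩ 𝓐ₙ` of the algebra of coinvariants. -/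
def gradedCoinv (π : A →ₐ[k] K) (𝓐 : ℕ → Submodule k A) (n : ℕ) : Submodule k (coinv π) :=
  (𝓐 n).comap (coinv π).val.toLinearMap

lemma mem_gradedCoinv {n : ℕ} {b : coinv π} : b ∈ gradedCoinv π 𝓐 n ↔ (b : A) ∈ 𝓐 n :=
  Iff.rfl

include h

lemma map_comul_mem {V : Type*} [AddCommGroup V] [Module k V] (L : A ⊗[k] A →ₗ[k] V)
    {Z : Submodule k V} {n : ℕ} (H : ∀ i j, i + j = n → ∀ x ∈ 𝓐 i, ∀ y ∈ 𝓐 j, L (x ⊗ₜ y) ∈ Z)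
    {a : A} (ha : a ∈ 𝓐 n) : L (comul (R := k) a) ∈ Z := by
  have : ⨆ p ∈ Finset.HasAntidiagonal.antidiagonal n, tensorSub k (𝓐 p.1) (𝓐 p.2) ≤ Z.comap L :=
    iSup₂_le fun p hp => tensorSub_le.2 fun x hx y hy =>
      H p.1 p.2 (by simpa using hp) x hx y hy
  exact this (h.comul_mem ha)

lemma counit_eq_zero {n : ℕ} (hn : n ≠ 0) {a : A} (ha : a ∈ 𝓐 n) : counit (R := k) a = 0 := by
  rw [← h.counit_proj, h.proj_eq_zero hn ha, map_zero]

lemma incl_mul_mem (x : K) {n : ℕ} {a : A} (ha : a ∈ 𝓐 n) : ι x * a ∈ 𝓐 n := by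
  simpa using h.mul_mem (h.incl_mem x) ha

lemma mul_incl_mem (x : K) {n : ℕ} {a : A} (ha : a ∈ 𝓐 n) : a * ι x ∈ 𝓐 n := by
  simpa using h.mul_mem ha (h.incl_mem x)

lemma retract_mem {n : ℕ} {a : A} (ha : a ∈ 𝓐 n) : h.retract a ∈ gradedCoinv π 𝓐 n := by
  refine h.map_comul_mem (LinearMap.mul' k A ∘ₗ (ι.toLinearMap ∘ₗ antipode k).lTensor A ∘ₗ
    TensorProduct.map LinearMap.id π.toLinearMap) (fun i j hij x hx y hy => ?_) ha
  rcases eq_or_ne j 0 with rfl | hj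
  · rw [add_zero] at hij
    subst hij
    exact h.mul_incl_mem _ hx
  · simp [h.proj_eq_zero hj hy]

lemma skewAntipode_mem_grading {n : ℕ} {a : A} (ha : a ∈ 𝓐 n) :
    skewAntipode π ι a ∈ 𝓐 n := by
  refine h.map_comul_mem (LinearMap.mul' k A ∘ₗ TensorProduct.map
    (ι.toLinearMap ∘ₗ π.toLinearMap) (antipode k)) (fun i j hij x hx y hy => ?_) ha
  rcases eq_or_ne i 0 with rfl | hi
  · rw [zero_add] at hij
    subst hij
    exact h.incl_mul_mem _ (h.antipode_mem hy)
  · simp [h.proj_eq_zero hi hx]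

lemma isInternal_gradedCoinv : DirectSum.IsInternal (gradedCoinv π 𝓐) := by
  rw [DirectSum.isInternal_submodule_iff_iSupIndep_and_iSup_eq_top]
  obtain ⟨hi, ht⟩ := (DirectSum.isInternal_submodule_iff_iSupIndep_and_iSup_eq_top _).1 h.isInternal
  constructor
  · intro n
    rw [Submodule.disjoint_def]
    intro b hb hb'
    have : ⨆ j, ⨆ (_ : j ≠ n), gradedCoinv π 𝓐 j ≤
        (⨆ j, ⨆ (_ : j ≠ n), 𝓐 j).comap (coinv π).val.toLinearMap :=
      iSup₂_le fun j hj => Submodule.comap_mono (le_iSup₂_of_le j hj le_rfl)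
    exact Subtype.ext (Submodule.disjoint_def.1 (hi n) _ hb (this hb'))
  · rw [eq_top_iff]
    intro b _
    have : ⨆ n, 𝓐 n ≤ (⨆ n, gradedCoinv π 𝓐 n).comap h.retract :=
      iSup_le fun n a ha => Submodule.mem_iSup_of_mem n (h.retract_mem ha)
    have hb := this (ht ▸ Submodule.mem_top : (b : A) ∈ ⨆ n, 𝓐 n)
    rwa [Submodule.mem_comap, h.retract_coe] at hb

lemma isGraded : h.braided.IsGraded (gradedCoinv π 𝓐) where
  isInternal := h.isInternal_gradedCoinv
  one_mem := by
    rw [mem_gradedCoinv, OneMemClass.coe_one, ← map_one ι]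
    exact h.incl_mem 1
  mul_mem _ _ _ ha _ hb := h.mul_mem ha hb
  act_mem n x b hb := h.retract_mem (h.incl_mul_mem x hb)
  coact_mem n b hb := by
    refine h.map_comul_mem (TensorProduct.map π.toLinearMap h.retract)
      (fun i j hij x hx y hy => ?_) hb
    rcases eq_or_ne i 0 with rfl | hi
    · rw [zero_add] at hij
      subst hij
      exact tmul_mem_tensorSub Submodule.mem_top (h.retract_mem hy)
    · simp [h.proj_eq_zero hi hx]
  comul_mem n b hb := by
    refine h.map_comul_mem (TensorProduct.map h.retract h.retract)
      (fun i j hij x hx y hy => ?_) hb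
    refine Submodule.mem_iSup_of_mem (i, j) (Submodule.mem_iSup_of_mem (by simpa using hij) ?_)
    exact tmul_mem_tensorSub (h.retract_mem hx) (h.retract_mem hy)
  counit_eq_zero n hn b hb := h.counit_eq_zero hn hb
  antipode_mem n b hb := h.retract_mem (h.skewAntipode_mem_grading hb)

lemma gradedCoinv_zero : gradedCoinv π 𝓐 0 = Submodule.span k {1} := by
  apply le_antisymm
  · intro b hb
    obtain ⟨x, hx⟩ := h.exists_incl (b : A) hb
    rw [← h.retract_coe b, ← hx, h.retract_incl]
    exact Submodule.smul_mem _ _ (Submodule.mem_span_singleton_self _)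
  · rw [Submodule.span_singleton_le_iff_mem]
    exact h.isGraded.one_mem

lemma map_biproductEquiv (n : ℕ) :
    (tensorSub k (gradedCoinv π 𝓐 n) ⊤).map h.biproductEquiv.toLinearMap = 𝓐 n := by
  apply le_antisymm
  · rw [Submodule.map_le_iff_le_comap, tensorSub_le]
    intro b hb x _
    exact h.mul_incl_mem x hb
  · intro a ha
    refine ⟨h.biproductEquiv.symm a, ?_, h.biproductEquiv.apply_symm_apply a⟩
    refine h.map_comul_mem (TensorProduct.map h.retract π.toLinearMap)
      (fun i j hij x hx y hy => ?_) ha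
    rcases eq_or_ne j 0 with rfl | hj
    · rw [add_zero] at hij
      subst hij
      exact tmul_mem_tensorSub (h.retract_mem hx) Submodule.mem_top
    · simp [h.proj_eq_zero hj hy]

end IsGradedProjection

end GradedProjection

section GradedFinite

variable {k S : Type*} [Field k] [Ring S] [Algebra k S]

lemma isNoetherianRing_of_retract {R T : Type*} [Semiring R] [Semiring T] (f : R →+* T)
    (E : T →+ R) (hE : ∀ t r, E (t * f r) = E t * r) (hf : ∀ r, E (f r) = r)
    [IsNoetherianRing T] : IsNoetherianRing R := by
  have map_mem (I : Ideal R) {x : T} (hx : x ∈ I.map f) : E x ∈ I := by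
    induction hx using Submodule.closure_induction with
    | zero => simp
    | add x y _ _ hx hy => simpa using add_mem hx hy
    | smul_mem t x hx =>
      obtain ⟨r, hr, rfl⟩ := hx
      simpa [hE] using I.mul_mem_left _ hr
  have comap_map (I : Ideal R) : (I.map f).comap f = I :=
    le_antisymm (fun r hr => hf r ▸ map_mem I hr) Ideal.le_comap_map
  have map_strictMono : StrictMono (Ideal.map f) :=
    Monotone.strictMono_of_injective (fun _ _ => Ideal.map_mono)
      (Function.LeftInverse.injective comap_map)
  exact isNoetherian_iff'.2 map_strictMono.wellFoundedGT

lemma fg_op_iff {U : Subalgebra k S} : U.op.FG ↔ U.FG := by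
  rw [Subalgebra.fg_def, Subalgebra.fg_def]
  constructor
  · rintro ⟨t, ht, h⟩
    exact ⟨_, ht.preimage MulOpposite.op_injective.injOn, by
      rw [← Subalgebra.unop_adjoin, h, Subalgebra.unop_op]⟩
  · rintro ⟨t, ht, rfl⟩
    exact ⟨_, ht.preimage MulOpposite.unop_injective.injOn, (Subalgebra.op_adjoin t).symm⟩

/-- Finitely many homogeneous elements of positive degree generate the left ideal of all of them;
by induction on the degree they generate `S` together with `𝓢₀`. -/
lemma finiteType_of_gradedAlgebra (𝓢 : ℕ → Submodule k S) [GradedAlgebra 𝓢] [IsNoetherianRing S]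
    {U : Subalgebra k S} (hU : U.FG) (h0 : 𝓢 0 ≤ Subalgebra.toSubmodule U) :
    Algebra.FiniteType k S := by
  obtain ⟨t, ht, hspan⟩ := (Submodule.fg_span_iff_fg_span_finset_subset
    {x | ∃ n ≠ 0, x ∈ 𝓢 n}).1 (IsNoetherian.noetherian (Submodule.span S _))
  have mem_sup (n : ℕ) : 𝓢 n ≤ Subalgebra.toSubmodule (U ⊔ Algebra.adjoin k t) := by
    induction n using Nat.strong_induction_on with
    | _ n ih =>
    intro x hx
    rcases eq_or_ne n 0 with rfl | hn
    · exact (le_sup_left : U ≤ _) (h0 hx)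
    have x_mem : x ∈ Submodule.span S (t : Set S) :=
      hspan ▸ Submodule.subset_span ⟨n, hn, hx⟩
    obtain ⟨c, -, rfl⟩ := Submodule.mem_span_finset.1 x_mem
    rw [← DirectSum.decompose_of_mem_same 𝓢 hx, DirectSum.decompose_sum, DFinsupp.finsetSum_apply,
      AddSubmonoidClass.coe_finsetSum]
    refine sum_mem fun y hy => ?_
    obtain ⟨d, hd, hyd⟩ := ht hy
    rw [smul_eq_mul, DirectSum.coe_decompose_mul_of_right_mem 𝓢 n hyd]
    split_ifs
    · exact (U ⊔ Algebra.adjoin k t).mul_mem (ih (n - d) (by lia) (SetLike.coe_mem _))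
        ((le_sup_right : _ ≤ U ⊔ _) (Algebra.subset_adjoin hy))
    · exact zero_mem _
  have sup_eq_top : U ⊔ Algebra.adjoin k t = ⊤ := by
    rw [← Algebra.toSubmodule_eq_top, eq_top_iff,
      ← (DirectSum.Decomposition.isInternal 𝓢).submodule_iSup_eq_top]
    exact iSup_le mem_sup
  exact ⟨sup_eq_top ▸ hU.sup ⟨t, rfl⟩⟩

lemma isInternal_op {𝓢 : ℕ → Submodule k S} (h : DirectSum.IsInternal 𝓢) :
    DirectSum.IsInternal fun n => (𝓢 n).map (MulOpposite.opLinearEquiv k).toLinearMap := by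
  rw [DirectSum.isInternal_submodule_iff_iSupIndep_and_iSup_eq_top] at h ⊢
  refine ⟨(iSupIndep_map_orderIso_iff (Submodule.orderIsoMapComap
    (MulOpposite.opLinearEquiv k))).2 h.1, ?_⟩
  rw [← Submodule.map_iSup, h.2, Submodule.map_top, LinearEquiv.range]

lemma finiteType_of_isInternal (hS : IsNoetherianRing S ∨ IsNoetherianRing Sᵐᵒᵖ)
    (𝓢 : ℕ → Submodule k S) [SetLike.GradedMonoid 𝓢] (h : DirectSum.IsInternal 𝓢)
    {U : Subalgebra k S} (hU : U.FG) (h0 : 𝓢 0 ≤ Subalgebra.toSubmodule U) :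
    Algebra.FiniteType k S := by
  rcases hS with hS | hS
  · let _ : GradedAlgebra 𝓢 := { h.chooseDecomposition with }
    exact finiteType_of_gradedAlgebra 𝓢 hU h0
  · let 𝓢' (n : ℕ) : Submodule k Sᵐᵒᵖ := (𝓢 n).map (MulOpposite.opLinearEquiv k).toLinearMap
    have : SetLike.GradedMonoid 𝓢' :=
      { one_mem := ⟨1, SetLike.GradedOne.one_mem, rfl⟩
        mul_mem := by
          rintro m n _ _ ⟨a, ha, rfl⟩ ⟨b, hb, rfl⟩
          exact ⟨b * a, add_comm n m ▸ SetLike.GradedMul.mul_mem hb ha, rfl⟩ }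
    have h' : DirectSum.IsInternal 𝓢' := isInternal_op h
    let _ : GradedAlgebra 𝓢' := { h'.chooseDecomposition with }
    have op_le : 𝓢' 0 ≤ Subalgebra.toSubmodule U.op := by
      rintro _ ⟨x, hx, rfl⟩
      exact h0 hx
    have := (finiteType_of_gradedAlgebra 𝓢' (fg_op_iff.2 hU) op_le).out
    exact ⟨fg_op_iff.1 (Subalgebra.op_top (R := k) (A := S) ▸ this)⟩

end GradedFinite

section GroupLikeFinite

open Coalgebra HopfAlgebra

variable {k K : Type*} [Field k] [Ring K] [HopfAlgebra k K]
  (hK : Submodule.span k {g : K | IsGroupLikeElem k g} = ⊤)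

include hK

/-- If `g₁ - 1, …, gₙ - 1` generate the left ideal of all `g - 1`, then the `gᵢ` generate the group:
the indicator function of the subgroup they generate, extended linearly, annihilates this ideal. -/
lemma fg_groupLike [IsNoetherianRing K] : Group.FG (GroupLike k K) := by
  classical
  obtain ⟨t, ht, hspan⟩ := (Submodule.fg_span_iff_fg_span_finset_subset
    (Set.range fun g : GroupLike k K => g.val - 1)).1 (IsNoetherian.noetherian (Submodule.span K _))
  rw [← Set.image_univ, Finset.subset_set_image_iff] at ht
  obtain ⟨T, -, rfl⟩ := ht
  let H := Subgroup.closure (T : Set (GroupLike k K))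
  let indicator : K →ₗ[k] k := (groupLikeBasis hK).constr k fun g => if g ∈ H then 1 else 0
  have indicator_val (g : GroupLike k K) : indicator g.val = if g ∈ H then 1 else 0 := by
    rw [← groupLikeBasis_apply hK, Module.Basis.constr_basis]
  have indicator_mul_sub_one (x : K) {g : GroupLike k K} (hg : g ∈ T) :
      indicator (x * (g.val - 1)) = 0 := by
    have hgH : g ∈ H := Subgroup.subset_closure hg
    have : indicator ∘ₗ LinearMap.mulRight k (g.val - 1) = 0 := by
      refine (groupLikeBasis hK).ext fun c => ?_
      rw [groupLikeBasis_apply, LinearMap.comp_apply, LinearMap.mulRight_apply, mul_sub, mul_one,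
        map_sub, ← GroupLike.val_mul, indicator_val, indicator_val, LinearMap.zero_apply,
        if_congr (Subgroup.mul_mem_cancel_right H hgH) rfl rfl, sub_self]
    exact LinearMap.congr_fun this x
  refine ⟨T, eq_top_iff.2 fun g _ => ?_⟩
  have g_mem : g.val - 1 ∈ Submodule.span K
      ((T.image fun g : GroupLike k K => g.val - 1 : Finset K) : Set K) :=
    hspan ▸ Submodule.subset_span ⟨g, rfl⟩
  obtain ⟨c, -, hc⟩ := Submodule.mem_span_finset.1 g_mem
  have indicator_sub_one : indicator (g.val - 1) = 0 := by
    rw [← hc, map_sum]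
    refine Finset.sum_eq_zero fun y hy => ?_
    obtain ⟨g', hg', rfl⟩ := Finset.mem_image.1 hy
    exact indicator_mul_sub_one _ hg'
  by_contra hgH
  rw [map_sub, ← GroupLike.val_one (R := k), indicator_val, indicator_val, if_neg hgH,
    if_pos (one_mem H), zero_sub, neg_eq_zero] at indicator_sub_one
  exact one_ne_zero indicator_sub_one

lemma antipode_surjective_of_span_groupLike : Function.Surjective (antipode k (A := K)) := by
  rw [← LinearMap.range_eq_top, eq_top_iff, ← hK, Submodule.span_le]
  exact fun g hg => ⟨antipode k g, hg.antipode_antipode⟩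

lemma isNoetherianRing_of_op [IsNoetherianRing Kᵐᵒᵖ] : IsNoetherianRing K :=
  isNoetherianRing_of_surjective Kᵐᵒᵖ K (AlgHom.opComm (antipodeAlgHomOp k K)).toRingHom
    fun x => (antipode_surjective_of_span_groupLike hK x).imp' MulOpposite.op fun _ h => h

lemma finiteType_of_span_groupLike (hN : IsNoetherianRing K ∨ IsNoetherianRing Kᵐᵒᵖ) :
    Algebra.FiniteType k K := by
  have : IsNoetherianRing K := hN.elim id fun _ => isNoetherianRing_of_op hK
  have : Monoid.FG (GroupLike k K) := Group.fg_iff_monoid_fg.1 (fg_groupLike hK)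
  refine .of_surjective
    (MonoidAlgebra.liftGroupLikeBialgHom : MonoidAlgebra k (GroupLike k K) →ₐc[k] K).toAlgHom ?_
  rw [← AlgHom.range_eq_top, ← Algebra.toSubmodule_eq_top, eq_top_iff, ← hK, Submodule.span_le]
  exact fun g hg => ⟨MonoidAlgebra.of k _ ⟨g, hg⟩, by simp⟩

end GroupLikeFinite

section NoetherianCoinvariants

open Coalgebra HopfAlgebra

variable {k A K : Type*} [Field k] [Ring A] [HopfAlgebra k A] [Ring K] [HopfAlgebra k K]

namespace IsSplitProjection

variable {π : A →ₐ[k] K} {ι : K →ₐ[k] A} (h : IsSplitProjection π ι)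

include h

/-- The projection of `A = ⨁ B ι(g)` onto the summand `B = B ι(1)`. -/
def identityComponent : A →ₗ[k] A :=
  TensorProduct.rid k A ∘ₗ ((groupLikeBasis h.span_groupLike).coord 1).lTensor A ∘ₗ
    (coactRight π).toLinearMap

lemma identityComponent_mul_incl (b : coinv π) (g : GroupLike k K) [Decidable (g = 1)] :
    h.identityComponent (b * ι g.val) = if g = 1 then (b : A) else 0 := by
  have coord_val : (groupLikeBasis h.span_groupLike).coord 1 g.val = if g = 1 then 1 else 0 := by
    rw [← groupLikeBasis_apply h.span_groupLike, Module.Basis.coord_apply,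
      Module.Basis.repr_self, Finsupp.single_apply]
  rw [identityComponent, LinearMap.comp_apply, LinearMap.comp_apply, AlgHom.toLinearMap_apply,
    h.coactRight_mul_incl b g.isGroupLikeElem_val, LinearMap.lTensor_tmul, coord_val]
  split_ifs with hg <;> simp [hg]

lemma identityComponent_coe (b : coinv π) : h.identityComponent b = b := by
  classical
  simpa using h.identityComponent_mul_incl b 1

lemma identityComponent_mem (a : A) : h.identityComponent a ∈ coinv π := by
  classical
  have : (coactRight π).toLinearMap ∘ₗ h.identityComponent =
      (TensorProduct.mk k A K).flip 1 ∘ₗ h.identityComponent := h.hom_ext fun b g hg => by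
    have := h.identityComponent_mul_incl b ⟨g, hg⟩
    simp only [LinearMap.comp_apply, this]
    split_ifs <;> simp [coactRight_coe]
  exact LinearMap.congr_fun this a

lemma identityComponent_coe_mul (b : coinv π) (a : A) :
    h.identityComponent (b * a) = b * h.identityComponent a := by
  simp only [identityComponent, LinearMap.comp_apply, AlgHom.toLinearMap_apply, map_mul,
    coactRight_coe]
  induction coactRight π a with
  | zero => simp
  | add x y hx hy => simp only [mul_add, map_add, hx, hy]
  | tmul x y => simp

lemma identityComponent_mul_coe (a : A) (b : coinv π) :
    h.identityComponent (a * b) = h.identityComponent a * b := by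
  simp only [identityComponent, LinearMap.comp_apply, AlgHom.toLinearMap_apply, map_mul,
    coactRight_coe]
  induction coactRight π a with
  | zero => simp
  | add x y hx hy => simp only [add_mul, map_add, hx, hy]
  | tmul x y => simp

lemma isNoetherianRing_coinv (hN : IsNoetherianRing A ∨ IsNoetherianRing Aᵐᵒᵖ) :
    IsNoetherianRing (coinv π) ∨ IsNoetherianRing (coinv π)ᵐᵒᵖ := by
  let E : A →ₗ[k] coinv π := h.identityComponent.codRestrict
    (Subalgebra.toSubmodule (coinv π)) h.identityComponent_mem
  have E_coe (b : coinv π) : E b = b := Subtype.ext (h.identityComponent_coe b)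
  rcases hN with hN | hN
  · exact .inl (isNoetherianRing_of_retract (coinv π).val.toRingHom E.toAddMonoidHom
      (fun a b => Subtype.ext (h.identityComponent_mul_coe a b)) E_coe)
  · exact .inr (isNoetherianRing_of_retract (T := Aᵐᵒᵖ) (RingHom.op (coinv π).val.toRingHom)
      (AddMonoidHom.mulOp E.toAddMonoidHom)
      (fun a b => congrArg MulOpposite.op (Subtype.ext
        (h.identityComponent_coe_mul b.unop a.unop)))
      fun b => congrArg MulOpposite.op (E_coe b.unop))

lemma isNoetherianRing_base (hN : IsNoetherianRing A ∨ IsNoetherianRing Aᵐᵒᵖ) :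
    IsNoetherianRing K ∨ IsNoetherianRing Kᵐᵒᵖ := by
  have proj_surjective : Function.Surjective π := fun x => ⟨ι x, h.proj_incl x⟩
  rcases hN with hN | hN
  · exact .inl (isNoetherianRing_of_surjective A K π.toRingHom proj_surjective)
  · exact .inr (isNoetherianRing_of_surjective Aᵐᵒᵖ Kᵐᵒᵖ (RingHom.op π.toRingHom) fun x =>
      (proj_surjective x.unop).imp' MulOpposite.op fun _ hx => congrArg MulOpposite.op hx)

end IsSplitProjection

namespace IsGradedProjection

variable {π : A →ₐ[k] K} {ι : K →ₐ[k] A} {𝓐 : ℕ → Submodule k A}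
  (h : IsGradedProjection π ι 𝓐)

include h

lemma gradedMonoid : SetLike.GradedMonoid 𝓐 where
  one_mem := map_one ι ▸ h.incl_mem 1
  mul_mem _ _ _ _ := h.mul_mem

lemma gradedMonoid_coinv : SetLike.GradedMonoid (gradedCoinv π 𝓐) where
  one_mem := h.isGraded.one_mem
  mul_mem _ _ _ _ ha hb := h.isGraded.mul_mem _ _ _ ha _ hb

lemma finiteType_base (hN : IsNoetherianRing A ∨ IsNoetherianRing Aᵐᵒᵖ) : Algebra.FiniteType k K :=
  finiteType_of_span_groupLike h.span_groupLike (h.isNoetherianRing_base hN)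

lemma finiteType (hN : IsNoetherianRing A ∨ IsNoetherianRing Aᵐᵒᵖ) : Algebra.FiniteType k A :=
  have := h.gradedMonoid
  finiteType_of_isInternal hN 𝓐 h.isInternal ((h.finiteType_base hN).out.map ι) fun a ha =>
    (h.exists_incl a ha).imp fun _ hx => ⟨trivial, hx⟩

lemma finiteType_coinv (hN : IsNoetherianRing A ∨ IsNoetherianRing Aᵐᵒᵖ) :
    Algebra.FiniteType k (coinv π) :=
  have := h.gradedMonoid_coinv
  finiteType_of_isInternal (h.isNoetherianRing_coinv hN) _ h.isInternal_gradedCoinv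
    Subalgebra.fg_bot (by rw [h.gradedCoinv_zero, Algebra.toSubmodule_bot, Submodule.one_eq_span])

end IsGradedProjection

end NoetherianCoinvariants

section Exhaustion

open Coalgebra

variable {k C : Type*} [Field k] [AddCommGroup C] [Module k C]

lemma tensor_ext_dual {V W : Type*} [AddCommGroup V] [Module k V] [AddCommGroup W] [Module k W]
    {u v : V ⊗[k] W} (h : ∀ (f : V →ₗ[k] k) (g : W →ₗ[k] k),
      LinearMap.mul' k k (TensorProduct.map f g u) = LinearMap.mul' k k (TensorProduct.map f g v)) :
    u = v := by
  let bV := Module.Basis.ofVectorSpace k V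
  let bW := Module.Basis.ofVectorSpace k W
  have repr_eq (w : V ⊗[k] W) (i j) : (bV.tensorProduct bW).repr w (i, j) =
      LinearMap.mul' k k (TensorProduct.map (bV.coord i) (bW.coord j) w) := by
    induction w with
    | zero => simp
    | add w w' hw hw' => simp only [map_add, Finsupp.add_apply, hw, hw']
    | tmul x y => simp [mul_comm]
  exact (bV.tensorProduct bW).ext_elem fun ⟨i, j⟩ => by rw [repr_eq, repr_eq, h]

variable (k) in
lemma ext_dual {x y : C} (h : ∀ f : WithConv (C →ₗ[k] k), f x = f y) : x = y :=
  sub_eq_zero.1 <| (Module.forall_dual_apply_eq_zero_iff k _).1 fun f => by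
    rw [map_sub, sub_eq_zero]
    exact h (.toConv f)

variable [Coalgebra k C]

/-- The operator `x ↦ f(x₁) x₂` on a coalgebra, for `f` in its dual convolution algebra. -/
def leftHit (f : WithConv (C →ₗ[k] k)) : C →ₗ[k] C :=
  (TensorProduct.lid k C).toLinearMap ∘ₗ f.ofConv.rTensor C ∘ₗ comul

/-- The operator `x ↦ x₁ g(x₂)` on a coalgebra, for `g` in its dual convolution algebra. -/
def rightHit (g : WithConv (C →ₗ[k] k)) : C →ₗ[k] C :=
  (TensorProduct.rid k C).toLinearMap ∘ₗ g.ofConv.lTensor C ∘ₗ comul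

lemma apply_leftHit (f g : WithConv (C →ₗ[k] k)) (x : C) : g (leftHit f x) = (f * g) x := by
  have : g.ofConv ∘ₗ (TensorProduct.lid k C).toLinearMap ∘ₗ f.ofConv.rTensor C =
      LinearMap.mul' k k ∘ₗ TensorProduct.map f.ofConv g.ofConv := by
    ext; simp
  exact LinearMap.congr_fun this (comul x)

lemma apply_rightHit (f g : WithConv (C →ₗ[k] k)) (x : C) : f (rightHit g x) = (f * g) x := by
  have : f.ofConv ∘ₗ (TensorProduct.rid k C).toLinearMap ∘ₗ g.ofConv.lTensor C =
      LinearMap.mul' k k ∘ₗ TensorProduct.map f.ofConv g.ofConv := by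
    ext; simp [mul_comm]
  exact LinearMap.congr_fun this (comul x)

lemma leftHit_one : leftHit (1 : WithConv (C →ₗ[k] k)) = LinearMap.id :=
  LinearMap.ext fun x => ext_dual k fun h => by
    rw [apply_leftHit, one_mul, LinearMap.id_apply]

lemma leftHit_mul (f g : WithConv (C →ₗ[k] k)) : leftHit (f * g) = leftHit g ∘ₗ leftHit f :=
  LinearMap.ext fun x => ext_dual k fun h => by
    rw [LinearMap.comp_apply, apply_leftHit, apply_leftHit, apply_leftHit, mul_assoc]

lemma leftHit_rightHit (f g : WithConv (C →ₗ[k] k)) (x : C) :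
    leftHit f (rightHit g x) = rightHit g (leftHit f x) :=
  ext_dual k fun h => by
    rw [apply_leftHit, apply_rightHit, apply_rightHit, apply_leftHit, mul_assoc]

lemma leftHit_add (f g : WithConv (C →ₗ[k] k)) : leftHit (f + g) = leftHit f + leftHit g :=
  LinearMap.ext fun x => by simp [leftHit, LinearMap.rTensor_add]

lemma leftHit_smul (r : k) (f : WithConv (C →ₗ[k] k)) : leftHit (r • f) = r • leftHit f :=
  LinearMap.ext fun x => by simp [leftHit, LinearMap.rTensor_smul]

variable (k C) in
/-- The opposite of the dual convolution algebra. It acts on `C` by `f • x = f(x₁) x₂`, and the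
submodules of `C` for this action are its left coideals. -/
def DualAlgebra : Type _ := (WithConv (C →ₗ[k] k))ᵐᵒᵖ

instance : Ring (DualAlgebra k C) := inferInstanceAs (Ring (WithConv (C →ₗ[k] k))ᵐᵒᵖ)

instance : Algebra k (DualAlgebra k C) := inferInstanceAs (Algebra k (WithConv (C →ₗ[k] k))ᵐᵒᵖ)

instance : Module (DualAlgebra k C) C where
  smul f := leftHit f.unop
  one_smul := LinearMap.congr_fun leftHit_one
  mul_smul f g := LinearMap.congr_fun (leftHit_mul g.unop f.unop)
  smul_zero f := map_zero (leftHit f.unop)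
  smul_add f := map_add (leftHit f.unop)
  add_smul f g := LinearMap.congr_fun (leftHit_add f.unop g.unop)
  zero_smul x := by
    change leftHit 0 x = 0
    simp [leftHit]

instance : IsScalarTower k (DualAlgebra k C) C where
  smul_assoc r f := LinearMap.congr_fun (leftHit_smul r f.unop)

/-- The submodule of `C` given by a left coideal. -/
def hitSubmodule (X : Submodule k C)
    (hX : ∀ f : WithConv (C →ₗ[k] k), ∀ x ∈ X, leftHit f x ∈ X) :
    Submodule (DualAlgebra k C) C where
  toAddSubmonoid := X.toAddSubmonoid
  smul_mem' f x hx := hX f.unop x hx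

lemma leftHit_mem_submodule (X : Submodule (DualAlgebra k C) C) (f : WithConv (C →ₗ[k] k)) {x : C}
    (hx : x ∈ X) : leftHit f x ∈ X :=
  X.smul_mem (MulOpposite.op f : DualAlgebra k C) hx

/-- The operator `x ↦ x₁ g(x₂)` as a module endomorphism. -/
def rightHitLin (g : WithConv (C →ₗ[k] k)) : C →ₗ[DualAlgebra k C] C where
  __ := rightHit g
  map_smul' f x := (leftHit_rightHit f.unop g x).symm

lemma exists_rightHit_eq (N : Submodule (DualAlgebra k C) C) (φ : N →ₗ[DualAlgebra k C] C) :
    ∃ g : WithConv (C →ₗ[k] k), ∀ x : N, φ x = rightHit g x := by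
  obtain ⟨g, hg⟩ := LinearMap.exists_extend (p := N.restrictScalars k)
    ((1 : WithConv (C →ₗ[k] k)).ofConv ∘ₗ φ.restrictScalars k)
  refine ⟨.toConv g, fun x => ext_dual k fun f => ?_⟩
  let f' : DualAlgebra k C := MulOpposite.op f
  calc f (φ x) = (1 : WithConv (C →ₗ[k] k)) (leftHit f (φ x)) := by rw [apply_leftHit, mul_one]
    _ = (1 : WithConv (C →ₗ[k] k)) (φ (f' • x)) := by rw [map_smul]; rfl
    _ = g (leftHit f x) := (LinearMap.congr_fun hg (f' • x)).symm
    _ = f (rightHit (.toConv g) x) := by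
      rw [apply_rightHit, ← apply_leftHit]

lemma isSubcoalgebra_of_hit {X : Submodule k C}
    (hl : ∀ f : WithConv (C →ₗ[k] k), ∀ x ∈ X, leftHit f x ∈ X)
    (hr : ∀ g : WithConv (C →ₗ[k] k), ∀ x ∈ X, rightHit g x ∈ X) : IsSubcoalgebra k X := by
  intro x hx
  obtain ⟨P, hP, hPX⟩ := exists_proj X
  suffices TensorProduct.map P P (comul x) = comul (R := k) x by
    rw [← this]
    exact map_mem_tensorSub (fun x _ => hP x) (fun x _ => hP x) (mem_tensorSub_top _)
  refine tensor_ext_dual fun f g => ?_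
  rw [← LinearMap.comp_apply (TensorProduct.map f g), ← TensorProduct.map_comp]
  calc (WithConv.toConv (f ∘ₗ P) * .toConv (g ∘ₗ P) : WithConv (C →ₗ[k] k)) x
      = (.toConv (f ∘ₗ P) * .toConv g : WithConv (C →ₗ[k] k)) x := by
        rw [← apply_leftHit, ← apply_leftHit]
        exact congrArg g (hPX _ (hl _ x hx))
    _ = (.toConv f * .toConv g : WithConv (C →ₗ[k] k)) x := by
        rw [← apply_rightHit, ← apply_rightHit]
        exact congrArg f (hPX _ (hr _ x hx))

lemma IsSubcoalgebra.leftHit_mem {X : Submodule k C} (hX : IsSubcoalgebra k X)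
    (f : WithConv (C →ₗ[k] k)) {x : C} (hx : x ∈ X) : leftHit f x ∈ X := by
  have : tensorSub k X X ≤ X.comap ((TensorProduct.lid k C).toLinearMap ∘ₗ f.ofConv.rTensor C) :=
    tensorSub_le.2 fun a _ b hb => by simpa using X.smul_mem (f a) hb
  exact this (hX x hx)

lemma IsSubcoalgebra.rightHit_mem {X : Submodule k C} (hX : IsSubcoalgebra k X)
    (g : WithConv (C →ₗ[k] k)) {x : C} (hx : x ∈ X) : rightHit g x ∈ X := by
  have : tensorSub k X X ≤ X.comap ((TensorProduct.rid k C).toLinearMap ∘ₗ g.ofConv.lTensor C) :=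
    tensorSub_le.2 fun a ha b _ => by simpa using X.smul_mem (g b) ha
  exact this (hX x hx)

lemma isotypicComponent_le_of_rightHit_mem {E S M : Submodule (DualAlgebra k C) C}
    (hE : ∀ g : WithConv (C →ₗ[k] k), ∀ x ∈ E, rightHit g x ∈ E) (hS : S ≤ E)
    (e : S ≃ₗ[DualAlgebra k C] M) : isotypicComponent (DualAlgebra k C) C M ≤ E := by
  refine sSup_le ?_
  rintro N ⟨e'⟩ x hx
  obtain ⟨g, hg⟩ := exists_rightHit_eq S (N.subtype ∘ₗ (e.trans e'.symm).toLinearMap)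
  obtain ⟨y, hy⟩ := (e.trans e'.symm).surjective ⟨x, hx⟩
  have hxy : x = rightHit g y := by
    rw [← hg y, LinearMap.comp_apply, LinearEquiv.coe_coe, hy, Submodule.subtype_apply]
  exact hxy ▸ hE g y (hS y.2)

lemma isSimpleSubcoalgebra_isotypicComponent (M : Submodule (DualAlgebra k C) C)
    [IsSimpleModule (DualAlgebra k C) M] :
    IsSimpleSubcoalgebra k ((isotypicComponent (DualAlgebra k C) C M).restrictScalars k) := by
  set I := isotypicComponent (DualAlgebra k C) C M
  refine ⟨isSubcoalgebra_of_hit (fun f x => leftHit_mem_submodule I f)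
    (fun g x hx => LinearMap.le_comap_isotypicComponent M (rightHitLin g) hx), ?_, ?_⟩
  · rw [Ne, Submodule.restrictScalars_eq_bot_iff]
    exact (bot_lt_isotypicComponent M).ne'
  · intro E hE hEI
    let E' := hitSubmodule E fun f x => hE.leftHit_mem f
    have hE'I : E' ≤ I := hEI
    have : IsSemisimpleModule (DualAlgebra k C) E' :=
      .of_injective (Submodule.inclusion hE'I) (Submodule.inclusion_injective _)
    rcases IsSemisimpleModule.eq_bot_or_exists_simple_le E' with hE' | ⟨S, hSE, hS⟩
    · exact .inl ((Submodule.restrictScalars_eq_bot_iff k _ _ (p := E')).2 hE')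
    · obtain ⟨e⟩ := isIsotypicOfType_submodule_iff.1 (.isotypicComponent _ C M) S
        (hSE.trans hE'I)
      exact .inr <| hEI.antisymm <|
        isotypicComponent_le_of_rightHit_mem (fun g x => hE.rightHit_mem g) hSE e

lemma simple_le_coradical (M : Submodule (DualAlgebra k C) C) [IsSimpleModule (DualAlgebra k C) M] :
    M.restrictScalars k ≤ coradical k C :=
  (Submodule.restrictScalars_mono k M.le_isotypicComponent).trans <|
    le_sSup (isSimpleSubcoalgebra_isotypicComponent M)

lemma map_simple_mem_coradical {Q : Type*} [AddCommGroup Q] [Module (DualAlgebra k C) Q]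
    (S : Submodule (DualAlgebra k C) Q) [IsSimpleModule (DualAlgebra k C) S]
    (ψ : Q →ₗ[DualAlgebra k C] C) {x : Q} (hx : x ∈ S) : ψ x ∈ coradical k C := by
  rcases LinearMap.injective_or_eq_zero (ψ ∘ₗ S.subtype) with hinj | h0
  · have : IsSimpleModule (DualAlgebra k C) (LinearMap.range (ψ ∘ₗ S.subtype)) :=
      .congr (LinearEquiv.ofInjective _ hinj).symm
    exact simple_le_coradical (LinearMap.range (ψ ∘ₗ S.subtype)) ⟨⟨x, hx⟩, rfl⟩
  · have : ψ x = 0 := LinearMap.congr_fun h0 ⟨x, hx⟩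
    rw [this]
    exact zero_mem _

lemma finite_span_singleton (x : C) :
    Module.Finite k ((Submodule.span (DualAlgebra k C) {x}).restrictScalars k) := by
  obtain ⟨s, hs⟩ := TensorProduct.exists_finset (comul (R := k) x)
  let W : Submodule k C := .span k (Prod.snd '' (s : Set (C × C)))
  have : Module.Finite k W := .span_of_finite k (s.finite_toSet.image _)
  refine Submodule.finiteDimensional_of_le (S₂ := W) fun y hy => ?_
  obtain ⟨f, rfl⟩ := Submodule.mem_span_singleton.1 hy
  change leftHit f.unop x ∈ W
  simp only [leftHit, LinearMap.comp_apply, hs, map_sum]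
  refine sum_mem fun p hp => ?_
  simpa using W.smul_mem _ (Submodule.subset_span ⟨p, hp, rfl⟩)

lemma leftHit_mem_coradFilt (n : ℕ) (f : WithConv (C →ₗ[k] k)) {x : C}
    (hx : x ∈ coradFilt k C n) : leftHit f x ∈ coradFilt k C n := by
  rw [← Subspace.forall_mem_dualAnnihilator_apply_eq_zero_iff]
  intro g hg
  rw [Submodule.mem_dualAnnihilator] at hg
  calc g (leftHit f x) = (f * .toConv g) x := apply_leftHit f (.toConv g) x
    _ = LinearMap.mul' k k (TensorProduct.map f.ofConv g (comul x)) := rfl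
    _ = 0 := by rw [map_comul_eq_zero_right _ hg hx, map_zero]

lemma rightHit_eq_zero_of_mem_coradFilt {n : ℕ} {g : WithConv (C →ₗ[k] k)}
    (hg : ∀ x ∈ coradFilt k C n, g x = 0) {x : C} (hx : x ∈ coradFilt k C n) :
    rightHit g x = 0 :=
  ext_dual k fun f => by
    rw [apply_rightHit, ← apply_leftHit, hg _ (leftHit_mem_coradFilt n f hx), map_zero]

lemma mem_coradFilt_succ_of_rightHit {n : ℕ} {y : C} (h : ∀ g : WithConv (C →ₗ[k] k),
    (∀ x ∈ coradFilt k C n, g x = 0) → rightHit g y ∈ coradical k C) :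
    y ∈ coradFilt k C (n + 1) := by
  rw [mem_coradFilt_succ]
  refine mem_of_map_mkQ_eq_zero (tensor_ext_dual fun f g => ?_)
  rw [← LinearMap.comp_apply (TensorProduct.map f g), ← TensorProduct.map_comp, map_zero, map_zero]
  let f' := WithConv.toConv (f ∘ₗ (coradical k C).mkQ)
  let g' := WithConv.toConv (g ∘ₗ (coradFilt k C n).mkQ)
  have hy : rightHit g' y ∈ coradical k C := h g' fun x hx => by
    simp [g', (Submodule.Quotient.mk_eq_zero _).2 hx]
  calc (f' * g') y = f' (rightHit g' y) := (apply_rightHit f' g' y).symm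
    _ = 0 := by simp [f', (Submodule.Quotient.mk_eq_zero _).2 hy]

/-- The socle of the nonzero finite-dimensional module `(N + Cₙ) / Cₙ` consists of classes of
elements of `Cₙ₊₁`. -/
lemma exists_mem_coradFilt_succ {N : Submodule (DualAlgebra k C) C}
    [Module.Finite k (N.restrictScalars k)] {n : ℕ} {x : C} (hxN : x ∈ N)
    (hx : x ∉ coradFilt k C n) :
    ∃ y ∈ N, y ∈ coradFilt k C (n + 1) ∧ y ∉ coradFilt k C n := by
  let F := hitSubmodule (coradFilt k C n) fun f x => leftHit_mem_coradFilt n f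
  let N' := N.map F.mkQ
  have : IsArtinian (DualAlgebra k C) N' :=
    have : IsArtinian (DualAlgebra k C) N :=
      isArtinian_of_tower k (inferInstanceAs (IsArtinian k (N.restrictScalars k)))
    isArtinian_of_surjective N (F.mkQ.submoduleMap N) (F.mkQ.submoduleMap_surjective N)
  have : Nontrivial N' :=
    ⟨⟨F.mkQ x, x, hxN, rfl⟩, 0, fun h =>
      hx ((Submodule.Quotient.mk_eq_zero F).1 (congrArg Subtype.val h))⟩
  obtain ⟨S, hS⟩ := IsAtomic.exists_atom (Submodule (DualAlgebra k C) N')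
  have : IsSimpleModule (DualAlgebra k C) S := isSimpleModule_iff_isAtom.2 hS
  obtain ⟨⟨_, y, hyN, rfl⟩, hyS, hy⟩ := S.exists_mem_ne_zero_of_ne_bot hS.1
  refine ⟨y, hyN, mem_coradFilt_succ_of_rightHit fun g hg => ?_,
    fun hyF => hy (Subtype.ext ((Submodule.Quotient.mk_eq_zero F).2 hyF))⟩
  have hker : F ≤ LinearMap.ker (rightHitLin g) := fun _ =>
    rightHit_eq_zero_of_mem_coradFilt hg
  exact map_simple_mem_coradical S (F.liftQ (rightHitLin g) hker ∘ₗ N'.subtype) hyS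

theorem exists_mem_coradFilt (x : C) : ∃ n, x ∈ coradFilt k C n := by
  set N := Submodule.span (DualAlgebra k C) {x}
  have : Module.Finite k (N.restrictScalars k) := finite_span_singleton x
  obtain ⟨n, hn⟩ := monotone_stabilizes_iff_noetherian.2
    (inferInstanceAs (IsNoetherian k (N.restrictScalars k)))
    ⟨fun n => (coradFilt k C n).comap (N.restrictScalars k).subtype,
      fun _ _ h => Submodule.comap_mono (coradFilt_mono h)⟩
  refine ⟨n, by_contra fun hx => ?_⟩
  obtain ⟨y, hyN, hy, hy'⟩ := exists_mem_coradFilt_succ (Submodule.mem_span_singleton_self x) hx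
  exact hy' ((SetLike.ext_iff.1 (hn (n + 1) n.le_succ) ⟨y, hyN⟩).2 hy)

end Exhaustion

section Lifting

variable {k H : Type*} [Field k] [Ring H] [HopfAlgebra k H]

namespace GrC

variable (k H) in
/-- The homogeneous part of degree `n` of an element of `gr_c H`. -/
def part (n : ℕ) : GrC k H →ₗ[k] grComp k H n := DirectSum.component k ℕ (grComp k H) n

lemma part_incl (n : ℕ) (y : grComp k H n) : part k H n (incl k H n y) = y :=
  DirectSum.component.lof_self k n y

lemma part_incl_of_ne {m n : ℕ} (h : m ≠ n) (y : grComp k H m) :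
    part k H n (incl k H m y) = 0 :=
  (DirectSum.component.of k n m y).trans (dif_neg h)

end GrC

variable [IsPointed k H]

/-- The subalgebra of `gr_c H` spanned by the classes of the elements of a subalgebra of `H`. -/
def grSubalgebra (U : Subalgebra k H) : Subalgebra k (GrC k H) :=
  (Submodule.span k {a | ∃ (n : ℕ) (x : coradFilt k H n),
    (x : H) ∈ U ∧ GrC.cls n x = a}).toSubalgebra
    (Submodule.subset_span ⟨0, ⟨1, one_mem_coradical⟩, U.one_mem, rfl⟩) (fun a b ha hb => by
      have := Submodule.mul_mem_mul ha hb
      rw [Submodule.span_mul_span] at this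
      refine Submodule.span_mono ?_ this
      rintro _ ⟨_, ⟨m, x, hx, rfl⟩, _, ⟨n, y, hy, rfl⟩, rfl⟩
      exact ⟨m + n, _, U.mul_mem hx hy, (GrC.cls_mul_cls x y).symm⟩)

lemma cls_mem_grSubalgebra {U : Subalgebra k H} {n : ℕ} {x : coradFilt k H n} (hx : (x : H) ∈ U) :
    GrC.cls n x ∈ grSubalgebra U :=
  Submodule.subset_span ⟨n, x, hx, rfl⟩

lemma exists_part_eq_mk {U : Subalgebra k H} {a : GrC k H} (ha : a ∈ grSubalgebra U) (n : ℕ) :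
    ∃ x : coradFilt k H n, (x : H) ∈ U ∧ Submodule.Quotient.mk x = GrC.part k H n a := by
  suffices Subalgebra.toSubmodule (grSubalgebra U) ≤
      ((U.toSubmodule.submoduleOf (coradFilt k H n)).map (Submodule.mkQ _)).comap
        (GrC.part k H n) from this ha
  refine Submodule.span_le.2 ?_
  rintro _ ⟨m, x, hx, rfl⟩
  rcases eq_or_ne m n with rfl | h
  · exact ⟨x, hx, (GrC.part_incl m _).symm⟩
  · exact ⟨0, zero_mem _, (GrC.part_incl_of_ne h _).symm⟩

lemma mem_of_grSubalgebra_eq_top {U : Subalgebra k H} (hU : grSubalgebra U = ⊤) (n : ℕ) {x : H}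
    (hx : x ∈ coradFilt k H n) : x ∈ U := by
  have mem_of_coradPred_le (n : ℕ) (hn : coradPred k H n ≤ U.toSubmodule) (x : coradFilt k H n) :
      (x : H) ∈ U := by
    obtain ⟨y, hy, hyx⟩ := exists_part_eq_mk (hU ▸ Algebra.mem_top : GrC.cls n x ∈ _) n
    have hxy : (x - y : H) ∈ coradPred k H n :=
      (Submodule.Quotient.eq ((coradPred k H n).submoduleOf (coradFilt k H n))).1
        (hyx.trans (GrC.part_incl n _)).symm
    simpa using U.add_mem (hn hxy) hy
  induction n generalizing x with
  | zero => exact mem_of_coradPred_le 0 bot_le ⟨x, hx⟩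
  | succ n ih => exact mem_of_coradPred_le (n + 1) (fun _ => ih) ⟨x, hx⟩

lemma eq_top_of_grSubalgebra_eq_top {U : Subalgebra k H} (hU : grSubalgebra U = ⊤) : U = ⊤ :=
  eq_top_iff.2 fun x _ =>
    have ⟨n, hn⟩ := exists_mem_coradFilt (k := k) x
    mem_of_grSubalgebra_eq_top hU n hn

lemma exists_finset_mem_grSubalgebra (a : GrC k H) :
    ∃ t : Finset H, ∀ U : Subalgebra k H, (t : Set H) ⊆ U → a ∈ grSubalgebra U := by
  classical
  induction a using GrC.induction with
  | h0 => exact ⟨∅, fun U _ => zero_mem _⟩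
  | hadd a b ha hb =>
    obtain ⟨s, hs⟩ := ha
    obtain ⟨t, ht⟩ := hb
    refine ⟨s ∪ t, fun U hU => ?_⟩
    rw [Finset.coe_union, Set.union_subset_iff] at hU
    exact add_mem (hs U hU.1) (ht U hU.2)
  | h n x => exact ⟨{(x : H)}, fun U hU => cls_mem_grSubalgebra (hU (by simp))⟩

theorem finiteType_of_grC (h : Algebra.FiniteType k (GrC k H)) : Algebra.FiniteType k H := by
  classical
  obtain ⟨s, hs⟩ := h
  choose t ht using exists_finset_mem_grSubalgebra (k := k) (H := H)
  refine ⟨s.biUnion t, eq_top_of_grSubalgebra_eq_top ?_⟩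
  rw [eq_top_iff, ← hs]
  refine Algebra.adjoin_le fun a ha => ht a _ fun x hx => Algebra.subset_adjoin ?_
  exact Finset.mem_biUnion.2 ⟨a, ha, hx⟩

end Lifting

section GradedProjection

open Coalgebra HopfAlgebra

variable {k H : Type*} [Field k] [Ring H] [HopfAlgebra k H]

namespace GrC

lemma mem_component {n : ℕ} {a : GrC k H} :
    a ∈ component k H n ↔ ∃ x : coradFilt k H n, cls n x = a := by
  rw [component, ← Submodule.map_top, ← Submodule.range_mkQ, ← LinearMap.range_comp]
  rfl

lemma symb_mem_component {n : ℕ} {x : H} (hx : x ∈ coradFilt k H n) :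
    symb (k := k) n x ∈ component k H n :=
  mem_component.2 ⟨⟨x, hx⟩, (symb_coe n _).symm⟩

variable (k H) in
lemma isInternal_component : DirectSum.IsInternal (component k H) := by
  rw [DirectSum.isInternal_submodule_iff_iSupIndep_and_iSup_eq_top]
  refine ⟨fun n => Submodule.disjoint_def.2 ?_, eq_top_iff.2 fun a _ => ?_⟩
  · rintro _ ⟨y, rfl⟩ hy
    have hle : ⨆ m, ⨆ (_ : m ≠ n), component k H m ≤ LinearMap.ker (part k H n) :=
      iSup₂_le fun m hmn => by
        rintro _ ⟨z, rfl⟩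
        exact part_incl_of_ne hmn z
    have hy0 : y = 0 := (part_incl n y).symm.trans (hle hy)
    rw [hy0, map_zero]
  · induction a using induction with
    | h0 => exact zero_mem _
    | hadd a b ha hb => exact add_mem (ha trivial) (hb trivial)
    | h n x => exact Submodule.mem_iSup_of_mem n ⟨_, rfl⟩

lemma comul_mem_component {n : ℕ} {a : GrC k H} (ha : a ∈ component k H n) :
    comul (R := k) a ∈ ⨆ p ∈ Finset.HasAntidiagonal.antidiagonal n,
      tensorSub k (component k H p.1) (component k H p.2) := by
  obtain ⟨x, rfl⟩ := mem_component.1 ha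
  rw [comul_cls]
  suffices tensorFilt k H n ≤ (⨆ p ∈ Finset.HasAntidiagonal.antidiagonal n,
      tensorSub k (component k H p.1) (component k H p.2)).comap (symb₂ n) from
    this (comul_mem_tensorFilt x.2)
  refine tensorFilt_le fun i j hij x hx y hy => ?_
  rw [Submodule.mem_comap, symb₂_tmul hij hx hy]
  exact Submodule.mem_iSup_of_mem (i, j) <|
    Submodule.mem_iSup_of_mem (Finset.HasAntidiagonal.mem_antidiagonal.2 hij) <|
      tmul_mem_tensorSub (symb_mem_component hx) (symb_mem_component hy)

variable [IsPointed k H]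

variable (k H) in
/-- The inclusion of the coradical as the component of degree zero. -/
def inclZero : corad k H →ₐ[k] GrC k H :=
  AlgHom.ofLinearMap
    { toFun x := cls 0 ⟨x, x.2⟩
      map_add' x y := map_add (cls 0) (⟨x, x.2⟩ : coradFilt k H 0) ⟨y, y.2⟩
      map_smul' c x := map_smul (cls 0) c (⟨x, x.2⟩ : coradFilt k H 0) }
    one_eq_cls.symm
    fun x y => (cls_mul_cls (⟨x, x.2⟩ : coradFilt k H 0) (⟨y, y.2⟩ : coradFilt k H 0)).symm

lemma inclZero_apply (x : corad k H) : inclZero k H x = cls 0 ⟨(x : H), x.2⟩ := rfl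

lemma projZero_cls_zero (x : coradFilt k H 0) : projZero k H (cls 0 x) = ⟨x, x.2⟩ :=
  projZeroLin_cls_zero x

lemma projZero_cls_pos {n : ℕ} (hn : n ≠ 0) (x : coradFilt k H n) : projZero k H (cls n x) = 0 :=
  projZeroLin_cls_pos hn x

lemma projZero_inclZero (x : corad k H) : projZero k H (inclZero k H x) = x :=
  projZero_cls_zero _

lemma isGroupLikeElem_corad {g : H} (hg : IsGroupLikeElem k g) :
    IsGroupLikeElem k (⟨g, groupLike_mem_coradical hg⟩ : corad k H) where
  counit_eq_one := hg.counit_eq_one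
  comul_eq_tmul_self := corad.incl₂_injective k H <| by
    rw [corad.incl₂_comul, corad.incl₂_tmul]
    exact hg.comul_eq_tmul_self

variable (k H) in
lemma span_groupLike_corad : Submodule.span k {g : corad k H | IsGroupLikeElem k g} = ⊤ := by
  have hle : coradical k H ≤ (Submodule.span k {g : corad k H | IsGroupLikeElem k g}).map
      (corad k H).val.toLinearMap := by
    rw [coradical_eq_span]
    exact Submodule.span_le.2 fun g hg =>
      ⟨_, Submodule.subset_span (isGroupLikeElem_corad hg), rfl⟩
  refine eq_top_iff.2 fun x _ => ?_
  obtain ⟨y, hy, hyx⟩ := hle x.2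
  exact Subtype.ext hyx ▸ hy

lemma symb₂_incl₂ (u : corad k H ⊗[k] corad k H) : symb₂ 0 (corad.incl₂ k H u) =
    TensorProduct.map (inclZero k H).toLinearMap (inclZero k H).toLinearMap u := by
  induction u with
  | zero => simp
  | add u v hu hv => simp only [map_add, hu, hv]
  | tmul x y =>
    rw [corad.incl₂_tmul, symb₂_tmul (zero_add 0) x.2 y.2, symb_coe 0 ⟨(x : H), x.2⟩,
      symb_coe 0 ⟨(y : H), y.2⟩]
    rfl

lemma comul_inclZero (x : corad k H) : comul (R := k) (inclZero k H x) =
    TensorProduct.map (inclZero k H).toLinearMap (inclZero k H).toLinearMap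
      (comul (R := k) x) := by
  rw [inclZero_apply, comul_cls, ← symb₂_incl₂, corad.incl₂_comul]

lemma map_projZero_symb₂ {n : ℕ} (hn : n ≠ 0) {u : H ⊗[k] H} (hu : u ∈ tensorFilt k H n) :
    TensorProduct.map (projZero k H).toLinearMap (projZero k H).toLinearMap (symb₂ n u) = 0 := by
  suffices tensorFilt k H n ≤ LinearMap.ker (TensorProduct.map (projZero k H).toLinearMap
      (projZero k H).toLinearMap ∘ₗ symb₂ n) from this hu
  refine tensorFilt_le fun i j hij x hx y hy => ?_
  rw [LinearMap.mem_ker, LinearMap.comp_apply, symb₂_tmul hij hx hy, TensorProduct.map_tmul,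
    symb_coe i ⟨x, hx⟩, symb_coe j ⟨y, hy⟩, AlgHom.toLinearMap_apply, AlgHom.toLinearMap_apply]
  rcases eq_or_ne i 0 with hi | hi
  · rw [projZero_cls_pos (by omega : j ≠ 0), TensorProduct.tmul_zero]
  · rw [projZero_cls_pos hi, TensorProduct.zero_tmul]

lemma comul_projZero (a : GrC k H) : comul (R := k) (projZero k H a) =
    TensorProduct.map (projZero k H).toLinearMap (projZero k H).toLinearMap
      (comul (R := k) a) := by
  induction a using induction with
  | h0 => simp
  | hadd a b ha hb => simp only [map_add, ha, hb]
  | h n x =>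
    rcases eq_or_ne n 0 with rfl | hn
    · have proj_comp_incl : (projZero k H).toLinearMap ∘ₗ (inclZero k H).toLinearMap = .id :=
        LinearMap.ext projZero_inclZero
      let x' : corad k H := ⟨x, x.2⟩
      change _ = TensorProduct.map _ _ (comul (R := k) (inclZero k H x'))
      rw [projZero_cls_zero, comul_inclZero, ← LinearMap.comp_apply, ← TensorProduct.map_comp,
        proj_comp_incl, TensorProduct.map_id, LinearMap.id_apply]
    · rw [projZero_cls_pos hn, map_zero, comul_cls,
        map_projZero_symb₂ hn (comul_mem_tensorFilt x.2)]

lemma counit_projZero (a : GrC k H) :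
    counit (R := k) (projZero k H a) = counit (R := k) a := by
  induction a using induction with
  | h0 => simp
  | hadd a b ha hb => simp only [map_add, ha, hb]
  | h n x =>
    rcases eq_or_ne n 0 with rfl | hn
    · rw [projZero_cls_zero, counit_cls_zero]
      rfl
    · rw [projZero_cls_pos hn, counit_cls_pos hn, map_zero]

variable (k H) in
theorem isGradedProjection :
    IsGradedProjection (projZero k H) (inclZero k H) (component k H) where
  comul_proj := comul_projZero
  counit_proj := counit_projZero
  comul_incl := comul_inclZero
  counit_incl x := counit_cls_zero _
  proj_incl := projZero_inclZero
  span_groupLike := span_groupLike_corad k H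
  isInternal := isInternal_component k H
  mul_mem ha hb := by
    obtain ⟨x, rfl⟩ := mem_component.1 ha
    obtain ⟨y, rfl⟩ := mem_component.1 hb
    exact mem_component.2 ⟨_, (cls_mul_cls x y).symm⟩
  comul_mem := comul_mem_component
  antipode_mem ha := by
    obtain ⟨x, rfl⟩ := mem_component.1 ha
    exact mem_component.2 ⟨_, (antipode_cls _ x).symm⟩
  proj_eq_zero hn ha := by
    obtain ⟨x, rfl⟩ := mem_component.1 ha
    exact projZero_cls_pos hn x
  incl_mem x := mem_component.2 ⟨_, rfl⟩
  exists_incl a ha := by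
    obtain ⟨x, rfl⟩ := mem_component.1 ha
    exact ⟨⟨x, x.2⟩, rfl⟩

end GrC

end GradedProjection

end PointedHopf

end

theorem corollary2p3 {k H : Type*} [Field k] [Ring H] [HopfAlgebra k H]
    [PointedHopf.IsPointed k H]
    (hN : IsNoetherianRing (PointedHopf.GrC k H) ∨ IsNoetherianRing (PointedHopf.GrC k H)ᵐᵒᵖ) :
    Algebra.FiniteType k (PointedHopf.corad k H) ∧
    Algebra.FiniteType k (PointedHopf.GrC k H) ∧
    Algebra.FiniteType k H ∧
    Algebra.FiniteType k (PointedHopf.GrC.braidedPart k H) ∧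
    ∃ (D : PointedHopf.BraidedHopfData k (PointedHopf.corad k H)
        (PointedHopf.GrC.braidedPart k H))
      (Φ : PointedHopf.GrC.braidedPart k H ⊗[k] PointedHopf.corad k H ≃ₗ[k] PointedHopf.GrC k H),
      D.IsBraidedHopfAlgebra ∧
      D.IsGraded (PointedHopf.GrC.braidedComponent k H) ∧
      PointedHopf.GrC.braidedComponent k H 0 = Submodule.span k {1} ∧
      D.IsBiproductIso (PointedHopf.GrC.braidedComponent k H) (PointedHopf.GrC.component k H)
        Φ := by
  have h := PointedHopf.GrC.isGradedProjection k H
  have hA := h.finiteType hN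
  exact ⟨h.finiteType_base hN, hA, PointedHopf.finiteType_of_grC hA, h.finiteType_coinv hN,
    h.braided, h.biproductEquiv, h.isBraidedHopfAlgebra, h.isGraded, h.gradedCoinv_zero,
    h.isBiproductIso h.map_biproductEquiv⟩
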